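/- Let $t\in\mathbb C\setminus\{0,1\}$ and $\theta_0,\theta_1,\theta_t,\theta_\infty,\lambda,\mu\in\mathbb C$. Put $\kappa_1=(\theta_\infty-\theta_0-\theta_1-\theta_t)/2$, $\kappa_2=-(\theta_\infty+\theta_0+\theta_1+\theta_t)/2$, and for $\lambda\notin\{0,1,t\}$ let $D_{y_1}(\theta_0,\theta_1,\theta_t,\theta_\infty;\lambda,\mu)$ be the Fuchsian equation $$y''+\Bigl(\tfrac{1-\theta_0}{z}+\tfrac{1-\theta_1}{z-1}+\tfrac{1-\theta_t}{z-t}-\tfrac1{z-\lambda}\Bigr)y'+\Bigl(\tfrac{\kappa_1(\kappa_2+1)}{z(z-1)}+\tfrac{\lambda(\lambda-1)\mu}{z(z-1)(z-\lambda)}-\tfrac{t(t-1)H}{z(z-1)(z-t)}\Bigr)y=0,$$ where $$H=\tfrac{1}{t(t-1)}\bigl\{\lambda(\lambda-1)(\lambda-t)\mu^2-\{\theta_0(\lambda-1)(\lambda-t)+\theta_1\lambda(\lambda-t)+(\theta_t-1)\lambda(\lambda-1)\}\mu+\kappa_1(\kappa_2+1)(\lambda-t)\bigr\}.$$ Its exponents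 are $0,\theta_p$ at $p\in\{0,1,t\}$, $0,2$ at $\lambda$ (an apparent singularity), and $\kappa_1,\kappa_2+1$ at $\infty$. A singularity $p\in\{0,1,t,\infty\}$ is called non-logarithmic if no logarithm occurs in the local solutions there, i.e. if there are solutions near $p$ of the form $x^{\rho}g(x)$ and $x^{\sigma}\tilde g(x)$ with $\rho\ne\sigma$, where $x=z-p$ (or $x=1/z$ for $p=\infty$) and $g,\tilde g$ are holomorphic at $x=0$ and do not vanish there; in particular a singularity with two equal exponents is logarithmic. Let $\tilde\theta_p=\kappa_2+\theta_p$ for $p=0,1,t,\infty$ and $$\tilde\lambda=\lambda-\frac{\kappa_2}{\mu-\frac{\theta_0}{\lambda}-\frac{\theta_1}{\lambda-1}-\frac{\theta_t}{\lambda-t}},\qquad \tilde\mu=\frac{\kappa_2+\theta_0}{\tilde\lambda}+\frac{\kappa_2+\theta_1}{\tilde\lambda-1}+\frac{\kappa_2+\theta_t}{\tilde\lambda-t}+\frac{\kappa_2}{\lambda-\tilde\lambda}.$$ Assume $\lambda,\tilde\lambda\notin\{0,1,t,\infty\}$; here $\tilde\lambda\neq\infty$ means that the denominator in the definition of $\tilde\lambda$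 is non-zero. Let $\{a,b,c\}=\{0,1,t\}$ with $a,b,c$ distinct, and write $D=D_{y_1}(\theta_0,\theta_1,\theta_t,\theta_\infty;\lambda,\mu)$ (variable $w$) and $\tilde D=D_{y_1}(\tilde\theta_0,\tilde\theta_1,\tilde\theta_t,\tilde\theta_\infty;\tilde\lambda,\tilde\mu)$ (variable $z$). (i) If $\theta_a\in\mathbb Z_{\le-1}$, $\kappa_2\notin\mathbb Z$ and the singularity $w=a$ of $D$ is non-logarithmic, then $\tilde D$ has a non-zero solution $(z-a)^{\tilde\theta_a}h(z)$ with $h$ a polynomial of degree at most $-\theta_a-1$. If moreover $\kappa_1\notin\mathbb Z$, then $\deg h=-\theta_a-1$. (ii) If $\theta_a\in\mathbb Z_{\ge0}$, $\kappa_1,\kappa_2,\tilde\theta_b,\tilde\theta_c\notin\mathbb Z$ and the singularity $w=a$ of $D$ is non-logarithmic, then $\tilde D$ has a non-zero solution $(z-b)^{\tilde\theta_b}(z-c)^{\tilde\theta_c}h(z)$ with $h$ a polynomial of degree $\theta_a$. (iii) If $\tilde\theta_a\in\mathbb Z_{\le0}$, $\kappa_2,\theta_\infty\notin\mathbb Z$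 and $D$ has a non-zero solution $(w-a)^{\theta_a}h(w)$ with $h$ a polynomial, then the singularity $z=a$ of $\tilde D$ is non-logarithmic. (iv) If $\tilde\theta_a\in\mathbb Z_{\ge1}$, $\kappa_2,\theta_\infty,\theta_b,\theta_c\notin\mathbb Z$ and $D$ has a non-zero solution $(w-b)^{\theta_b}(w-c)^{\theta_c}h(w)$ with $h$ a polynomial, then the singularity $z=a$ of $\tilde D$ is non-logarithmic. (v) If $\theta_\infty\in\mathbb Z_{\le0}$, $\kappa_2\notin\mathbb Z$ and the singularity $w=\infty$ of $D$ is non-logarithmic, then $\tilde D$ has a non-zero polynomial solution of degree $-\theta_\infty$. (vi) If $\theta_\infty\in\mathbb Z_{\ge1}$, $\kappa_2,\tilde\theta_0,\tilde\theta_1,\tilde\theta_t\notin\mathbb Z$ and the singularity $w=\infty$ of $D$ is non-logarithmic, then $\tilde D$ has a non-zero solution $z^{\tilde\theta_0}(z-1)^{\tilde\theta_1}(z-t)^{\tilde\theta_t}h(z)$ with $h$ a polynomial of degree $\theta_\infty-1$. (vii) If $\kappa_1\in\mathbb Z_{\le0}$, $\kappa_2,\theta_0\notin\mathbb Z$ and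 $D$ has a non-zero polynomial solution, then the singularity $z=\infty$ of $\tilde D$ is non-logarithmic. (viii) If $\kappa_1\in\mathbb Z_{\ge1}$, $\kappa_2,\theta_0,\theta_1,\theta_t\notin\mathbb Z$ and $D$ has a non-zero solution $w^{\theta_0}(w-1)^{\theta_1}(w-t)^{\theta_t}h(w)$ with $h$ a polynomial, then the singularity $z=\infty$ of $\tilde D$ is non-logarithmic. -/

import Mathlib

/-- The data of the equation `D_{y₁}(θ₀, θ₁, θ_t, θ_∞; λ, μ)` with finite singularities `0, 1, t`
and `λ`. The indices `0, 1, 2 : Fin 3` stand for the points `0, 1, t`, so that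
`θ 0 = θ₀`, `θ 1 = θ₁`, `θ 2 = θ_t`. -/
structure LinP6 where
  t : ℂ
  θ : Fin 3 → ℂ
  θinf : ℂ
  lam : ℂ
  mu : ℂ

namespace LinP6

noncomputable section

/-- The three points `0, 1, t`. -/
def pt (D : LinP6) : Fin 3 → ℂ := ![0, 1, D.t]

def kappa1 (D : LinP6) : ℂ := (D.θinf - D.θ 0 - D.θ 1 - D.θ 2) / 2

def kappa2 (D : LinP6) : ℂ := -(D.θinf + D.θ 0 + D.θ 1 + D.θ 2) / 2

/-- The Hamiltonian of the sixth Painlevé system. -/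
def H (D : LinP6) : ℂ :=
  1 / (D.t * (D.t - 1)) *
    (D.lam * (D.lam - 1) * (D.lam - D.t) * D.mu ^ 2
      - (D.θ 0 * (D.lam - 1) * (D.lam - D.t) + D.θ 1 * D.lam * (D.lam - D.t)
          + (D.θ 2 - 1) * D.lam * (D.lam - 1)) * D.mu
      + D.kappa1 * (D.kappa2 + 1) * (D.lam - D.t))

/-- The coefficient of `y'`. -/
def coeffP (D : LinP6) (z : ℂ) : ℂ :=
  (1 - D.θ 0) / z + (1 - D.θ 1) / (z - 1) + (1 - D.θ 2) / (z - D.t) - 1 / (z - D.lam)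

/-- The coefficient of `y`. -/
def coeffQ (D : LinP6) (z : ℂ) : ℂ :=
  D.kappa1 * (D.kappa2 + 1) / (z * (z - 1))
    + D.lam * (D.lam - 1) * D.mu / (z * (z - 1) * (z - D.lam))
    - D.t * (D.t - 1) * D.H / (z * (z - 1) * (z - D.t))

/-- `y` is a holomorphic solution of `y'' + P y' + Q y = 0` on the set `U`; used only for open sets
`U` that avoid the finite singularities. -/
def IsSolutionOn (D : LinP6) (U : Set ℂ) (y : ℂ → ℂ) : Prop :=
  DifferentiableOn ℂ y U ∧
    ∀ z ∈ U, deriv (deriv y) z + D.coeffP z * deriv y z + D.coeffQ z * y z = 0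

/-- `ℓ` is a holomorphic branch of `log (z - p)` on the set `U`. -/
def IsLogBranch (U : Set ℂ) (p : ℂ) (ℓ : ℂ → ℂ) : Prop :=
  DifferentiableOn ℂ ℓ U ∧ ∀ z ∈ U, Complex.exp (ℓ z) = z - p

/-- The multivalued function `z ^ ρ₀ (z - 1) ^ ρ₁ (z - t) ^ ρ₂ h(z)` is a solution: all its branches,
on all open sets that avoid the singularities, are solutions. -/
def IsPolyTypeSolution (D : LinP6) (ρ : Fin 3 → ℂ) (h : Polynomial ℂ) : Prop :=
  ∀ (U : Set ℂ) (ℓ : Fin 3 → ℂ → ℂ), IsOpen U → D.lam ∉ U →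
    (∀ i, IsLogBranch U (D.pt i) (ℓ i)) →
    D.IsSolutionOn U (fun z => Complex.exp (∑ i, ρ i * ℓ i z) * h.eval z)

/-- Near the point `p = D.pt i` there is a solution `(z - p) ^ ρ g(z)` with `g` holomorphic at `p`
and `g(p) ≠ 0`. -/
def HasFrobeniusSolution (D : LinP6) (i : Fin 3) (ρ : ℂ) : Prop :=
  ∃ (g : ℂ → ℂ) (r : ℝ), AnalyticAt ℂ g (D.pt i) ∧ g (D.pt i) ≠ 0 ∧ 0 < r ∧
    ∀ (U : Set ℂ) (ℓ : ℂ → ℂ), IsOpen U → U ⊆ Metric.ball (D.pt i) r \ {D.pt i} →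
      IsLogBranch U (D.pt i) ℓ →
      D.IsSolutionOn U (fun z => Complex.exp (ρ * ℓ z) * g z)

/-- Near `∞` there is a solution `(1/z) ^ ρ g(1/z)` with `g` holomorphic at `0` and `g(0) ≠ 0`. -/
def HasFrobeniusSolutionInfty (D : LinP6) (ρ : ℂ) : Prop :=
  ∃ (g : ℂ → ℂ) (R : ℝ), AnalyticAt ℂ g 0 ∧ g 0 ≠ 0 ∧ 0 < R ∧
    ∀ (U : Set ℂ) (ℓ : ℂ → ℂ), IsOpen U → U ⊆ {z | R < ‖z‖} →
      IsLogBranch U 0 ℓ →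
      D.IsSolutionOn U (fun z => Complex.exp (-ρ * ℓ z) * g z⁻¹)

/-- The singularity `D.pt i` is non-logarithmic: no logarithm occurs in the local solutions, that is,
there are Frobenius solutions without logarithm for two different exponents (which then form a basis
of the local solutions; if the two exponents coincide, the singularity is logarithmic). -/
def NonLogarithmicAt (D : LinP6) (i : Fin 3) : Prop :=
  ∃ ρ σ : ℂ, ρ ≠ σ ∧ D.HasFrobeniusSolution i ρ ∧ D.HasFrobeniusSolution i σ

/-- The singularity `∞` is non-logarithmic. -/
def NonLogarithmicAtInfty (D : LinP6) : Prop :=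
  ∃ ρ σ : ℂ, ρ ≠ σ ∧ D.HasFrobeniusSolutionInfty ρ ∧ D.HasFrobeniusSolutionInfty σ

/-- The denominator in the definition of `λ̃`; `λ̃ = ∞` when it vanishes (and `κ₂ ≠ 0`). -/
def tildeDenom (D : LinP6) : ℂ :=
  D.mu - D.θ 0 / D.lam - D.θ 1 / (D.lam - 1) - D.θ 2 / (D.lam - D.t)

def lamTilde (D : LinP6) : ℂ := D.lam - D.kappa2 / D.tildeDenom

def muTilde (D : LinP6) : ℂ :=
  (D.kappa2 + D.θ 0) / D.lamTilde + (D.kappa2 + D.θ 1) / (D.lamTilde - 1)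
    + (D.kappa2 + D.θ 2) / (D.lamTilde - D.t) + D.kappa2 / (D.lam - D.lamTilde)

/-- The data of `D_{y₁}(θ̃₀, θ̃₁, θ̃_t, θ̃_∞; λ̃, μ̃)`, where `θ̃_p = κ₂ + θ_p`. -/
def tilde (D : LinP6) : LinP6 where
  t := D.t
  θ := fun i => D.kappa2 + D.θ i
  θinf := D.kappa2 + D.θinf
  lam := D.lamTilde
  mu := D.muTilde

end

end LinP6

/-- `x ∉ ℤ`. -/
def NotInt (x : ℂ) : Prop := ∀ n : ℤ, x ≠ (n : ℂ)

open Filter Topology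

/-! ### Rank-one realizations of the equation as a two by two Fuchsian system. -/

namespace LinP6

noncomputable section

/-! The equation is what the first component `y` of a two by two Fuchsian system satisfies, the
residue at `p_i` being the column `(1, c_i)` times the row `(l_i, ρ_i)`. If `w` is the second
component, the vector `G_i = (l_i y + ρ_i w) / (z - p_i)` solves the Okubo system `(z - T) G' = (M -
1) G`, where `T = diag(0, 1, t)` and `M i j = l_i + ρ_i c_j`. Conversely the component sum of any
solution of `(z - T) G' = M G` solves the equation. The matrix `M` has diagonal entries `θ_i` and
rank at most two, and its non-zero eigenvalues can only be `-κ₁` and `-κ₂`. The passage to the tilde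
parameters is the shift of `M` by `κ₂` (`tilde_matrix_eq`), that is, middle convolution.

No Euler integral is used: the convolution acts on series coefficients. If `(z - a)^(ρ-1) ∑ F_k (z -
a)^k` solves the system of `M - 1`, then multiplying `F_k` by a quotient of Gamma values
(`shiftFactor`) gives a formal solution with exponent `κ + ρ` for `M + κ` (`image_rec`). For `ρ =
-n` the factors vanish beyond index `n`, so a Frobenius solution without logarithm becomes a finite
sum, hence a solution of polynomial type (`exists_finite`, `isPolyTypeSolution`). Its degree is read
off from the last non-zero coefficient, which is an eigenvector: an eigenvector of non-zero sum
belongs to `-κ₁`, and one of zero sum is a multiple of `ρ` and lowers the degree by exactly one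
(`sum_top`).

In the other direction, a finite sum ends exactly at the resonant index of the convolved series. The
vector left over there lies in the kernel of the shifted matrix and has sum zero, so the logarithm
it creates in the Okubo vector cancels in the component sum (`hasFrobeniusSolution_neg`,
`ConvPair.nonLogarithmicAt`). At infinity the factors are `inftyFactor`; there the obstruction at
the resonance lies in the image of `M`, and a second solution starts from a kernel vector of `M`
(`ConvPair.nonLogarithmicAtInfty`).

Division by `z^θ₀ (z-1)^θ₁ (z-t)^θ_t` leads to the dual equation. Its Okubo matrix is minus the
transpose of `M` up to a diagonal gauge, so a `ConvPair` for `κ` dualizes to one for `-κ`. Parts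
(ii), (iv), (vi), (viii) come from the lemmas behind (i), (iii), (v), (vii) applied to the dual
pair. -/

/-- The equation has three distinct singular points and `λ` is none of them. -/
structure Regular (D : LinP6) : Prop where
  t_ne_zero : D.t ≠ 0
  t_ne_one : D.t ≠ 1
  lam_ne : ∀ i, D.lam ≠ D.pt i

/-- The residues of `(z - λ) / (z (z - 1) (z - t))` at `0, 1, t`. -/
def rho (D : LinP6) : Fin 3 → ℂ :=
  ![-D.lam / D.t, (1 - D.lam) / (1 - D.t), (D.t - D.lam) / (D.t * (D.t - 1))]

/-- A two by two Fuchsian system with residue matrices of rank one whose first component satisfies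
the equation: the residue at `D.pt i` is the product of the column `(1, c i)` and the row
`(l i, D.rho i)`. -/
structure Realization (D : LinP6) where
  l : Fin 3 → ℂ
  c : Fin 3 → ℂ
  diag : ∀ i, l i + D.rho i * c i = D.θ i
  sum_l : ∑ i, l i = -D.kappa1
  sum_div : ∑ i, l i / (D.lam - D.pt i) = D.mu

variable {D : LinP6}

namespace Regular

theorem lam_ne_zero (h : D.Regular) : D.lam ≠ 0 := by simpa [pt] using h.lam_ne 0
theorem lam_ne_one (h : D.Regular) : D.lam ≠ 1 := by simpa [pt] using h.lam_ne 1
theorem lam_ne_t (h : D.Regular) : D.lam ≠ D.t := by simpa [pt] using h.lam_ne 2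

theorem pt_injective (h : D.Regular) : Function.Injective D.pt := by
  have h0 := h.t_ne_zero
  have h1 := h.t_ne_one
  intro i j hij
  fin_cases i <;> fin_cases j <;> simp_all [pt, eq_comm]

theorem rho_ne_zero (h : D.Regular) (i : Fin 3) : D.rho i ≠ 0 := by
  have h0 := h.t_ne_zero
  have h1 := sub_ne_zero.2 h.t_ne_one
  have h1' := sub_ne_zero.2 h.t_ne_one.symm
  have h2 := h.lam_ne_zero
  have h3 := sub_ne_zero.2 h.lam_ne_one.symm
  have h4 := sub_ne_zero.2 h.lam_ne_t.symm
  fin_cases i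
  · simpa [rho] using ⟨h2, h0⟩
  · simpa [rho] using ⟨h3, h1'⟩
  · simpa [rho] using ⟨h4, h0, h1⟩

theorem sum_rho (h : D.Regular) : ∑ i, D.rho i = 0 := by
  have h0 := h.t_ne_zero
  have h1 := sub_ne_zero.2 h.t_ne_one
  have h1' := sub_ne_zero.2 h.t_ne_one.symm
  simp only [rho, Fin.sum_univ_three, Matrix.cons_val]
  field_simp
  ring

theorem sum_pt_rho (h : D.Regular) : ∑ i, D.pt i * D.rho i = 1 := by
  have h0 := h.t_ne_zero
  have h1 := sub_ne_zero.2 h.t_ne_one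
  have h1' := sub_ne_zero.2 h.t_ne_one.symm
  simp only [rho, pt, Fin.sum_univ_three, Matrix.cons_val]
  field_simp
  ring

theorem sum_rho_div (h : D.Regular) {z : ℂ} (hz : ∀ i, z ≠ D.pt i) :
    ∑ i, D.rho i / (z - D.pt i) = (z - D.lam) / (z * (z - 1) * (z - D.t)) := by
  have h0 := h.t_ne_zero
  have h1 := sub_ne_zero.2 h.t_ne_one
  have h1' := sub_ne_zero.2 h.t_ne_one.symm
  have z0 : z ≠ 0 := by simpa [pt] using hz 0
  have z1 : z - 1 ≠ 0 := sub_ne_zero.2 (by simpa [pt] using hz 1)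
  have z2 : z - D.t ≠ 0 := sub_ne_zero.2 (by simpa [pt] using hz 2)
  simp only [rho, pt, Fin.sum_univ_three, Matrix.cons_val, sub_zero]
  field_simp
  ring

theorem sum_rho_div_sq (h : D.Regular) {z : ℂ} (hz : ∀ i, z ≠ D.pt i) (hl : z ≠ D.lam) :
    ∑ i, D.rho i / (z - D.pt i) ^ 2 =
      (1 / z + 1 / (z - 1) + 1 / (z - D.t) - 1 / (z - D.lam)) *
        ((z - D.lam) / (z * (z - 1) * (z - D.t))) := by
  have h0 := h.t_ne_zero
  have h1 := sub_ne_zero.2 h.t_ne_one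
  have h1' := sub_ne_zero.2 h.t_ne_one.symm
  have z0 : z ≠ 0 := by simpa [pt] using hz 0
  have z1 : z - 1 ≠ 0 := sub_ne_zero.2 (by simpa [pt] using hz 1)
  have z2 : z - D.t ≠ 0 := sub_ne_zero.2 (by simpa [pt] using hz 2)
  have z3 : z - D.lam ≠ 0 := sub_ne_zero.2 hl
  simp only [rho, pt, Fin.sum_univ_three, Matrix.cons_val, sub_zero]
  field_simp
  ring

end Regular

namespace Realization

variable (R : D.Realization)

theorem sum_rho_c : ∑ i, D.rho i * R.c i = -D.kappa2 := by
  have h : ∑ i, (R.l i + D.rho i * R.c i) = ∑ i, D.θ i := by simp only [R.diag]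
  rw [Finset.sum_add_distrib, R.sum_l] at h
  simp only [kappa1, kappa2, Fin.sum_univ_three] at h ⊢
  linear_combination h

/-- Lagrange interpolation: write `l_i = ρ_i q(p_i)` with `q` quadratic. `sum_div` fixes the leading
coefficient of `q` and `sum_l` the next one; the constant term `s` stays free and reflects
conjugation of the system by a constant lower triangular unipotent matrix. -/
theorem exists_l_eq (h : D.Regular) : ∃ s, ∀ i, R.l i = D.rho i *
    (-D.mu * D.pt i ^ 2 + (D.mu * (1 + D.t - D.lam) - D.kappa1) * D.pt i + s) := by
  have h0 := h.t_ne_zero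
  have h1 := sub_ne_zero.2 h.t_ne_one
  have h1' := sub_ne_zero.2 h.t_ne_one.symm
  have h2 := h.lam_ne_zero
  have h3 := sub_ne_zero.2 h.lam_ne_one.symm
  have h4 := sub_ne_zero.2 h.lam_ne_t.symm
  have h3' := sub_ne_zero.2 h.lam_ne_one
  have h4' := sub_ne_zero.2 h.lam_ne_t
  have e1 := R.sum_l
  have e2 := R.sum_div
  simp only [Fin.sum_univ_three, pt, Matrix.cons_val, sub_zero] at e1 e2
  have e2' : D.mu * (D.lam * (D.lam - 1) * (D.lam - D.t)) =
      R.l 0 * ((D.lam - 1) * (D.lam - D.t)) + R.l 1 * (D.lam * (D.lam - D.t))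
        + R.l 2 * (D.lam * (D.lam - 1)) := by
    rw [← e2]
    field_simp
  have hk : D.kappa1 = -(R.l 0 + R.l 1 + R.l 2) := by rw [e1]; ring
  refine ⟨R.l 0 / D.rho 0, fun i => ?_⟩
  fin_cases i
  · simp [pt]
    field_simp [h.rho_ne_zero 0]
  · simp only [rho, pt, Matrix.cons_val, Fin.mk_one, hk]
    field_simp
    linear_combination (-1) * e2'
  · simp only [rho, pt, Matrix.cons_val, Fin.reduceFinMk, hk]
    field_simp
    linear_combination (-1) * e2'

end Realization

end

end LinP6

/-! ### The scalar equation recovered from the system, and the residue matrix of the Okubo system.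
-/

namespace LinP6

noncomputable section

variable {D : LinP6}

namespace Realization

variable (R : D.Realization)

/-- Together with the next three definitions, the entries of the coefficient matrix of the two by
two system. -/
def a11 (z : ℂ) : ℂ := ∑ i, R.l i / (z - D.pt i)
def a12 (_ : D.Realization) (z : ℂ) : ℂ := ∑ i, D.rho i / (z - D.pt i)
def a21 (z : ℂ) : ℂ := ∑ i, R.c i * R.l i / (z - D.pt i)
def a22 (z : ℂ) : ℂ := ∑ i, D.rho i * R.c i / (z - D.pt i)

/-- Minus the derivative of `a11`. -/
def b11 (z : ℂ) : ℂ := ∑ i, R.l i / (z - D.pt i) ^ 2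
/-- Minus the derivative of `a12`. -/
def b12 (_ : D.Realization) (z : ℂ) : ℂ := ∑ i, D.rho i / (z - D.pt i) ^ 2

variable {R}

theorem a12_ne_zero (h : D.Regular) {z : ℂ} (hz : ∀ i, z ≠ D.pt i) (hl : z ≠ D.lam) :
    R.a12 z ≠ 0 := by
  have z0 : z ≠ 0 := by simpa [pt] using hz 0
  have z1 : z - 1 ≠ 0 := sub_ne_zero.2 (by simpa [pt] using hz 1)
  have z2 : z - D.t ≠ 0 := sub_ne_zero.2 (by simpa [pt] using hz 2)
  rw [a12, h.sum_rho_div hz]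
  exact div_ne_zero (sub_ne_zero.2 hl) (by positivity)

/-- Eliminating the second component gives `P = -tr A - a12' / a12`. Everything is multiplied by
`a12`, whose only zero `λ` produces the apparent singularity. -/
theorem coeffP_eq (h : D.Regular) {z : ℂ} (hz : ∀ i, z ≠ D.pt i) (hl : z ≠ D.lam) :
    R.a12 z * D.coeffP z = -R.a12 z * (R.a11 z + R.a22 z) + R.b12 z := by
  have ht : R.a11 z + R.a22 z = ∑ i, D.θ i / (z - D.pt i) := by
    rw [a11, a22, ← Finset.sum_add_distrib]
    exact Finset.sum_congr rfl fun i _ => by rw [← add_div, R.diag]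
  rw [ht, b12, h.sum_rho_div_sq hz hl, a12, h.sum_rho_div hz, coeffP]
  simp only [Fin.sum_univ_three, pt, Matrix.cons_val]
  ring

/-- The same elimination gives `Q = det A - a11' + a11 a12' / a12`. The Hamiltonian `H` is exactly
the value for which this agrees with `coeffQ`; the free constant `s` of `exists_l_eq` drops out. -/
theorem coeffQ_eq (h : D.Regular) {z : ℂ} (hz : ∀ i, z ≠ D.pt i) (hl : z ≠ D.lam) :
    R.a12 z * D.coeffQ z = R.a12 z * (R.a11 z * R.a22 z - R.a12 z * R.a21 z + R.b11 z)
      - R.a11 z * R.b12 z := by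
  have h0 := h.t_ne_zero
  have h1 := sub_ne_zero.2 h.t_ne_one
  have h1' := sub_ne_zero.2 h.t_ne_one.symm
  have h2 := h.lam_ne_zero
  have h3 := sub_ne_zero.2 h.lam_ne_one.symm
  have h4 := sub_ne_zero.2 h.lam_ne_t.symm
  have z0 : z ≠ 0 := by simpa [pt] using hz 0
  have z1 : z - 1 ≠ 0 := sub_ne_zero.2 (by simpa [pt] using hz 1)
  have z2 : z - D.t ≠ 0 := sub_ne_zero.2 (by simpa [pt] using hz 2)
  have z3 : z - D.lam ≠ 0 := sub_ne_zero.2 hl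
  obtain ⟨s, hs⟩ := R.exists_l_eq h
  have hc : ∀ i, D.rho i * R.c i = D.θ i - R.l i := fun i => by rw [← R.diag i]; ring
  -- Only the product `ρ_i c_i` is polynomial in the data, so the factor `ρ_i` is borrowed from the
  -- interpolated form of `l_i`.
  have hcl : ∀ i, R.c i * R.l i = (D.θ i - R.l i) *
      (-D.mu * D.pt i ^ 2 + (D.mu * (1 + D.t - D.lam) - D.kappa1) * D.pt i + s) := fun i => by
    rw [← hc i]; nth_rewrite 1 [hs i]; ring
  rw [b12, h.sum_rho_div_sq hz hl, a12, h.sum_rho_div hz, a11, a22, a21, b11]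
  simp only [hc, hcl]
  simp only [hs, Fin.sum_univ_three, pt, Matrix.cons_val, sub_zero, rho, coeffQ, H]
  have hk2 : D.kappa2 = -D.kappa1 - D.θ 0 - D.θ 1 - D.θ 2 := by
    simp only [kappa1, kappa2]; ring
  rw [hk2]
  generalize D.kappa1 = k
  generalize D.θ 0 = x0
  generalize D.θ 1 = x1
  generalize D.θ 2 = x2
  field_simp
  ring

variable (D) in
/-- A realization of a regular equation. -/
def canonical (h : D.Regular) : D.Realization where
  l i := D.rho i * (-D.mu * D.pt i ^ 2 + (D.mu * (1 + D.t - D.lam) - D.kappa1) * D.pt i)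
  c i := D.θ i / D.rho i
    - (-D.mu * D.pt i ^ 2 + (D.mu * (1 + D.t - D.lam) - D.kappa1) * D.pt i)
  diag i := by
    field_simp [h.rho_ne_zero i]
    ring
  sum_l := by
    have h0 := h.t_ne_zero
    have h1 := sub_ne_zero.2 h.t_ne_one
    have h1' := sub_ne_zero.2 h.t_ne_one.symm
    simp only [rho, pt, Fin.sum_univ_three, Matrix.cons_val]
    field_simp
    ring
  sum_div := by
    have h0 := h.t_ne_zero
    have h1 := sub_ne_zero.2 h.t_ne_one
    have h1' := sub_ne_zero.2 h.t_ne_one.symm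
    have h3' := sub_ne_zero.2 h.lam_ne_one
    have h4' := sub_ne_zero.2 h.lam_ne_t
    have h2 := h.lam_ne_zero
    simp only [rho, pt, Fin.sum_univ_three, Matrix.cons_val]
    field_simp
    ring

variable (R) in
/-- The residue matrix of the Okubo system attached to a realization. -/
def op : (Fin 3 → ℂ) →ₗ[ℂ] (Fin 3 → ℂ) where
  toFun v i := R.l i * ∑ j, v j + D.rho i * ∑ j, R.c j * v j
  map_add' v w := by
    ext i
    simp only [Pi.add_apply, mul_add, Finset.sum_add_distrib]
    ring
  map_smul' a v := by
    ext i
    simp only [Pi.smul_apply, smul_eq_mul, RingHom.id_apply, mul_left_comm _ a, ← Finset.mul_sum]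
    ring

theorem op_apply (v : Fin 3 → ℂ) (i : Fin 3) :
    R.op v i = R.l i * ∑ j, v j + D.rho i * ∑ j, R.c j * v j := rfl

theorem sum_op (h : D.Regular) (v : Fin 3 → ℂ) : ∑ i, R.op v i = -D.kappa1 * ∑ i, v i := by
  simp only [op_apply, Finset.sum_add_distrib, ← Finset.sum_mul, R.sum_l, h.sum_rho]
  ring

theorem op_rho (h : D.Regular) : R.op D.rho = -D.kappa2 • D.rho := by
  ext i
  have : ∑ j, R.c j * D.rho j = -D.kappa2 := by
    rw [← R.sum_rho_c]
    exact Finset.sum_congr rfl fun j _ => mul_comm _ _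
  simp only [op_apply, h.sum_rho, this, Pi.smul_apply, smul_eq_mul]
  ring

/-- A non-zero eigenvalue is `-κ₁` or `-κ₂`, and eigenvectors are told apart by their sums. -/
theorem eigen_cases (h : D.Regular) {v : Fin 3 → ℂ} {N : ℂ} (hv : R.op v = N • v) (h0 : v ≠ 0)
    (hN : N ≠ 0) : (∑ i, v i ≠ 0 ∧ N = -D.kappa1) ∨
      (∑ i, v i = 0 ∧ N = -D.kappa2 ∧ ∃ s : ℂ, s ≠ 0 ∧ v = s • D.rho) := by
  by_cases hs : ∑ i, v i = 0
  · right
    -- When the sum vanishes, the part of `op` along `l` disappears and the image is a multiple of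
    -- `ρ`.
    have hv' : v = ((∑ j, R.c j * v j) / N) • D.rho := by
      ext i
      have := congrFun hv i
      simp only [op_apply, hs, Pi.smul_apply, smul_eq_mul] at this ⊢
      field_simp
      linear_combination -this
    set s := (∑ j, R.c j * v j) / N
    have hs0 : s ≠ 0 := by
      rintro h
      rw [h, zero_smul] at hv'
      exact h0 hv'
    refine ⟨hs, ?_, s, hs0, hv'⟩
    rw [hv', map_smul, op_rho h] at hv
    have := congrFun hv 0
    simp only [Pi.smul_apply, smul_eq_mul] at this
    have h2 := h.rho_ne_zero 0
    have : s * D.rho 0 * (N - -D.kappa2) = 0 := by linear_combination -this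
    have := (mul_eq_zero.1 this).resolve_left (mul_ne_zero hs0 h2)
    exact sub_eq_zero.1 this
  · left
    refine ⟨hs, ?_⟩
    have := sum_op (R := R) h v
    rw [hv] at this
    simp only [Pi.smul_apply, smul_eq_mul, ← Finset.mul_sum] at this
    exact mul_right_cancel₀ hs this

/-- If `κ₂ ≠ 0`, the two functionals that define the residue matrix are independent. -/
theorem exists_sum_eq (h : D.Regular) (hk : D.kappa2 ≠ 0) (α β : ℂ) :
    ∃ v : Fin 3 → ℂ, ∑ i, v i = α ∧ ∑ i, R.c i * v i = β := by
  have hc : ∑ j, R.c j * D.rho j = -D.kappa2 := by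
    rw [← R.sum_rho_c]
    exact Finset.sum_congr rfl fun j _ => mul_comm _ _
  -- The first summand has the right sum. Adding multiples of `ρ` keeps the sum and moves the other
  -- functional by multiples of `-κ₂`.
  refine ⟨Pi.single 0 α + ((α * R.c 0 - β) / D.kappa2) • D.rho, ?_, ?_⟩
  · simp [Finset.sum_add_distrib, ← Finset.mul_sum, h.sum_rho]
  · simp only [Pi.add_apply, mul_add, Finset.sum_add_distrib, Pi.smul_apply, smul_eq_mul,
      mul_left_comm _ ((α * R.c 0 - β) / D.kappa2), ← Finset.mul_sum, hc]
    simp [Pi.single_apply]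
    field_simp
    ring

/-- The residue matrix has rank at most two. -/
theorem exists_op_eq_zero (R : D.Realization) (h : D.Regular) (hk : D.kappa2 ≠ 0) :
    ∃ v : Fin 3 → ℂ, v ≠ 0 ∧ ∑ i, v i = 0 ∧ R.op v = 0 := by
  -- The cross product of `(1, 1, 1)` and `c`. If it vanished, all `c_i` would be equal and `∑ ρ_i =
  -- 0` would force `κ₂ = 0`.
  refine ⟨![R.c 2 - R.c 1, R.c 0 - R.c 2, R.c 1 - R.c 0], fun h0 => hk ?_, ?_, ?_⟩
  · have e1 := congrFun h0 1
    have e2 := congrFun h0 2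
    simp only [Matrix.cons_val, Pi.zero_apply] at e1 e2
    have := R.sum_rho_c
    have hr := h.sum_rho
    simp only [Fin.sum_univ_three] at this hr
    linear_combination this - R.c 0 * hr + D.rho 2 * e1 - D.rho 1 * e2
  · simp only [Fin.sum_univ_three, Matrix.cons_val]
    ring
  · ext i
    simp only [op_apply, Fin.sum_univ_three, Matrix.cons_val, Pi.zero_apply]
    ring

end Realization

end

end LinP6

/-! ### The dual equation, and the tilde transform as a shift of the Okubo matrix. -/

namespace LinP6

noncomputable section

variable {D : LinP6}

/-- The equation satisfied by `y / (z ^ θ₀ (z - 1) ^ θ₁ (z - t) ^ θ_t)`. -/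
def dual (D : LinP6) : LinP6 where
  t := D.t
  θ := fun i => -D.θ i
  θinf := D.θinf
  lam := D.lam
  mu := D.mu - ∑ i, D.θ i / (D.lam - D.pt i)

theorem dual_pt : D.dual.pt = D.pt := rfl

theorem dual_rho : D.dual.rho = D.rho := rfl

theorem dual_dual : D.dual.dual = D := by
  obtain ⟨t, θ, θinf, lam, mu⟩ := D
  simp only [dual, neg_neg, LinP6.mk.injEq, true_and]
  simp only [neg_div, Finset.sum_neg_distrib]
  exact (sub_neg_eq_add _ _).trans (sub_add_cancel _ _)

theorem dual_kappa1 : D.dual.kappa1 = -D.kappa2 := by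
  simp only [dual, kappa1, kappa2]; ring

theorem dual_kappa2 : D.dual.kappa2 = -D.kappa1 := by
  simp only [dual, kappa1, kappa2]; ring

/-- A finite `λ̃` thus means `μ ≠ 0` for the dual equation, which excludes constant solutions of the
latter. -/
theorem dual_mu : D.dual.mu = D.tildeDenom := by
  simp only [dual, tildeDenom, Fin.sum_univ_three, pt, Matrix.cons_val, sub_zero]
  ring

theorem Regular.dual (h : D.Regular) : D.dual.Regular := ⟨h.1, h.2, h.3⟩

theorem tilde_kappa1 : D.tilde.kappa1 = D.kappa1 - D.kappa2 := by
  simp only [tilde, kappa1, kappa2]; ring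

theorem tilde_kappa2 : D.tilde.kappa2 = -D.kappa2 := by
  simp only [tilde, kappa2]; ring

theorem tilde_pt : D.tilde.pt = D.pt := rfl

theorem kappa1_sub_kappa2 : D.kappa1 - D.kappa2 = D.θinf := by
  simp only [kappa1, kappa2]; ring

/-- The transposed system is a realization of the dual equation. -/
def Realization.dual (R : D.Realization) (h : D.Regular) : D.dual.Realization where
  l i := -(D.rho i * R.c i)
  c i := -(R.l i / D.rho i)
  diag i := by
    have := h.rho_ne_zero i
    have hd := R.diag i
    rw [dual_rho]
    change _ = -D.θ i
    rw [← hd]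
    field_simp
    ring
  sum_l := by rw [Finset.sum_neg_distrib, R.sum_rho_c, dual_kappa1]
  sum_div := by
    change _ = D.mu - ∑ i, D.θ i / (D.lam - D.pt i)
    rw [← R.sum_div, ← Finset.sum_sub_distrib]
    refine Finset.sum_congr rfl fun i _ => ?_
    rw [← sub_div, ← R.diag i]
    change _ / (D.lam - D.pt i) = _
    ring

/-- The Okubo systems of two equations are related by a diagonal gauge transformation and the shift
of the residue matrix by `κ`. -/
structure ConvPair (D E : LinP6) (κ : ℂ) where
  regular : D.Regular
  regular' : E.Regular
  R : D.Realization
  R' : E.Realization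
  S : Fin 3 → ℂ
  S_ne_zero : ∀ i, S i ≠ 0
  pt_eq : E.pt = D.pt
  intertwine : ∀ i j, (R'.l i + E.rho i * R'.c j) * S j =
    S i * (R.l i + D.rho i * R.c j + if i = j then κ else 0)

/-- The computational core: `λ̃` and `μ̃` are precisely the values that leave the off-diagonal
entries of the Okubo matrix unchanged. As its diagonal is `θ`, the whole matrix is then shifted by
`κ₂`. The entries do not depend on the choice of realization. -/
theorem tilde_matrix_eq (h : D.Regular) (h' : D.tilde.Regular) (hden : D.tildeDenom ≠ 0)
    (hk : D.kappa2 ≠ 0) {i j : Fin 3} (hij : i ≠ j) :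
    (Realization.canonical D.tilde h').l i + D.tilde.rho i * (Realization.canonical D.tilde h').c j
      = (Realization.canonical D h).l i + D.rho i * (Realization.canonical D h).c j := by
  have hr := h.rho_ne_zero j
  have hr' := h'.rho_ne_zero j
  have hne : D.lam - D.lamTilde ≠ 0 := by
    simp only [lamTilde, sub_sub_cancel]
    exact div_ne_zero hk hden
  -- The definition of `λ̃` solved for `μ`, so that both matrices become rational in `κ₂`, `λ`,
  -- `λ̃`, `t` and `θ`.
  have hmu : D.mu = D.kappa2 / (D.lam - D.lamTilde) + D.θ 0 / D.lam + D.θ 1 / (D.lam - 1)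
      + D.θ 2 / (D.lam - D.t) := by
    have : D.tildeDenom = D.kappa2 / (D.lam - D.lamTilde) := by
      simp only [lamTilde, sub_sub_cancel]
      field_simp
    rw [← this, tildeDenom]
    ring
  have h0 := h.t_ne_zero
  have h1 := sub_ne_zero.2 h.t_ne_one
  have h1' := sub_ne_zero.2 h.t_ne_one.symm
  have h2 := h.lam_ne_zero
  have h3 := sub_ne_zero.2 h.lam_ne_one
  have h4 := sub_ne_zero.2 h.lam_ne_t
  have h3' := sub_ne_zero.2 h.lam_ne_one.symm
  have h4' := sub_ne_zero.2 h.lam_ne_t.symm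
  have g2 : D.lamTilde ≠ 0 := h'.lam_ne_zero
  have g3 : D.lamTilde - 1 ≠ 0 := sub_ne_zero.2 h'.lam_ne_one
  have g4 : D.lamTilde - D.t ≠ 0 := sub_ne_zero.2 h'.lam_ne_t
  have g3' : 1 - D.lamTilde ≠ 0 := sub_ne_zero.2 h'.lam_ne_one.symm
  have g4' : D.t - D.lamTilde ≠ 0 := sub_ne_zero.2 h'.lam_ne_t.symm
  have hk1 : D.kappa1 = -D.kappa2 - D.θ 0 - D.θ 1 - D.θ 2 := by
    simp only [kappa1, kappa2]; ring
  have e1 : D.tilde.rho = ![-D.lamTilde / D.t, (1 - D.lamTilde) / (1 - D.t),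
    (D.t - D.lamTilde) / (D.t * (D.t - 1))] := rfl
  have e2 : D.tilde.lam = D.lamTilde := rfl
  have e3 : D.tilde.θ = fun i => D.kappa2 + D.θ i := rfl
  have e4 : D.tilde.mu = D.muTilde := rfl
  have e5 : D.tilde.t = D.t := rfl
  simp only [Realization.canonical, tilde_kappa1, tilde_pt, e1, e2, e3, e4, e5, muTilde]
  rw [hmu, hk1]
  clear e1 e2 e3 e4 e5 hk1 hmu hr hr' hden h h'
  generalize D.kappa2 = k at *
  generalize D.lamTilde = L at *
  fin_cases i <;> fin_cases j <;>
    simp only [pt, rho, Matrix.cons_val, Fin.mk_one, Fin.reduceFinMk, Fin.zero_eta, ne_eq,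
      not_true_eq_false] at hij ⊢ <;>
    generalize D.lam = l at * <;> generalize D.t = t at * <;> generalize D.θ 0 = x at * <;>
    generalize D.θ 1 = y at * <;> generalize D.θ 2 = w at * <;>
    field_simp <;> ring

/-- The equation and its tilde transform. -/
def tildePair (h : D.Regular) (h' : D.tilde.Regular) (hden : D.tildeDenom ≠ 0)
    (hk : D.kappa2 ≠ 0) : ConvPair D D.tilde D.kappa2 where
  regular := h
  regular' := h'
  R := Realization.canonical D h
  R' := Realization.canonical D.tilde h'
  S := 1
  S_ne_zero i := by simp
  pt_eq := rfl
  intertwine i j := by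
    rcases eq_or_ne i j with rfl | hij
    · rw [Realization.diag, Realization.diag]
      simp [tilde, add_comm]
    · rw [tilde_matrix_eq h h' hden hk hij]
      simp [hij]

/-- The dual equations form a pair for the opposite parameter. -/
def ConvPair.dual {E : LinP6} {κ : ℂ} (C : ConvPair D E κ) : ConvPair D.dual E.dual (-κ) where
  regular := C.regular.dual
  regular' := C.regular'.dual
  R := C.R.dual C.regular
  R' := C.R'.dual C.regular'
  -- Dualizing replaces `M` by minus its transpose conjugated by `diag(ρ)`. Transposition inverts
  -- the old gauge, and the two conjugations contribute the quotient of the `ρ`.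
  S i := E.rho i / (D.rho i * C.S i)
  S_ne_zero i := div_ne_zero (C.regular'.rho_ne_zero i)
    (mul_ne_zero (C.regular.rho_ne_zero i) (C.S_ne_zero i))
  pt_eq := C.pt_eq
  intertwine i j := by
    have h := C.intertwine j i
    have r1 := C.regular.rho_ne_zero i
    have r2 := C.regular.rho_ne_zero j
    have r3 := C.regular'.rho_ne_zero i
    have r4 := C.regular'.rho_ne_zero j
    have s1 := C.S_ne_zero i
    have s2 := C.S_ne_zero j
    simp only [Realization.dual, dual_rho]
    rcases eq_or_ne i j with rfl | hij
    · simp only [if_true] at h ⊢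
      have h2 := mul_right_cancel₀ s1 (h.trans (mul_comm _ _))
      field_simp
      linear_combination -h2
    · rw [if_neg hij.symm] at h
      rw [if_neg hij]
      field_simp
      linear_combination -(D.rho i) * h

end

end LinP6

/-! ### Passage between solutions of the equation and solutions of the Okubo system. -/

namespace LinP6

noncomputable section

variable {D : LinP6}

namespace Realization

variable {R : D.Realization}

theorem hasDerivAt_sum_div {a : Fin 3 → ℂ} {z : ℂ} (hz : ∀ i, z ≠ D.pt i) :
    HasDerivAt (fun z => ∑ i, a i / (z - D.pt i)) (-∑ i, a i / (z - D.pt i) ^ 2) z := by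
  rw [← Finset.sum_neg_distrib]
  refine HasDerivAt.fun_sum fun i _ => ?_
  have h := sub_ne_zero.2 (hz i)
  have := (hasDerivAt_const z (a i)).fun_div ((hasDerivAt_id' z).sub_const (D.pt i)) h
  refine this.congr_deriv ?_
  field_simp
  ring

theorem hasDerivAt_a11 {z : ℂ} (hz : ∀ i, z ≠ D.pt i) : HasDerivAt R.a11 (-R.b11 z) z :=
  hasDerivAt_sum_div hz

theorem hasDerivAt_a12 {z : ℂ} (hz : ∀ i, z ≠ D.pt i) : HasDerivAt R.a12 (-R.b12 z) z :=
  hasDerivAt_sum_div hz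

/-- The first component of a solution of the system satisfies the equation. -/
theorem isSolutionOn_of_system (h : D.Regular) {U : Set ℂ} (hU : IsOpen U)
    (hp : ∀ z ∈ U, ∀ i, z ≠ D.pt i) (hl : D.lam ∉ U) {y w : ℂ → ℂ}
    (hy : ∀ z ∈ U, HasDerivAt y (R.a11 z * y z + R.a12 z * w z) z)
    (hw : ∀ z ∈ U, HasDerivAt w (R.a21 z * y z + R.a22 z * w z) z) : D.IsSolutionOn U y := by
  refine ⟨fun z hz => (hy z hz).differentiableAt.differentiableWithinAt, fun z hz => ?_⟩
  have hzl : z ≠ D.lam := fun e => hl (e ▸ hz)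
  have hd : deriv y =ᶠ[nhds z] fun z => R.a11 z * y z + R.a12 z * w z := by
    filter_upwards [hU.mem_nhds hz] with x hx using (hy x hx).deriv
  have h2 := ((hasDerivAt_a11 (R := R) (hp z hz)).fun_mul (hy z hz)).fun_add
    ((hasDerivAt_a12 (R := R) (hp z hz)).fun_mul (hw z hz))
  rw [hd.deriv_eq, h2.deriv, (hy z hz).deriv]
  have h12 := a12_ne_zero (R := R) h (hp z hz) hzl
  have eP := coeffP_eq (R := R) h (hp z hz) hzl
  have eQ := coeffQ_eq (R := R) h (hp z hz) hzl
  refine mul_left_cancel₀ h12 ?_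
  linear_combination (R.a11 z * y z + R.a12 z * w z) * eP + y z * eQ

/-- The sum of the components of a solution of the Okubo system satisfies the equation. -/
theorem isSolutionOn_sum (h : D.Regular) {U : Set ℂ} (hU : IsOpen U)
    (hp : ∀ z ∈ U, ∀ i, z ≠ D.pt i) (hl : D.lam ∉ U) {G : Fin 3 → ℂ → ℂ}
    (hG : ∀ z ∈ U, ∀ i, HasDerivAt (G i) (R.op (fun j => G j z) i / (z - D.pt i)) z) :
    D.IsSolutionOn U (fun z => ∑ i, G i z) := by
  refine isSolutionOn_of_system (R := R) (w := fun z => ∑ i, R.c i * G i z) h hU hp hl ?_ ?_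
  · intro z hz
    refine (HasDerivAt.fun_sum fun i (_ : i ∈ Finset.univ) => hG z hz i).congr_deriv ?_
    simp only [op_apply, a11, a12, Finset.sum_mul, ← Finset.sum_add_distrib]
    refine Finset.sum_congr rfl fun i _ => ?_
    ring
  · intro z hz
    refine (HasDerivAt.fun_sum fun i (_ : i ∈ Finset.univ) =>
      (hG z hz i).const_mul (R.c i)).congr_deriv ?_
    simp only [op_apply, a21, a22, Finset.sum_mul, ← Finset.sum_add_distrib]
    refine Finset.sum_congr rfl fun i _ => ?_
    ring

variable (R) in
/-- The second component of the system for the solution `E v`, divided by `E`, where `E`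
has logarithmic derivative `τ`. -/
def second (τ v : ℂ → ℂ) (z : ℂ) : ℂ := (deriv v z + τ z * v z - R.a11 z * v z) / R.a12 z

variable (R) in
/-- The Okubo vector for the solution `E v`, divided by `E`, where `E`
has logarithmic derivative `τ`. -/
def okubo (τ v : ℂ → ℂ) (i : Fin 3) (z : ℂ) : ℂ :=
  (R.l i * v z + D.rho i * R.second τ v z) / (z - D.pt i)

/-- Multiplied by `E`, the right side is the derivative of the solution `E v`, not the solution
itself. This accounts for the shift by `-1` in the system satisfied by `okubo`. -/
theorem sum_okubo (h : D.Regular) {τ v : ℂ → ℂ} {z : ℂ} (hz : ∀ i, z ≠ D.pt i) (hl : z ≠ D.lam) :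
    ∑ i, R.okubo τ v i z = deriv v z + τ z * v z := by
  have : ∑ i, R.okubo τ v i z = R.a11 z * v z + R.a12 z * R.second τ v z := by
    simp only [okubo, a11, a12, Finset.sum_mul, ← Finset.sum_add_distrib]
    exact Finset.sum_congr rfl fun i _ => by ring
  rw [this, second, mul_div_cancel₀ _ (a12_ne_zero h hz hl)]
  ring

/-- Converse of `isSolutionOn_of_system`: off the zeros of `a12` the second component is determined
by `y` and `y'`, and the scalar equation supplies its derivative. Factoring out `E` adds the terms
with `τ`. -/
theorem hasDerivAt_second (h : D.Regular) {U : Set ℂ} (hU : IsOpen U)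
    (hp : ∀ z ∈ U, ∀ i, z ≠ D.pt i) (hl : D.lam ∉ U) {E τ v : ℂ → ℂ}
    (hE : ∀ z ∈ U, HasDerivAt E (τ z * E z) z) (hE0 : ∀ z ∈ U, E z ≠ 0)
    (hsol : D.IsSolutionOn U (fun z => E z * v z)) {z : ℂ} (hz : z ∈ U) :
    HasDerivAt v (R.a11 z * v z + R.a12 z * R.second τ v z - τ z * v z) z ∧
    HasDerivAt (R.second τ v)
      (R.a21 z * v z + R.a22 z * R.second τ v z - τ z * R.second τ v z) z := by
  have hzl : ∀ x ∈ U, x ≠ D.lam := fun x hx e => hl (e ▸ hx)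
  set y : ℂ → ℂ := fun z => E z * v z with hy
  have hyd : ∀ x ∈ U, DifferentiableAt ℂ y x := fun x hx =>
    hsol.1.differentiableAt (hU.mem_nhds hx)
  have hvd : ∀ x ∈ U, DifferentiableAt ℂ v x := by
    intro x hx
    have : v =ᶠ[nhds x] fun z => y z / E z := by
      filter_upwards [hU.mem_nhds hx] with u hu
      rw [hy, mul_div_cancel_left₀ _ (hE0 u hu)]
    exact ((hyd x hx).fun_div (hE x hx).differentiableAt (hE0 x hx)).congr_of_eventuallyEq this
  have hdy : ∀ x ∈ U, deriv y x = E x * (deriv v x + τ x * v x) := by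
    intro x hx
    rw [((hE x hx).fun_mul (hvd x hx).hasDerivAt).deriv]
    ring
  have hv1 : R.a11 z * v z + R.a12 z * R.second τ v z - τ z * v z = deriv v z := by
    rw [second, mul_div_cancel₀ _ (a12_ne_zero h (hp z hz) (hzl z hz))]
    ring
  refine ⟨by rw [hv1]; exact (hvd z hz).hasDerivAt, ?_⟩
  -- Rewritten through `y = E v` alone, so that differentiation only brings in `y''`, which the
  -- equation eliminates.
  have hw : R.second τ v =ᶠ[nhds z] fun x => (deriv y x - R.a11 x * y x) / (R.a12 x * E x) := by
    filter_upwards [hU.mem_nhds hz] with x hx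
    have h1 := a12_ne_zero (R := R) h (hp x hx) (hzl x hx)
    have h2 := hE0 x hx
    rw [hdy x hx, second, hy]
    field_simp
  have hdd : HasDerivAt (deriv y) (deriv (deriv y) z) z :=
    ((hsol.1.deriv hU).differentiableAt (hU.mem_nhds hz)).hasDerivAt
  have h12 := a12_ne_zero (R := R) h (hp z hz) (hzl z hz)
  have hEz := hE0 z hz
  have key := (hdd.fun_sub ((hasDerivAt_a11 (R := R) (hp z hz)).fun_mul (hyd z hz).hasDerivAt)).fun_div
    ((hasDerivAt_a12 (R := R) (hp z hz)).fun_mul (hE z hz)) (mul_ne_zero h12 hEz)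
  refine (key.congr_of_eventuallyEq hw).congr_deriv ?_
  have e := hsol.2 z hz
  have e2 : deriv (deriv y) z = -(D.coeffP z * deriv y z + D.coeffQ z * y z) := by
    linear_combination e
  rw [e2, hdy z hz]
  have eP := coeffP_eq (R := R) h (hp z hz) (hzl z hz)
  have eQ := coeffQ_eq (R := R) h (hp z hz) (hzl z hz)
  simp only [second, hy]
  field_simp
  linear_combination (-(deriv v z + τ z * v z)) * eP - v z * eQ

/-- The Okubo system satisfied by `R.okubo τ v`. -/
theorem hasDerivAt_okubo (h : D.Regular) {U : Set ℂ} (hU : IsOpen U)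
    (hp : ∀ z ∈ U, ∀ i, z ≠ D.pt i) (hl : D.lam ∉ U) {E τ v : ℂ → ℂ}
    (hE : ∀ z ∈ U, HasDerivAt E (τ z * E z) z) (hE0 : ∀ z ∈ U, E z ≠ 0)
    (hsol : D.IsSolutionOn U (fun z => E z * v z)) {z : ℂ} (hz : z ∈ U) (i : Fin 3) :
    HasDerivAt (R.okubo τ v i) ((R.op (fun j => R.okubo τ v j z) i - R.okubo τ v i z)
      / (z - D.pt i) - τ z * R.okubo τ v i z) z := by
  obtain ⟨h1, h2⟩ := hasDerivAt_second (R := R) h hU hp hl hE hE0 hsol hz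
  have hi := sub_ne_zero.2 (hp z hz i)
  have key := ((h1.const_mul (R.l i)).fun_add (h2.const_mul (D.rho i))).fun_div
    ((hasDerivAt_id' z).sub_const (D.pt i)) hi
  refine key.congr_deriv ?_
  have s1 : ∑ j, R.okubo τ v j z = R.a11 z * v z + R.a12 z * R.second τ v z := by
    simp only [okubo, a11, a12, Finset.sum_mul, ← Finset.sum_add_distrib]
    exact Finset.sum_congr rfl fun i _ => by ring
  have s2 : ∑ j, R.c j * R.okubo τ v j z = R.a21 z * v z + R.a22 z * R.second τ v z := by
    simp only [okubo, a21, a22, Finset.sum_mul, ← Finset.sum_add_distrib]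
    exact Finset.sum_congr rfl fun i _ => by ring
  rw [op_apply, s1, s2, okubo]
  field_simp
  ring

theorem sum_theta (z : ℂ) : R.a11 z + R.a22 z = ∑ i, D.θ i / (z - D.pt i) := by
  rw [a11, a22, ← Finset.sum_add_distrib]
  exact Finset.sum_congr rfl fun i _ => by rw [← add_div, R.diag]

end Realization

/-- Multiplication by `z ^ θ₀ (z - 1) ^ θ₁ (z - t) ^ θ_t` maps solutions of the dual equation to
solutions of the equation. -/
theorem IsSolutionOn.of_dual (h : D.Regular) {U : Set ℂ} (hU : IsOpen U)
    (hp : ∀ z ∈ U, ∀ i, z ≠ D.pt i) (hl : D.lam ∉ U) {E v : ℂ → ℂ}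
    (hE : ∀ z ∈ U, HasDerivAt E ((∑ i, D.θ i / (z - D.pt i)) * E z) z)
    (hsol : D.dual.IsSolutionOn U v) : D.IsSolutionOn U (fun z => E z * v z) := by
  set R := Realization.canonical D h
  have hrh : ∀ i, D.rho i ≠ 0 := h.rho_ne_zero
  have key := fun z (hz : z ∈ U) => Realization.hasDerivAt_second (R := R.dual h) h.dual hU hp hl
    (E := fun _ => 1) (τ := fun _ => 0) (v := v) (fun z _ => by simpa using hasDerivAt_const z 1)
    (fun _ _ => one_ne_zero) (by simpa using hsol) hz
  have e11 : ∀ z, (R.dual h).a11 z = -R.a22 z := fun z => by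
    simp only [Realization.a11, Realization.a22, Realization.dual, ← Finset.sum_neg_distrib,
      neg_div, dual_pt]
  have e22 : ∀ z, (R.dual h).a22 z = -R.a11 z := fun z => by
    simp only [Realization.a11, Realization.a22, Realization.dual, ← Finset.sum_neg_distrib,
      dual_rho, dual_pt]
    refine Finset.sum_congr rfl fun i _ => ?_
    field_simp [hrh i]
  have e21 : ∀ z, (R.dual h).a21 z = R.a21 z := fun z => by
    simp only [Realization.a21, Realization.dual, dual_pt]
    refine Finset.sum_congr rfl fun i _ => ?_
    field_simp [hrh i]
  have e12 : ∀ z, (R.dual h).a12 z = R.a12 z := fun z => rfl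
  refine Realization.isSolutionOn_of_system (R := R)
    (w := fun z => E z * (R.dual h).second (fun _ => 0) v z) h hU hp hl ?_ ?_
  · intro z hz
    have k := (hE z hz).fun_mul (key z hz).1
    refine k.congr_deriv ?_
    rw [e11, e12, ← R.sum_theta]
    ring
  · intro z hz
    have k := (hE z hz).fun_mul (key z hz).2
    refine k.congr_deriv ?_
    rw [e21, e22, ← R.sum_theta]
    ring

end

end LinP6

/-! ### Taylor coefficients and branches of the logarithm. -/

noncomputable section

/-- The `n`-th Taylor coefficient of `f` at `a`. -/
def taylorCoeff (f : ℂ → ℂ) (a : ℂ) (n : ℕ) : ℂ := iteratedDeriv n f a / n.factorial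

section taylorCoeff

variable {f g : ℂ → ℂ} {a : ℂ}

theorem taylorCoeff_zero : taylorCoeff f a 0 = f a := by simp [taylorCoeff]

theorem taylorCoeff_congr (h : f =ᶠ[𝓝 a] g) (n : ℕ) : taylorCoeff f a n = taylorCoeff g a n := by
  rw [taylorCoeff, h.iteratedDeriv_eq, taylorCoeff]

theorem taylorCoeff_add (hf : AnalyticAt ℂ f a) (hg : AnalyticAt ℂ g a) (n : ℕ) :
    taylorCoeff (fun z => f z + g z) a n = taylorCoeff f a n + taylorCoeff g a n := by
  have := iteratedDeriv_add (n := n) hf.contDiffAt hg.contDiffAt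
  simp only [taylorCoeff, ← add_div, ← this]
  rfl

theorem taylorCoeff_const_mul (c : ℂ) (n : ℕ) :
    taylorCoeff (fun z => c * f z) a n = c * taylorCoeff f a n := by
  simp only [taylorCoeff, iteratedDeriv_const_mul_field, mul_div_assoc]

theorem taylorCoeff_sum {ι : Type*} (s : Finset ι) {F : ι → ℂ → ℂ}
    (hF : ∀ i ∈ s, AnalyticAt ℂ (F i) a) (n : ℕ) :
    taylorCoeff (fun z => ∑ i ∈ s, F i z) a n = ∑ i ∈ s, taylorCoeff (F i) a n := by
  classical
  induction s using Finset.induction_on with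
  | empty => simp [taylorCoeff]
  | insert i s hi ih =>
    simp only [Finset.sum_insert hi]
    rw [taylorCoeff_add (hF i (by simp)), ih fun j hj => hF j (by simp [hj])]
    exact Finset.analyticAt_fun_sum s fun j hj => hF j (by simp [hj])

theorem taylorCoeff_deriv (n : ℕ) :
    taylorCoeff (deriv f) a n = (n + 1) * taylorCoeff f a (n + 1) := by
  have h : ((n : ℂ) + 1) ≠ 0 := by exact_mod_cast n.succ_ne_zero
  have h2 : ((n.factorial : ℕ) : ℂ) ≠ 0 := by exact_mod_cast n.factorial_ne_zero
  simp only [taylorCoeff, iteratedDeriv_succ', Nat.factorial_succ]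
  push_cast
  field_simp

/-- Leibniz' rule for the factor `z - a`, stated for germs because the induction differentiates it
again. -/
theorem iteratedDeriv_sub_mul (hf : AnalyticAt ℂ f a) (n : ℕ) :
    iteratedDeriv (n + 1) (fun z => (z - a) * f z) =ᶠ[𝓝 a]
      fun z => (z - a) * iteratedDeriv (n + 1) f z + (n + 1) * iteratedDeriv n f z := by
  have hd : ∀ k, ∀ᶠ z in 𝓝 a, HasDerivAt (iteratedDeriv k f) (iteratedDeriv (k + 1) f z) z := by
    intro k
    have : AnalyticAt ℂ (iteratedDeriv k f) a := by
      rw [iteratedDeriv_eq_iterate]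
      exact hf.iterated_deriv k
    filter_upwards [this.eventually_analyticAt] with z hz
    rw [iteratedDeriv_succ]
    exact hz.differentiableAt.hasDerivAt
  induction n with
  | zero =>
    filter_upwards [hd 0] with z hz
    rw [iteratedDeriv_one]
    simp only [iteratedDeriv_zero] at hz
    rw [(((hasDerivAt_id' z).sub_const a).fun_mul hz).deriv]
    simp only [iteratedDeriv_zero, zero_add, iteratedDeriv_one, Nat.cast_zero]
    ring
  | succ n ih =>
    have := ih.deriv
    rw [← iteratedDeriv_succ] at this
    refine this.trans ?_
    filter_upwards [hd (n + 1), hd n] with z h1 h2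
    rw [((((hasDerivAt_id' z).sub_const a).fun_mul h1).fun_add (h2.const_mul _)).deriv]
    push_cast
    ring

theorem taylorCoeff_sub_mul_zero : taylorCoeff (fun z => (z - a) * f z) a 0 = 0 := by
  simp [taylorCoeff]

theorem taylorCoeff_sub_mul (hf : AnalyticAt ℂ f a) (n : ℕ) :
    taylorCoeff (fun z => (z - a) * f z) a (n + 1) = taylorCoeff f a n := by
  have h : ((n : ℂ) + 1) ≠ 0 := by exact_mod_cast n.succ_ne_zero
  have h2 : ((n.factorial : ℕ) : ℂ) ≠ 0 := by exact_mod_cast n.factorial_ne_zero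
  rw [taylorCoeff, (iteratedDeriv_sub_mul hf n).eq_of_nhds, taylorCoeff, Nat.factorial_succ]
  push_cast
  field_simp
  ring

/-- The Taylor coefficients of the Euler operator. -/
theorem taylorCoeff_euler (hf : AnalyticAt ℂ f a) (s : ℂ) (n : ℕ) :
    taylorCoeff (fun z => (z - a) * deriv f z + s * f z) a n = (n + s) * taylorCoeff f a n := by
  have h1 : AnalyticAt ℂ (fun z => (z - a) * deriv f z) a := by
    have := hf.deriv
    fun_prop
  have h2 : AnalyticAt ℂ (fun z => s * f z) a := by fun_prop
  rw [taylorCoeff_add h1 h2, taylorCoeff_const_mul]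
  rcases n with _ | n
  · rw [taylorCoeff_sub_mul_zero]
    simp
  · rw [taylorCoeff_sub_mul hf.deriv, taylorCoeff_deriv]
    push_cast
    ring

theorem taylorCoeff_polynomial (p : Polynomial ℂ) {n : ℕ} (hn : p.natDegree < n) :
    taylorCoeff (fun z => p.eval z) a n = 0 := by
  have : ∀ k, iteratedDeriv k (fun z => p.eval z) = fun z =>
      (Polynomial.derivative^[k] p).eval z := by
    intro k
    induction k with
    | zero => simp
    | succ k ih =>
      rw [iteratedDeriv_succ, ih]
      ext z
      rw [Function.iterate_succ_apply', Polynomial.deriv]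
  rw [taylorCoeff, this, Polynomial.iterate_derivative_eq_zero hn]
  simp

/-- A function with vanishing Taylor coefficients is locally zero. -/
theorem exists_taylorCoeff_ne_zero (hf : AnalyticAt ℂ f a) (h : ¬ ∀ᶠ z in 𝓝 a, f z = 0) :
    ∃ n, taylorCoeff f a n ≠ 0 := by
  by_contra! hn
  refine h ?_
  have := hf.hasFPowerSeriesAt
  have h0 : FormalMultilinearSeries.ofScalars ℂ (fun n => iteratedDeriv n f a / (n.factorial : ℂ))
      = 0 := by
    have e : (fun n => iteratedDeriv n f a / (n.factorial : ℂ)) = 0 := funext hn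
    rw [e]
    ext n
    simp [FormalMultilinearSeries.ofScalars]
  rw [h0] at this
  exact this.eventually_eq_zero

end taylorCoeff

namespace LinP6

theorem IsLogBranch.ne {U : Set ℂ} {p : ℂ} {ℓ : ℂ → ℂ} (h : IsLogBranch U p ℓ) {z : ℂ}
    (hz : z ∈ U) : z ≠ p := by
  intro e
  have := h.2 z hz
  rw [e, sub_self] at this
  exact Complex.exp_ne_zero _ this

theorem IsLogBranch.hasDerivAt {U : Set ℂ} {p : ℂ} {ℓ : ℂ → ℂ} (h : IsLogBranch U p ℓ)
    (hU : IsOpen U) {z : ℂ} (hz : z ∈ U) : HasDerivAt ℓ (1 / (z - p)) z := by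
  have hd := (h.1.differentiableAt (hU.mem_nhds hz)).hasDerivAt
  have h1 := hd.cexp
  have h2 : HasDerivAt (fun x => Complex.exp (ℓ x)) 1 z := by
    refine ((hasDerivAt_id' z).sub_const p).congr_of_eventuallyEq ?_
    filter_upwards [hU.mem_nhds hz] with x hx using h.2 x hx
  have h3 := h1.unique h2
  rw [h.2 z hz] at h3
  have h4 := sub_ne_zero.2 (h.ne hz)
  refine hd.congr_deriv ?_
  field_simp
  linear_combination h3

theorem exists_isLogBranch {p z₀ : ℂ} (h : z₀ ≠ p) :
    ∃ ℓ, IsLogBranch (Metric.ball z₀ ‖z₀ - p‖) p ℓ := by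
  -- On this ball `(z - p) / (z₀ - p)` is at distance less than `1` from `1`, so the principal
  -- logarithm of the quotient is holomorphic.
  have h0 := sub_ne_zero.2 h
  refine ⟨fun z => Complex.log ((z - p) / (z₀ - p)) + Complex.log (z₀ - p), ?_, ?_⟩
  · intro z hz
    have hs : (z - p) / (z₀ - p) ∈ Complex.slitPlane := by
      left
      have hn : ‖(z - p) / (z₀ - p) - 1‖ < 1 := by
        rw [div_sub_one h0, norm_div, div_lt_one (norm_pos_iff.2 h0)]
        simpa [dist_eq_norm] using hz
      have := (Complex.abs_re_le_norm _).trans_lt hn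
      rw [abs_lt] at this
      simp only [Complex.sub_re, Complex.one_re] at this
      linarith [this.1]
    have hd : DifferentiableAt ℂ (fun z => (z - p) / (z₀ - p)) z := by fun_prop
    exact ((hd.clog hs).add_const _).differentiableWithinAt
  · intro z hz
    have hzp : z - p ≠ 0 := by
      intro e
      rw [sub_eq_zero] at e
      rw [e, Metric.mem_ball, dist_eq_norm, norm_sub_rev] at hz
      exact lt_irrefl _ hz
    rw [Complex.exp_add, Complex.exp_log (div_ne_zero hzp h0), Complex.exp_log h0,
      div_mul_cancel₀ _ h0]

theorem IsLogBranch.mono {U V : Set ℂ} {p : ℂ} {ℓ : ℂ → ℂ} (h : IsLogBranch U p ℓ)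
    (hV : V ⊆ U) : IsLogBranch V p ℓ :=
  ⟨h.1.mono hV, fun z hz => h.2 z (hV hz)⟩

theorem IsLogBranch.hasDerivAt_exp {U : Set ℂ} {p : ℂ} {ℓ : ℂ → ℂ} (h : IsLogBranch U p ℓ)
    (hU : IsOpen U) {z : ℂ} (hz : z ∈ U) (s : ℂ) :
    HasDerivAt (fun z => Complex.exp (s * ℓ z)) (s / (z - p) * Complex.exp (s * ℓ z)) z := by
  refine ((h.hasDerivAt hU hz).const_mul s).cexp.congr_deriv ?_
  ring

end LinP6

end

/-! ### Expansion of the Okubo vector at a finite singular point. -/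

noncomputable section

namespace LinP6

variable {D : LinP6}

theorem isOpen_regular (D : LinP6) : IsOpen {z | (∀ i, z ≠ D.pt i) ∧ z ≠ D.lam} := by
  refine IsOpen.and ?_ isOpen_ne
  simp only [Set.ofPred_forall]
  exact isOpen_iInter_of_finite fun i => isOpen_ne

theorem Regular.eventually_ne (h : D.Regular) (i : Fin 3) :
    ∀ᶠ z in 𝓝[≠] D.pt i, (∀ j, z ≠ D.pt j) ∧ z ≠ D.lam := by
  have hl : ∀ᶠ z in 𝓝[≠] D.pt i, z ≠ D.lam :=
    (eventually_ne_nhds (h.lam_ne i).symm).filter_mono nhdsWithin_le_nhds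
  have hj : ∀ᶠ z in 𝓝[≠] D.pt i, ∀ j, z ≠ D.pt j := by
    rw [eventually_all]
    intro j
    rcases eq_or_ne j i with rfl | hji
    · exact eventually_mem_nhdsWithin
    · exact (eventually_ne_nhds (h.pt_injective.ne hji.symm)).filter_mono nhdsWithin_le_nhds
  exact hj.and hl

theorem prod_sub_pt (z : ℂ) : ∏ j, (z - D.pt j) = z * (z - 1) * (z - D.t) := by
  simp [Fin.prod_univ_three, pt]

namespace Realization

variable {R : D.Realization}

/-- The Okubo system near a finite singular point, in terms of functions that are analytic there. -/
theorem exists_local_okubo (h : D.Regular) (i : Fin 3) (ρ : ℂ) {v : ℂ → ℂ}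
    (hv : AnalyticAt ℂ v (D.pt i)) {r : ℝ} (hr : 0 < r)
    (hsol : ∀ (U : Set ℂ) (ℓ : ℂ → ℂ), IsOpen U → D.lam ∉ U → (∀ z ∈ U, ∀ j, z ≠ D.pt j) →
      U ⊆ Metric.ball (D.pt i) r → IsLogBranch U (D.pt i) ℓ →
      D.IsSolutionOn U (fun z => Complex.exp (ρ * ℓ z) * v z)) :
    ∃ f : Fin 3 → ℂ → ℂ, (∀ j, AnalyticAt ℂ (f j) (D.pt i)) ∧
      (∀ j, ∀ᶠ z in 𝓝[≠] D.pt i,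
        f j z = (z - D.pt i) * R.okubo (fun z => ρ / (z - D.pt i)) v j z) ∧
      (∀ j, j ≠ i → f j (D.pt i) = 0) ∧
      ((fun z => ∑ j, f j z) =ᶠ[𝓝 (D.pt i)] fun z => (z - D.pt i) * deriv v z + ρ * v z) ∧
      (∀ j, (fun z => (z - D.pt j) * ((z - D.pt i) * deriv (f j) z + (ρ - 1) * f j z))
        =ᶠ[𝓝 (D.pt i)] fun z => (z - D.pt i) * (R.op (fun k => f k z) j - f j z)) ∧
      ∃ w, AnalyticAt ℂ w (D.pt i) ∧ ∀ j, (fun z => (z - D.pt j) * f j z) =ᶠ[𝓝 (D.pt i)]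
        fun z => (z - D.pt i) * (R.l j * v z + D.rho j * w z) := by
  set a := D.pt i with ha
  set τ : ℂ → ℂ := fun z => ρ / (z - a) with hτ
  have hla : a - D.lam ≠ 0 := sub_ne_zero.2 (h.lam_ne i).symm
  -- The function `(z - a) / (z - p_j)` with its removable singularity filled in when `p_j = a`.
  let q : Fin 3 → ℂ → ℂ := fun j z => if j = i then 1 else (z - a) / (z - D.pt j)
  -- The analytic continuation of `second` to `a`: since `1 / a12 = ∏ (z - p_j) / (z - λ)`, its
  -- factor `z - a` absorbs the poles of `τ` and `a11`.
  let w : ℂ → ℂ := fun z => (∏ j ∈ Finset.univ.erase i, (z - D.pt j)) / (z - D.lam) *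
    ((z - a) * deriv v z + ρ * v z - (∑ j, R.l j * q j z) * v z)
  let f : Fin 3 → ℂ → ℂ := fun j z => q j z * (R.l j * v z + D.rho j * w z)
  have hq : ∀ j, AnalyticAt ℂ (q j) a := by
    intro j
    by_cases hj : j = i
    · simp only [q, hj, if_true]
      exact analyticAt_const
    · simp only [q, hj, if_false]
      have : a - D.pt j ≠ 0 := sub_ne_zero.2 (h.pt_injective.ne (Ne.symm hj))
      exact (analyticAt_id.sub analyticAt_const).div (analyticAt_id.sub analyticAt_const) this
  have hv' := hv.deriv
  have hw : AnalyticAt ℂ w a := by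
    have h1 : AnalyticAt ℂ (fun z => ∏ j ∈ Finset.univ.erase i, (z - D.pt j)) a :=
      Finset.analyticAt_fun_prod _ fun j _ => by fun_prop
    have h2 : AnalyticAt ℂ (fun z => ∑ j, R.l j * q j z) a :=
      Finset.analyticAt_fun_sum _ fun j _ => analyticAt_const.mul (hq j)
    have h3 : AnalyticAt ℂ (fun z => (∏ j ∈ Finset.univ.erase i, (z - D.pt j)) / (z - D.lam)) a :=
      h1.div (by fun_prop) hla
    exact h3.mul (((analyticAt_id.sub analyticAt_const).mul hv' |>.add
      (analyticAt_const.mul hv)).sub (h2.mul hv))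
  have hf : ∀ j, AnalyticAt ℂ (f j) a := fun j =>
    (hq j).mul ((analyticAt_const.mul hv).add (analyticAt_const.mul hw))
  have hqe : ∀ j z, z ≠ a → q j z = (z - a) / (z - D.pt j) := by
    intro j z hz
    by_cases hj : j = i
    · simp only [q, hj, if_true]
      rw [← ha, div_self (sub_ne_zero.2 hz)]
    · simp only [q, hj, if_false]
  have hfo : ∀ z, (∀ j, z ≠ D.pt j) → z ≠ D.lam → ∀ j, f j z = (z - a) * R.okubo τ v j z := by
    intro z hz hzl j
    have hza : z - a ≠ 0 := sub_ne_zero.2 (hz i)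
    have hzl' : z - D.lam ≠ 0 := sub_ne_zero.2 hzl
    have hw' : w z = R.second τ v z := by
      have e1 : ∑ j, R.l j * q j z = (z - a) * R.a11 z := by
        rw [a11, Finset.mul_sum]
        exact Finset.sum_congr rfl fun j _ => by rw [hqe j z (hz i)]; ring
      have e2 : (z - a) * ∏ j ∈ Finset.univ.erase i, (z - D.pt j) = z * (z - 1) * (z - D.t) := by
        rw [← prod_sub_pt, ← Finset.mul_prod_erase _ _ (Finset.mem_univ i)]
      have e3 : z * (z - 1) * (z - D.t) ≠ 0 := by
        rw [← prod_sub_pt]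
        exact Finset.prod_ne_zero_iff.2 fun j _ => sub_ne_zero.2 (hz j)
      simp only [w, e1]
      rw [second, a12, h.sum_rho_div hz, hτ, ← e2]
      rw [← e2] at e3
      have e4 := right_ne_zero_of_mul e3
      field_simp
    simp only [f]
    rw [hqe j z (hz i), hw', okubo]
    ring
  have hfo' : ∀ᶠ z in 𝓝[≠] a, ∀ j, f j z = (z - a) * R.okubo τ v j z := by
    filter_upwards [h.eventually_ne i] with z hz j using hfo z hz.1 hz.2 j
  have hball : ∀ᶠ z in 𝓝[≠] a, z ∈ Metric.ball a r :=
    nhdsWithin_le_nhds (Metric.ball_mem_nhds a hr)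
  refine ⟨f, hf, fun j => hfo'.mono fun z hz => hz j, ?_, ?_, ?_, w, hw, ?_⟩
  · intro j hj
    simp [f, q, hj]
  · refine (AnalyticAt.frequently_eq_iff_eventually_eq
      (Finset.analyticAt_fun_sum _ fun j _ => hf j) (by fun_prop)).1 (Eventually.frequently ?_)
    filter_upwards [h.eventually_ne i, hfo'] with z hz hz'
    have hza : z - a ≠ 0 := sub_ne_zero.2 (hz.1 i)
    simp only [hz', ← Finset.mul_sum]
    rw [sum_okubo h hz.1 hz.2, hτ]
    field_simp
  · intro j
    have hfj := hf j
    have hfj' := hfj.deriv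
    have hop : AnalyticAt ℂ (fun z => R.op (fun k => f k z) j) a := by
      simp only [op_apply]
      exact (analyticAt_const.mul (Finset.analyticAt_fun_sum _ fun j _ => hf j)).add
        (analyticAt_const.mul (Finset.analyticAt_fun_sum _ fun j _ => analyticAt_const.mul (hf j)))
    refine (AnalyticAt.frequently_eq_iff_eventually_eq
      (by fun_prop) (by fun_prop)).1 (Eventually.frequently ?_)
    filter_upwards [h.eventually_ne i, hball] with z hz hzb
    have hza : z - a ≠ 0 := sub_ne_zero.2 (hz.1 i)
    obtain ⟨ℓ, hℓ⟩ := exists_isLogBranch (hz.1 i)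
    set U : Set ℂ := {z | (∀ i, z ≠ D.pt i) ∧ z ≠ D.lam} ∩ Metric.ball a r ∩
      Metric.ball z ‖z - D.pt i‖ with hUdef
    have hU : IsOpen U := (D.isOpen_regular.inter Metric.isOpen_ball).inter Metric.isOpen_ball
    have hzU : z ∈ U := ⟨⟨hz, hzb⟩, Metric.mem_ball_self (norm_pos_iff.2 hza)⟩
    have hℓU : IsLogBranch U (D.pt i) ℓ := hℓ.mono fun x hx => hx.2
    have hpU : ∀ z ∈ U, ∀ j, z ≠ D.pt j := fun x hx => hx.1.1.1
    have hlU : D.lam ∉ U := fun hx => hx.1.1.2 rfl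
    have hs := hsol U ℓ hU hlU hpU (fun x hx => hx.1.2) hℓU
    have hder := hasDerivAt_okubo (R := R) (τ := τ) h hU hpU hlU
      (fun x hx => hℓU.hasDerivAt_exp hU hx ρ) (fun x _ => Complex.exp_ne_zero _) hs hzU j
    have hfj2 : f j =ᶠ[𝓝 z] fun x => (x - a) * R.okubo τ v j x := by
      filter_upwards [hU.mem_nhds hzU] with x hx using hfo x (hpU x hx) hx.1.1.2 j
    have hd := ((((hasDerivAt_id' z).sub_const a).fun_mul hder).congr_of_eventuallyEq hfj2).deriv
    have hop2 : R.op (fun k => f k z) j = (z - a) * R.op (fun k => R.okubo τ v k z) j := by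
      have : (fun k => f k z) = (z - a) • fun k => R.okubo τ v k z := by
        ext k
        simp [hfo z hz.1 hz.2 k]
      rw [this, map_smul]
      rfl
    have hzj := sub_ne_zero.2 (hz.1 j)
    rw [hd, hop2, hfo z hz.1 hz.2 j, hτ]
    field_simp
    ring
  · intro j
    have hfj := hf j
    refine (AnalyticAt.frequently_eq_iff_eventually_eq
      (by fun_prop) (by fun_prop)).1 (Eventually.frequently ?_)
    filter_upwards [h.eventually_ne i] with z hz
    have hzj := sub_ne_zero.2 (hz.1 j)
    simp only [f, hqe j z (hz.1 i)]
    field_simp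

/-- The Taylor coefficients of the Okubo vector at a finite singular point. -/
theorem coeff_recursion {i : Fin 3} {ρ : ℂ} {f : Fin 3 → ℂ → ℂ}
    (hf : ∀ j, AnalyticAt ℂ (f j) (D.pt i)) {j : Fin 3}
    (he : (fun z => (z - D.pt j) * ((z - D.pt i) * deriv (f j) z + (ρ - 1) * f j z))
      =ᶠ[𝓝 (D.pt i)] fun z => (z - D.pt i) * (R.op (fun k => f k z) j - f j z)) (n : ℕ) :
    R.op (fun k => taylorCoeff (f k) (D.pt i) n) j - (n + ρ) * taylorCoeff (f j) (D.pt i) n =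
      (n + ρ) * ((D.pt i - D.pt j) * taylorCoeff (f j) (D.pt i) (n + 1)) := by
  set a := D.pt i
  have hfj := hf j
  have hfj' := hfj.deriv
  have hs1 : AnalyticAt ℂ (fun z => ∑ k, f k z) a := Finset.analyticAt_fun_sum _ fun j _ => hf j
  have hs2 : AnalyticAt ℂ (fun z => ∑ k, R.c k * f k z) a :=
    Finset.analyticAt_fun_sum _ fun j _ => analyticAt_const.mul (hf j)
  have hop : AnalyticAt ℂ (fun z => R.op (fun k => f k z) j) a := by
    simp only [op_apply]
    fun_prop
  have hφ : AnalyticAt ℂ (fun z => (z - a) * deriv (f j) z + (ρ - 1) * f j z) a := by fun_prop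
  -- Splitting `z - p_j = (z - a) + (a - p_j)` turns multiplication into an index shift plus a
  -- scalar.
  have e1 : (fun z => (z - D.pt j) * ((z - a) * deriv (f j) z + (ρ - 1) * f j z)) =
      fun z => (z - a) * ((z - a) * deriv (f j) z + (ρ - 1) * f j z) +
        (a - D.pt j) * ((z - a) * deriv (f j) z + (ρ - 1) * f j z) := by
    ext z; ring
  have e2 : (fun z => (z - a) * (R.op (fun k => f k z) j - f j z)) =
      fun z => (z - a) * (R.op (fun k => f k z) j + (-1) * f j z) := by
    ext z; ring
  have key := taylorCoeff_congr he (n + 1)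
  rw [e1, e2, taylorCoeff_add (by fun_prop) (by fun_prop), taylorCoeff_const_mul,
    taylorCoeff_sub_mul hφ, taylorCoeff_euler hfj, taylorCoeff_euler hfj,
    taylorCoeff_sub_mul (by fun_prop), taylorCoeff_add hop (by fun_prop),
    taylorCoeff_const_mul] at key
  have hop' : taylorCoeff (fun z => R.op (fun k => f k z) j) a n =
      R.op (fun k => taylorCoeff (f k) a n) j := by
    simp only [op_apply]
    rw [taylorCoeff_add (by fun_prop) (by fun_prop), taylorCoeff_const_mul, taylorCoeff_const_mul,
      taylorCoeff_sum _ fun k _ => hf k,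
      taylorCoeff_sum (F := fun k z => R.c k * f k z) _ fun k _ => analyticAt_const.mul (hf k)]
    simp only [taylorCoeff_const_mul]
  rw [hop'] at key
  push_cast at key
  linear_combination -key

/-- The coefficients of the Okubo vector at a finite singular point. They vanish eventually if the
vector is polynomial. -/
theorem exists_coeffs (R : D.Realization) (h : D.Regular) (i : Fin 3) (ρ : ℂ) {v : ℂ → ℂ}
    (hv : AnalyticAt ℂ v (D.pt i)) {r : ℝ} (hr : 0 < r)
    (hsol : ∀ (U : Set ℂ) (ℓ : ℂ → ℂ), IsOpen U → D.lam ∉ U → (∀ z ∈ U, ∀ j, z ≠ D.pt j) →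
      U ⊆ Metric.ball (D.pt i) r → IsLogBranch U (D.pt i) ℓ →
      D.IsSolutionOn U (fun z => Complex.exp (ρ * ℓ z) * v z)) :
    ∃ F : ℕ → Fin 3 → ℂ, (∀ j, j ≠ i → F 0 j = 0) ∧
      (∀ n, ∑ j, F n j = (n + ρ) * taylorCoeff v (D.pt i) n) ∧
      (∀ n j, R.op (F n) j - (n + ρ) * F n j = (n + ρ) * ((D.pt i - D.pt j) * F (n + 1) j)) ∧
      (∃ β, ∀ j, F 0 j + (D.pt i - D.pt j) * F 1 j = R.l j * v (D.pt i) + D.rho j * β) ∧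
      ((∀ j, ∃ p : Polynomial ℂ, ∀ᶠ z in 𝓝[≠] D.pt i,
        p.eval z = (z - D.pt i) * R.okubo (fun z => ρ / (z - D.pt i)) v j z) →
        ∃ n₀, ∀ n, n₀ < n → F n = 0) := by
  obtain ⟨f, hf, hfo, hf0, hsum, hrec, w, hw, him⟩ := exists_local_okubo (R := R) h i ρ hv hr hsol
  refine ⟨fun n j => taylorCoeff (f j) (D.pt i) n, ?_, ?_, fun n j => coeff_recursion hf (hrec j) n,
    ⟨w (D.pt i), ?_⟩, ?_⟩
  · intro j hj
    simp only [taylorCoeff_zero, hf0 j hj]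
  · intro n
    rw [← taylorCoeff_sum _ fun k _ => hf k, taylorCoeff_congr hsum, taylorCoeff_euler hv]
  · intro j
    have hfj := hf j
    have key := taylorCoeff_congr (him j) 1
    have e1 : (fun z => (z - D.pt j) * f j z) =
        fun z => (z - D.pt i) * f j z + (D.pt i - D.pt j) * f j z := by
      ext z; ring
    rw [e1, taylorCoeff_add (by fun_prop) (by fun_prop), taylorCoeff_const_mul,
      show 1 = 0 + 1 from rfl, taylorCoeff_sub_mul hfj, taylorCoeff_sub_mul (by fun_prop)] at key
    simpa [taylorCoeff_zero] using key
  · intro hp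
    choose p hp using hp
    refine ⟨∑ j, (p j).natDegree, fun n hn => funext fun j => ?_⟩
    have he : f j =ᶠ[𝓝 (D.pt i)] fun z => (p j).eval z := by
      refine (AnalyticAt.frequently_eq_iff_eventually_eq (hf j) ?_).1 (Eventually.frequently ?_)
      · exact (p j).differentiable.analyticAt _
      · filter_upwards [hfo j, hp j] with z h1 h2 using h1.trans h2.symm
    change taylorCoeff (f j) (D.pt i) n = 0
    rw [taylorCoeff_congr he, taylorCoeff_polynomial]
    exact (Finset.single_le_sum (f := fun j => (p j).natDegree) (fun _ _ => Nat.zero_le _)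
      (Finset.mem_univ j)).trans_lt hn

end Realization

end LinP6

end

/-! ### Expansion of the Okubo vector at infinity, in `u = 1/z`. -/

noncomputable section

namespace LinP6

variable {D : LinP6}

theorem eventually_inv_ne (D : LinP6) :
    ∀ᶠ u in 𝓝[≠] (0 : ℂ), u ≠ 0 ∧ (∀ j, 1 - D.pt j * u ≠ 0) ∧ 1 - D.lam * u ≠ 0 := by
  have h : ∀ c : ℂ, ∀ᶠ u in 𝓝[≠] (0 : ℂ), 1 - c * u ≠ 0 := by
    intro c
    refine Eventually.filter_mono nhdsWithin_le_nhds ?_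
    have : ContinuousAt (fun u : ℂ => 1 - c * u) 0 := by fun_prop
    exact this.eventually_ne (by simp)
  exact (eventually_mem_nhdsWithin.mono fun u hu => hu).and
    ((eventually_all.2 fun j => h _).and (h _))

theorem inv_sub_ne {c u : ℂ} (hu : u ≠ 0) (h : 1 - c * u ≠ 0) : u⁻¹ ≠ c := by
  rintro rfl
  simp [hu] at h

namespace Realization

/-- The coefficients of the Okubo vector at infinity. -/
theorem exists_coeffs_infty (R : D.Realization) (h : D.Regular) (ρ : ℂ) {g : ℂ → ℂ}
    (hg : AnalyticAt ℂ g 0) {r : ℝ}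
    (hsol : ∀ (U : Set ℂ) (ℓ : ℂ → ℂ), IsOpen U → U ⊆ {z | r < ‖z‖} → IsLogBranch U 0 ℓ →
      D.IsSolutionOn U (fun z => Complex.exp (-ρ * ℓ z) * g z⁻¹)) :
    ∃ F : ℕ → Fin 3 → ℂ, F 0 = ((D.kappa1 - ρ) * g 0) • D.rho ∧
      R.op (F 0) = (1 - ρ) • F 0 ∧
      (∀ n, ∑ j, F (n + 1) j = -(n + ρ) * taylorCoeff g 0 n) ∧
      (∀ n j, R.op (F (n + 1)) j + (n + ρ) * F (n + 1) j = (n + ρ) * (D.pt j * F n j)) := by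
  set τ : ℂ → ℂ := fun z => -ρ / (z - 0) with hτ
  set v : ℂ → ℂ := fun z => g z⁻¹ with hv
  have hg' := hg.deriv
  -- This is `u` times the second component; the factor removes its pole at infinity.
  let W : ℂ → ℂ := fun u => (1 - u) * (1 - D.t * u) / (1 - D.lam * u) *
    (-(u * deriv g u + ρ * g u) - (∑ j, R.l j / (1 - D.pt j * u)) * g u)
  let f : Fin 3 → ℂ → ℂ := fun j u => (R.l j * (u * g u) + D.rho j * W u) / (1 - D.pt j * u)
  have hq : ∀ c d : ℂ, AnalyticAt ℂ (fun u : ℂ => c / (1 - d * u)) 0 := fun c d =>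
    analyticAt_const.div (by fun_prop) (by simp)
  have hsumq : AnalyticAt ℂ (fun u => ∑ j, R.l j / (1 - D.pt j * u)) 0 :=
    Finset.analyticAt_fun_sum _ fun j _ => hq _ _
  have hW : AnalyticAt ℂ W 0 := by
    have h1 : AnalyticAt ℂ (fun u : ℂ => (1 - u) * (1 - D.t * u) / (1 - D.lam * u)) 0 :=
      AnalyticAt.div (by fun_prop) (by fun_prop) (by simp)
    refine h1.mul ?_
    fun_prop
  have hf : ∀ j, AnalyticAt ℂ (f j) 0 := fun j =>
    AnalyticAt.div (by fun_prop) (by fun_prop) (by simp)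
  have hderv : ∀ᶠ u in 𝓝[≠] (0 : ℂ), deriv v u⁻¹ = -u ^ 2 * deriv g u := by
    have : ∀ᶠ u in 𝓝[≠] (0 : ℂ), AnalyticAt ℂ g u :=
      hg.eventually_analyticAt.filter_mono nhdsWithin_le_nhds
    filter_upwards [this, D.eventually_inv_ne] with u hu hu0
    have h1 := hasDerivAt_inv (inv_ne_zero hu0.1)
    have h2 : HasDerivAt g (deriv g u) (u⁻¹)⁻¹ := by
      rw [inv_inv]; exact hu.differentiableAt.hasDerivAt
    have := (HasDerivAt.comp u⁻¹ h2 h1).deriv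
    rw [show v = g ∘ Inv.inv from rfl, this]
    field_simp
  have hfo : ∀ᶠ u in 𝓝[≠] (0 : ℂ), ∀ j, f j u = R.okubo τ v j u⁻¹ := by
    filter_upwards [hderv, D.eventually_inv_ne] with u hu ⟨hu0, huj, hul⟩ j
    have hz : ∀ j, u⁻¹ ≠ D.pt j := fun j => inv_sub_ne hu0 (huj j)
    have hzl : u⁻¹ ≠ D.lam := inv_sub_ne hu0 hul
    have hs : R.second τ v u⁻¹ = W u / u := by
      have e11 : R.a11 u⁻¹ = u * ∑ j, R.l j / (1 - D.pt j * u) := by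
        rw [a11, Finset.mul_sum]
        refine Finset.sum_congr rfl fun j _ => ?_
        have h1 := huj j
        have h2 := sub_ne_zero.2 (hz j)
        have h3 : u⁻¹ - D.pt j = (1 - D.pt j * u) / u := by field_simp
        rw [h3]
        field_simp
      have h1 : 1 - u ≠ 0 := by simpa [pt] using huj 1
      have h2 : 1 - D.t * u ≠ 0 := by simpa [pt] using huj 2
      have e12 : R.a12 u⁻¹ = u ^ 2 * (1 - D.lam * u) / ((1 - u) * (1 - D.t * u)) := by
        rw [a12, h.sum_rho_div hz]
        have h1' : u⁻¹ - 1 = (1 - u) / u := by field_simp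
        have h2' : u⁻¹ - D.t = (1 - D.t * u) / u := by field_simp
        have h3' : u⁻¹ - D.lam = (1 - D.lam * u) / u := by field_simp
        rw [h1', h2', h3']
        field_simp
      simp only [W]
      rw [second, e11, e12, hu, hτ, hv]
      simp only [inv_inv, sub_zero]
      generalize ∑ j, R.l j / (1 - D.pt j * u) = A
      field_simp
      ring
    have h1 := huj j
    have h3 : u⁻¹ - D.pt j = (1 - D.pt j * u) / u := by field_simp
    simp only [f]
    rw [okubo, hs, h3, hv]
    simp only [inv_inv]
    field_simp
  have hsum : (fun u => ∑ j, f j u) =ᶠ[𝓝 0] fun u => (u - 0) * (-1 * ((u - 0) * deriv g u + ρ * g u)) := by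
    refine (AnalyticAt.frequently_eq_iff_eventually_eq
      (Finset.analyticAt_fun_sum _ fun j _ => hf j) (by fun_prop)).1 (Eventually.frequently ?_)
    filter_upwards [hfo, hderv, D.eventually_inv_ne] with u h1 h2 ⟨hu0, huj, hul⟩
    simp only [h1]
    rw [sum_okubo h (fun j => inv_sub_ne hu0 (huj j)) (inv_sub_ne hu0 hul), h2, hτ, hv]
    simp only [inv_inv, sub_zero]
    field_simp
    ring
  have hrec : ∀ j, (fun u => (1 - D.pt j * u) * ((u - 0) * deriv (f j) u + ρ * f j u)) =ᶠ[𝓝 0]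
      fun u => f j u + (-1) * R.op (fun k => f k u) j := by
    intro j
    have hfj := hf j
    have hfj' := hfj.deriv
    have hop : AnalyticAt ℂ (fun z => R.op (fun k => f k z) j) 0 := by
      simp only [op_apply]
      exact (analyticAt_const.mul (Finset.analyticAt_fun_sum _ fun j _ => hf j)).add
        (analyticAt_const.mul (Finset.analyticAt_fun_sum _ fun j _ => analyticAt_const.mul (hf j)))
    refine (AnalyticAt.frequently_eq_iff_eventually_eq
      (by fun_prop) (by fun_prop)).1 (Eventually.frequently ?_)
    have hlarge : ∀ᶠ u in 𝓝[≠] (0 : ℂ), r < ‖u⁻¹‖ :=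
      (tendsto_norm_cobounded_atTop.comp tendsto_inv₀_nhdsNE_zero).eventually_gt_atTop r
    filter_upwards [hfo, hlarge, D.eventually_inv_ne, eventually_eventually_nhdsWithin.2 hfo]
      with u h1 hru ⟨hu0, huj, hul⟩ h2
    have hz : ∀ j, u⁻¹ ≠ D.pt j := fun j => inv_sub_ne hu0 (huj j)
    have hzl : u⁻¹ ≠ D.lam := inv_sub_ne hu0 hul
    have hz0 : u⁻¹ ≠ 0 := inv_ne_zero hu0
    obtain ⟨ℓ, hℓ⟩ := exists_isLogBranch hz0
    set U : Set ℂ := {z | (∀ i, z ≠ D.pt i) ∧ z ≠ D.lam} ∩ {z | r < ‖z‖} ∩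
      Metric.ball u⁻¹ ‖u⁻¹ - 0‖ with hUdef
    have hU : IsOpen U := (D.isOpen_regular.inter (isOpen_lt continuous_const continuous_norm)).inter
      Metric.isOpen_ball
    have hzU : u⁻¹ ∈ U := ⟨⟨⟨hz, hzl⟩, hru⟩, Metric.mem_ball_self (by simpa using hu0)⟩
    have hℓU : IsLogBranch U 0 ℓ := hℓ.mono fun x hx => hx.2
    have hpU : ∀ z ∈ U, ∀ j, z ≠ D.pt j := fun x hx => hx.1.1.1
    have hlU : D.lam ∉ U := fun hx => hx.1.1.2 rfl
    have hs := hsol U ℓ hU (fun x hx => hx.1.2) hℓU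
    have hder := hasDerivAt_okubo (R := R) (τ := τ) (v := v) h hU hpU hlU
      (fun x hx => hℓU.hasDerivAt_exp hU hx (-ρ)) (fun x _ => Complex.exp_ne_zero _) hs hzU j
    have hd : deriv (f j) u = ((R.op (fun k => f k u) j - f j u) / (u⁻¹ - D.pt j)
        - τ u⁻¹ * f j u) * (-(u ^ 2)⁻¹) := by
      have hc := HasDerivAt.comp u hder (hasDerivAt_inv hu0)
      have he : f j =ᶠ[𝓝 u] R.okubo τ v j ∘ Inv.inv := by
        rw [isOpen_compl_singleton.nhdsWithin_eq (show u ∈ ({0}ᶜ : Set ℂ) from hu0)] at h2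
        exact h2.mono fun x hx => hx j
      rw [(hc.congr_of_eventuallyEq he).deriv]
      simp only [h1]
    have h3 : u⁻¹ - D.pt j = (1 - D.pt j * u) / u := by field_simp
    have h4 := huj j
    rw [hd, hτ, h3]
    simp only [sub_zero]
    field_simp
    ring
  have hW0 : W 0 = (D.kappa1 - ρ) * g 0 := by
    simp [W, R.sum_l]
    ring
  have hop' : ∀ n j, taylorCoeff (fun z => R.op (fun k => f k z) j) 0 n =
      R.op (fun k => taylorCoeff (f k) 0 n) j := by
    intro n j
    have hs1 : AnalyticAt ℂ (fun z => ∑ k, f k z) 0 := Finset.analyticAt_fun_sum _ fun j _ => hf j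
    have hs2 : AnalyticAt ℂ (fun z => ∑ k, R.c k * f k z) 0 :=
      Finset.analyticAt_fun_sum _ fun j _ => analyticAt_const.mul (hf j)
    simp only [op_apply]
    rw [taylorCoeff_add (by fun_prop) (by fun_prop), taylorCoeff_const_mul, taylorCoeff_const_mul,
      taylorCoeff_sum _ fun k _ => hf k,
      taylorCoeff_sum (F := fun k z => R.c k * f k z) _ fun k _ => analyticAt_const.mul (hf k)]
    simp only [taylorCoeff_const_mul]
  refine ⟨fun n j => taylorCoeff (f j) 0 n, ?_, ?_, ?_, ?_⟩
  · ext j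
    simp [taylorCoeff_zero, f, hW0, mul_comm]
  · ext j
    have := (hrec j).eq_of_nhds
    simp only [mul_zero, sub_zero, one_mul, zero_mul, zero_add] at this
    simp only [taylorCoeff_zero, Pi.smul_apply, smul_eq_mul]
    linear_combination this
  · intro n
    rw [← taylorCoeff_sum _ fun k _ => hf k, taylorCoeff_congr hsum,
      taylorCoeff_sub_mul (by fun_prop), taylorCoeff_const_mul, taylorCoeff_euler hg]
    ring
  · intro n j
    have hfj := hf j
    have hfj' := hfj.deriv
    have hop : AnalyticAt ℂ (fun z => R.op (fun k => f k z) j) 0 := by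
      simp only [op_apply]
      exact (analyticAt_const.mul (Finset.analyticAt_fun_sum _ fun j _ => hf j)).add
        (analyticAt_const.mul (Finset.analyticAt_fun_sum _ fun j _ => analyticAt_const.mul (hf j)))
    have key := taylorCoeff_congr (hrec j) (n + 1)
    have hφ : AnalyticAt ℂ (fun u => (u - 0) * deriv (f j) u + ρ * f j u) 0 := by fun_prop
    have e1 : (fun u => (1 - D.pt j * u) * ((u - 0) * deriv (f j) u + ρ * f j u)) =
      fun u => ((u - 0) * deriv (f j) u + ρ * f j u) +
        (-D.pt j) * ((u - 0) * ((u - 0) * deriv (f j) u + ρ * f j u)) := by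
      ext z; ring
    rw [e1, taylorCoeff_add (by fun_prop) (by fun_prop), taylorCoeff_const_mul,
      taylorCoeff_sub_mul hφ, taylorCoeff_euler hfj, taylorCoeff_euler hfj,
      taylorCoeff_add (by fun_prop) (by fun_prop), taylorCoeff_const_mul, hop'] at key
    push_cast at key
    linear_combination key

end Realization

end LinP6

end

/-! ### Okubo vectors of solutions of polynomial type. -/

noncomputable section

namespace LinP6

variable {D : LinP6}

theorem isSolutionOn_of_local {U : Set ℂ} {y : ℂ → ℂ}
    (h : ∀ z ∈ U, ∃ V, IsOpen V ∧ z ∈ V ∧ D.IsSolutionOn V y) : D.IsSolutionOn U y := by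
  constructor
  · intro z hz
    obtain ⟨V, hV, hzV, hs⟩ := h z hz
    exact (hs.1.differentiableAt (hV.mem_nhds hzV)).differentiableWithinAt
  · intro z hz
    obtain ⟨V, hV, hzV, hs⟩ := h z hz
    exact hs.2 z hzV

theorem IsSolutionOn.congr {U : Set ℂ} {y y' : ℂ → ℂ} (h : D.IsSolutionOn U y) (hU : IsOpen U)
    (e : ∀ z ∈ U, y' z = y z) : D.IsSolutionOn U y' := by
  refine ⟨h.1.congr e, fun z hz => ?_⟩
  have he : y' =ᶠ[𝓝 z] y := by
    filter_upwards [hU.mem_nhds hz] with x hx using e x hx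
  rw [he.deriv.deriv_eq, he.deriv_eq, e z hz]
  exact h.2 z hz

/-- Only the branch of the logarithm at the point `D.pt i` matters for a solution
`(z - D.pt i) ^ s p(z)`. -/
theorem IsPolyTypeSolution.isSolutionOn_single {i : Fin 3} {s : ℂ} {p : Polynomial ℂ}
    (hsol : D.IsPolyTypeSolution (Pi.single i s) p) {U : Set ℂ} {ℓ : ℂ → ℂ} (hU : IsOpen U)
    (hl : D.lam ∉ U) (hp : ∀ z ∈ U, ∀ j, z ≠ D.pt j) (hℓ : IsLogBranch U (D.pt i) ℓ) :
    D.IsSolutionOn U (fun z => Complex.exp (s * ℓ z) * p.eval z) := by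
  refine isSolutionOn_of_local fun z hz => ?_
  choose L hL using fun j => exists_isLogBranch (hp z hz j)
  set V : Set ℂ := U ∩ ⋂ j, Metric.ball z ‖z - D.pt j‖ with hV
  have hVo : IsOpen V := hU.inter (isOpen_iInter_of_finite fun j => Metric.isOpen_ball)
  have hzV : z ∈ V := ⟨hz, Set.mem_iInter.2 fun j => Metric.mem_ball_self
    (norm_pos_iff.2 (sub_ne_zero.2 (hp z hz j)))⟩
  refine ⟨V, hVo, hzV, ?_⟩
  -- The given branch is kept at `D.pt i`. The other branches exist locally and enter with exponent
  -- zero.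
  have := hsol V (Function.update L i ℓ) hVo (fun h => hl h.1) ?_
  · simpa [Pi.single_apply] using this
  · intro j
    rcases eq_or_ne j i with rfl | hj
    · simpa using hℓ.mono fun x hx => hx.1
    · rw [Function.update_of_ne hj]
      exact (hL j).mono fun x hx => Set.mem_iInter.1 hx.2 j

theorem Regular.rho_mul_prod (h : D.Regular) (j : Fin 3) :
    D.rho j * ∏ k ∈ Finset.univ.erase j, (D.pt j - D.pt k) = D.pt j - D.lam := by
  have h0 := h.t_ne_zero
  have h1 := sub_ne_zero.2 h.t_ne_one
  have h1' := sub_ne_zero.2 h.t_ne_one.symm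
  fin_cases j
  · rw [show (Finset.univ : Finset (Fin 3)).erase ⟨0, by simp⟩ = {1, 2} from by decide]
    simp [rho, pt]
    field_simp
  · rw [show (Finset.univ : Finset (Fin 3)).erase ⟨1, by simp⟩ = {0, 2} from by decide]
    simp [rho, pt]
    field_simp
  · rw [show (Finset.univ : Finset (Fin 3)).erase ⟨2, by simp⟩ = {0, 1} from by decide]
    simp [rho, pt]
    field_simp

namespace Realization

/-- The second component of the system is a polynomial too, and the Okubo vector has no poles at
the other singular points. -/
theorem exists_polynomial_second (R : D.Realization) (h : D.Regular) {i : Fin 3} {s : ℂ}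
    {p : Polynomial ℂ} (hsol : D.IsPolyTypeSolution (Pi.single i s) p) :
    ∃ V : Polynomial ℂ, (∀ z, (∀ j, z ≠ D.pt j) → z ≠ D.lam →
        V.eval z = R.second (fun z => s / (z - D.pt i)) (fun z => p.eval z) z) ∧
      ∀ j, j ≠ i ∨ s = 0 → R.l j * p.eval (D.pt j) + D.rho j * V.eval (D.pt j) = 0 := by
  classical
  let Q : Fin 3 → Polynomial ℂ := fun j =>
    ∏ k ∈ Finset.univ.erase j, (Polynomial.X - Polynomial.C (D.pt k))
  have hQ : ∀ j z, (Q j).eval z = ∏ k ∈ Finset.univ.erase j, (z - D.pt k) := fun j z => by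
    simp [Q, Polynomial.eval_prod]
  -- The numerator of the second component after clearing all denominators except `z - λ`, that is,
  -- `second = N / (z - λ)`.
  let N : Polynomial ℂ := Q i * ((Polynomial.X - Polynomial.C (D.pt i)) * Polynomial.derivative p
    + Polynomial.C s * p) - (∑ j, Polynomial.C (R.l j) * Q j) * p
  have hN : ∀ z, N.eval z = (Q i).eval z * ((z - D.pt i) * (Polynomial.derivative p).eval z
      + s * p.eval z) - (∑ j, R.l j * (Q j).eval z) * p.eval z := fun z => by
    simp [N, Polynomial.eval_finsetSum]
  set τ : ℂ → ℂ := fun z => s / (z - D.pt i) with hτ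
  set v : ℂ → ℂ := fun z => p.eval z with hv
  have hsec : ∀ z, (∀ j, z ≠ D.pt j) → z ≠ D.lam →
      R.second τ v z = N.eval z / (z - D.lam) := by
    intro z hz hzl
    have hq : ∀ j, (z - D.pt j) * (Q j).eval z = z * (z - 1) * (z - D.t) := fun j => by
      rw [hQ, ← prod_sub_pt, ← Finset.mul_prod_erase _ _ (Finset.mem_univ j)]
    have e3 : z * (z - 1) * (z - D.t) ≠ 0 := by
      rw [← prod_sub_pt]
      exact Finset.prod_ne_zero_iff.2 fun j _ => sub_ne_zero.2 (hz j)
    have e1 : ∑ j, R.l j * (Q j).eval z = z * (z - 1) * (z - D.t) * R.a11 z := by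
      rw [a11, Finset.mul_sum]
      refine Finset.sum_congr rfl fun j _ => ?_
      have := sub_ne_zero.2 (hz j)
      rw [← hq j]
      field_simp
    have hza := sub_ne_zero.2 (hz i)
    have hzl' := sub_ne_zero.2 hzl
    have hdv : deriv v z = (Polynomial.derivative p).eval z := Polynomial.deriv p
    rw [second, a12, h.sum_rho_div hz, hN, e1, hdv, ← hq i, hτ]
    rw [← hq i] at e3
    have e4 := right_ne_zero_of_mul e3
    simp only [hv]
    field_simp
  -- The differential equation of the second component, multiplied by `(z - λ)²`, reads `(z - λ) N'
  -- - N = (z - λ) (...)` with a bracket continuous at `λ`. Letting `z → λ` gives `N(λ) = 0`, so the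
  -- apparent singularity causes no pole.
  have hroot : N.IsRoot D.lam := by
    have hpl : ∀ᶠ z in 𝓝 D.lam, ∀ j, z ≠ D.pt j :=
      eventually_all.2 fun j => eventually_ne_nhds (h.lam_ne j)
    have hev : ∀ᶠ z in 𝓝[≠] D.lam, (∀ j, z ≠ D.pt j) ∧ z ≠ D.lam :=
      (hpl.filter_mono nhdsWithin_le_nhds).and eventually_mem_nhdsWithin
    have hid : (fun z => (Polynomial.derivative N).eval z * (z - D.lam) - N.eval z) =ᶠ[𝓝[≠] D.lam]
        fun z => (z - D.lam) * ((z - D.lam) * (R.a21 z * v z) + (R.a22 z - τ z) * N.eval z) := by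
      filter_upwards [hev] with z ⟨hz, hzl⟩
      obtain ⟨ℓ, hℓ⟩ := exists_isLogBranch (hz i)
      set U : Set ℂ := {z | (∀ i, z ≠ D.pt i) ∧ z ≠ D.lam} ∩ Metric.ball z ‖z - D.pt i‖
      have hU : IsOpen U := D.isOpen_regular.inter Metric.isOpen_ball
      have hzU : z ∈ U := ⟨⟨hz, hzl⟩, Metric.mem_ball_self (norm_pos_iff.2 (sub_ne_zero.2 (hz i)))⟩
      have hpU : ∀ z ∈ U, ∀ j, z ≠ D.pt j := fun x hx => hx.1.1
      have hlU : D.lam ∉ U := fun hx => hx.1.2 rfl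
      have hℓU : IsLogBranch U (D.pt i) ℓ := hℓ.mono fun x hx => hx.2
      have hd := (hasDerivAt_second (R := R) (τ := τ) (v := v) h hU hpU hlU
        (fun x hx => hℓU.hasDerivAt_exp hU hx s) (fun x _ => Complex.exp_ne_zero _)
        (hsol.isSolutionOn_single hU hlU hpU hℓU) hzU).2
      have hzl' := sub_ne_zero.2 hzl
      have hd2 := (N.hasDerivAt z).fun_div ((hasDerivAt_id' z).sub_const D.lam) hzl'
      have he : R.second τ v =ᶠ[𝓝 z] fun z => N.eval z / (z - D.lam) := by
        filter_upwards [hU.mem_nhds hzU] with x hx using hsec x hx.1.1 hx.1.2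
      have := hd.unique (hd2.congr_of_eventuallyEq he)
      rw [hsec z hz hzl] at this
      field_simp at this
      linear_combination -this
    have hc : ∀ a : Fin 3 → ℂ, ContinuousAt (fun z => ∑ j, a j / (z - D.pt j)) D.lam := fun a =>
      (hasDerivAt_sum_div h.lam_ne).continuousAt
    have h21 : ContinuousAt R.a21 D.lam := hc _
    have h22 : ContinuousAt R.a22 D.lam := hc _
    have hτc : ContinuousAt τ D.lam :=
      ContinuousAt.div (by fun_prop) (by fun_prop) (sub_ne_zero.2 (h.lam_ne i))
    have hvc : Continuous v := p.continuous
    have hNc : Continuous fun z => N.eval z := N.continuous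
    have hNc' : Continuous fun z => (Polynomial.derivative N).eval z := Polynomial.continuous _
    have := ((ContinuousAt.eventuallyEq_nhds_iff_eventuallyEq_nhdsNE
      (by fun_prop) (by fun_prop)).1 hid).eq_of_nhds
    simpa using this
  obtain ⟨V, hV⟩ := Polynomial.dvd_iff_isRoot.2 hroot
  have hVe : ∀ z, N.eval z = (z - D.lam) * V.eval z := fun z => by rw [hV]; simp
  refine ⟨V, fun z hz hzl => ?_, fun j hj => ?_⟩
  · have := sub_ne_zero.2 hzl
    rw [hsec z hz hzl, hVe]
    field_simp
  · have hne := sub_ne_zero.2 (h.lam_ne j).symm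
    have hq0 : ∀ k, k ≠ j → (Q k).eval (D.pt j) = 0 := fun k hk => by
      rw [hQ]
      exact Finset.prod_eq_zero (Finset.mem_erase.2 ⟨hk.symm, Finset.mem_univ j⟩) (sub_self _)
    have hs : ∑ k, R.l k * (Q k).eval (D.pt j) = R.l j * (Q j).eval (D.pt j) :=
      Finset.sum_eq_single j (fun k _ hk => by rw [hq0 k hk, mul_zero]) (by simp)
    have h1 : (Q i).eval (D.pt j) * ((D.pt j - D.pt i) * (Polynomial.derivative p).eval (D.pt j)
        + s * p.eval (D.pt j)) = 0 := by
      by_cases hij : j = i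
      · have hs0 : s = 0 := hj.resolve_left (fun h => h hij)
        rw [hij, hs0]
        ring
      · rw [hq0 i (Ne.symm hij), zero_mul]
    have h2 := hVe (D.pt j)
    rw [hN, h1, hs] at h2
    have h3 := h.rho_mul_prod j
    rw [← hQ j] at h3
    refine mul_left_cancel₀ hne ?_
    linear_combination (-D.rho j) * h2 - (R.l j * p.eval (D.pt j)) * h3

/-- The Okubo vector of a solution `(z - D.pt i) ^ s p(z)` is polynomial. -/
theorem exists_polynomial_okubo (R : D.Realization) (h : D.Regular) {i : Fin 3} {s : ℂ}
    {p : Polynomial ℂ} (hsol : D.IsPolyTypeSolution (Pi.single i s) p) (j : Fin 3) :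
    ∃ q : Polynomial ℂ, ∀ z, (∀ j, z ≠ D.pt j) → z ≠ D.lam →
        q.eval z = (z - D.pt i) *
          R.okubo (fun z => s / (z - D.pt i)) (fun z => p.eval z) j z := by
  obtain ⟨V, hV, hV0⟩ := R.exists_polynomial_second h hsol
  by_cases hj : j = i
  · refine ⟨Polynomial.C (R.l j) * p + Polynomial.C (D.rho j) * V, fun z hz hzl => ?_⟩
    have := sub_ne_zero.2 (hz i)
    rw [okubo, ← hV z hz hzl, hj]
    simp
    field_simp
  · have hroot : (Polynomial.C (R.l j) * p + Polynomial.C (D.rho j) * V).IsRoot (D.pt j) := by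
      simpa using hV0 j (Or.inl hj)
    obtain ⟨q, hq⟩ := Polynomial.dvd_iff_isRoot.2 hroot
    refine ⟨(Polynomial.X - Polynomial.C (D.pt i)) * q, fun z hz hzl => ?_⟩
    have := sub_ne_zero.2 (hz j)
    have hz' := congrArg (Polynomial.eval z) hq
    simp only [Polynomial.eval_add, Polynomial.eval_mul, Polynomial.eval_C, Polynomial.eval_sub,
      Polynomial.eval_X] at hz'
    rw [okubo, ← hV z hz hzl]
    simp only [Polynomial.eval_mul, Polynomial.eval_C, Polynomial.eval_sub, Polynomial.eval_X, hz']
    field_simp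

end Realization

end LinP6

end

/-! ### Convergent power series solutions of Okubo systems at a finite point. -/

noncomputable section

theorem exists_geometric_bound {b : ℕ → ℝ} (hb : ∀ n, 0 ≤ b n) {C : ℝ} (hC : 1 ≤ C) {n₀ : ℕ}
    (h : ∀ n, n₀ ≤ n → b (n + 1) ≤ C * b n) : ∃ A, ∀ n, b n ≤ A * C ^ n := by
  refine ⟨∑ k ∈ Finset.range (n₀ + 1), b k, fun n => ?_⟩
  have hA : ∀ k ≤ n₀, b k ≤ ∑ k ∈ Finset.range (n₀ + 1), b k := fun k hk =>
    Finset.single_le_sum (fun i _ => hb i) (Finset.mem_range.2 (by omega))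
  have hA0 : 0 ≤ ∑ k ∈ Finset.range (n₀ + 1), b k := Finset.sum_nonneg fun i _ => hb i
  induction n with
  | zero => simpa using hA 0 (by omega)
  | succ n ih =>
    by_cases hn : n₀ ≤ n
    · calc b (n + 1) ≤ C * b n := h n hn
        _ ≤ C * ((∑ k ∈ Finset.range (n₀ + 1), b k) * C ^ n) := by gcongr
        _ = _ := by ring
    · exact (hA (n + 1) (by omega)).trans (le_mul_of_one_le_right hA0 (one_le_pow₀ hC))

/-- A power series with geometrically bounded coefficients and its derivative. -/
theorem hasDerivAt_powerSeries {a : ℕ → ℂ} {A C : ℝ} (hC : 0 < C) (ha : ∀ n, ‖a n‖ ≤ A * C ^ n)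
    {x : ℂ} (hx : x ∈ Metric.ball (0 : ℂ) (1 / (2 * C))) :
    HasSum (fun n => a n * x ^ n) (∑' n, a n * x ^ n) ∧
    ∃ d, HasDerivAt (fun x => ∑' n, a n * x ^ n) d x ∧
      HasSum (fun n => (n + 1) * a (n + 1) * x ^ n) d := by
  have hle : ∀ (n : ℕ) (w : ℂ), w ∈ Metric.ball (0 : ℂ) (1 / (2 * C)) →
      ‖a n * w ^ n‖ ≤ A * (1 / 2) ^ n := by
    intro n w hw
    have hw' : ‖w‖ ≤ 1 / (2 * C) := by simpa using (mem_ball_zero_iff.1 hw).le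
    rw [norm_mul, norm_pow]
    have hA : 0 ≤ A * C ^ n := (norm_nonneg _).trans (ha n)
    calc ‖a n‖ * ‖w‖ ^ n ≤ (A * C ^ n) * (1 / (2 * C)) ^ n := by
          gcongr
          exact ha n
      _ = A * (1 / 2) ^ n := by
          rw [mul_assoc, ← mul_pow]
          congr 2
          field_simp
  have hu : Summable fun n : ℕ => A * (1 / 2 : ℝ) ^ n :=
    (summable_geometric_of_lt_one (by norm_num) (by norm_num)).mul_left A
  have hd : ∀ n : ℕ, DifferentiableOn ℂ (fun w : ℂ => a n * w ^ n)
      (Metric.ball (0 : ℂ) (1 / (2 * C))) := fun n => by fun_prop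
  refine ⟨(Summable.of_norm_bounded hu fun n => hle n x hx).hasSum, ?_⟩
  have hdiff := Complex.differentiableOn_tsum_of_summable_norm hu hd Metric.isOpen_ball hle
  refine ⟨_, (hdiff.differentiableAt (Metric.isOpen_ball.mem_nhds hx)).hasDerivAt, ?_⟩
  have hs := Complex.hasSum_deriv_of_summable_norm hu hd Metric.isOpen_ball hle hx
  rw [← hasSum_nat_add_iff' 1] at hs
  simp only [Finset.range_one, Finset.sum_singleton, pow_zero, mul_one, deriv_const, sub_zero] at hs
  refine hs.congr_fun fun n => ?_
  rw [deriv_const_mul _ (by fun_prop)]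
  simp
  ring

theorem analyticAt_powerSeries {a : ℕ → ℂ} {A C : ℝ} (hC : 0 < C) (ha : ∀ n, ‖a n‖ ≤ A * C ^ n) :
    AnalyticAt ℂ (fun x => ∑' n, a n * x ^ n) 0 := by
  have hr : (0 : ℝ) < 1 / (2 * C) := by positivity
  refine DifferentiableOn.analyticAt (s := Metric.ball 0 (1 / (2 * C))) (fun x hx => ?_)
    (Metric.ball_mem_nhds _ hr)
  obtain ⟨-, d, hd, -⟩ := hasDerivAt_powerSeries hC ha hx
  exact hd.differentiableAt.differentiableWithinAt

theorem powerSeries_zero (a : ℕ → ℂ) : (∑' n, a n * (0 : ℂ) ^ n) = a 0 := by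
  rw [tsum_eq_single 0 fun n hn => by simp [hn]]
  simp

namespace LinP6

namespace Realization

variable {D : LinP6} {R : D.Realization}

theorem hasSum_op {v : ℕ → Fin 3 → ℂ} {x : ℂ} {s : Fin 3 → ℂ}
    (h : ∀ j, HasSum (fun n => v n j * x ^ n) (s j)) (j : Fin 3) :
    HasSum (fun n => R.op (v n) j * x ^ n) (R.op s j) := by
  have h1 : HasSum (fun n => R.l j * ∑ k, v n k * x ^ n) (R.l j * ∑ k, s k) :=
    (hasSum_sum fun k _ => h k).mul_left _
  have h2 : HasSum (fun n => D.rho j * ∑ k, R.c k * (v n k * x ^ n))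
      (D.rho j * ∑ k, R.c k * s k) :=
    (hasSum_sum fun k _ => (h k).mul_left (R.c k)).mul_left _
  refine (h1.add h2).congr_fun fun n => ?_
  simp only [op_apply, ← mul_assoc, ← Finset.sum_mul]
  ring

theorem op_single (i : Fin 3) (s : ℂ) : R.op (Pi.single i s) i = D.θ i * s := by
  rw [op_apply, ← R.diag i]
  simp [Pi.single_apply]
  ring

variable (R) in
theorem exists_norm_op_le : ∃ K : ℝ, 0 ≤ K ∧ ∀ v, ‖R.op v‖ ≤ K * ‖v‖ :=
  ⟨‖LinearMap.toContinuousLinearMap R.op‖, norm_nonneg _,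
    (LinearMap.toContinuousLinearMap R.op).le_opNorm⟩

variable (R) in
/-- The coefficients of an analytic solution of an inhomogeneous Okubo system. -/
theorem exists_seq (h : D.Regular) (i : Fin 3) {V G₀ : Fin 3 → ℂ}
    (h0 : R.op G₀ i = V i) (hθ : ∀ n : ℕ, D.θ i ≠ n + 1) :
    ∃ G : ℕ → Fin 3 → ℂ, G 0 = G₀ ∧ (∀ n j, n * G n j + (n + 1) * ((D.pt i - D.pt j) * G (n + 1) j) +
      (if n = 0 then V j else 0) = R.op (G n) j) := by
  set a := D.pt i with ha
  have hpt : ∀ j, j ≠ i → a - D.pt j ≠ 0 := fun j hj =>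
    sub_ne_zero.2 (h.pt_injective.ne (Ne.symm hj))
  -- The coefficient `D.pt i - D.pt j` kills row `i`. The recursion therefore determines only the
  -- components `j ≠ i` of the next vector; component `i` comes from row `i` of the following
  -- equation, solvable because `θ_i ≠ n + 1`.
  have hstep : ∀ (n : ℕ) (y : Fin 3 → ℂ), ∃ g : Fin 3 → ℂ,
      (∀ j, j ≠ i → (n + 1) * ((a - D.pt j) * g j) = y j) ∧ R.op g i = (n + 1) * g i := by
    intro n y
    have hn : (n : ℂ) + 1 ≠ 0 := by exact_mod_cast n.succ_ne_zero
    let g' : Fin 3 → ℂ := fun j => if j = i then 0 else y j / ((n + 1) * (a - D.pt j))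
    have hne : (n : ℂ) + 1 - D.θ i ≠ 0 := sub_ne_zero.2 (hθ n).symm
    refine ⟨g' + Pi.single i (R.op g' i / (n + 1 - D.θ i)), fun j hj => ?_, ?_⟩
    · have := hpt j hj
      simp [g', hj]
      field_simp
    · rw [map_add, Pi.add_apply, op_single]
      simp only [Pi.add_apply, Pi.single_eq_same]
      have : g' i = 0 := by simp [g']
      rw [this]
      field_simp
      ring
  choose step hstep1 hstep2 using hstep
  let G : ℕ → Fin 3 → ℂ := fun n => Nat.rec G₀ (fun n g => step n fun j =>
    R.op g j - n * g j - if n = 0 then V j else 0) n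
  have hG0 : G 0 = G₀ := rfl
  have hGs : ∀ n, G (n + 1) = step n fun j =>
    R.op (G n) j - n * G n j - if n = 0 then V j else 0 := fun n => rfl
  have hrec : ∀ n j, n * G n j + (n + 1) * ((a - D.pt j) * G (n + 1) j) +
      (if n = 0 then V j else 0) = R.op (G n) j := by
    intro n j
    rcases eq_or_ne j i with rfl | hj
    · rw [← ha, sub_self, zero_mul, mul_zero, add_zero]
      rcases n with _ | n
      · simp [hG0, h0]
      · rw [hGs, hstep2]
        simp
    · rw [hGs n, hstep1 n _ j hj]
      ring
  exact ⟨G, hG0, hrec⟩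

/-- For large `n` the components `j ≠ i` grow by at most `(K + 1) / δ`, and component `i` is
controlled by them because `‖n + 1 - θ_i‖ ≥ 1`. -/
theorem exists_bound (h : D.Regular) {i : Fin 3} {V : Fin 3 → ℂ} {G : ℕ → Fin 3 → ℂ}
    (hrec : (∀ n j, n * G n j + (n + 1) * ((D.pt i - D.pt j) * G (n + 1) j) +
      (if n = 0 then V j else 0) = R.op (G n) j)) :
    ∃ A C : ℝ, 0 < C ∧ ∀ n, ‖G n‖ ≤ A * C ^ n := by
  set a := D.pt i with ha
  have hpt : ∀ j, j ≠ i → a - D.pt j ≠ 0 := fun j hj =>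
    sub_ne_zero.2 (h.pt_injective.ne (Ne.symm hj))
  obtain ⟨K, hK0, hK⟩ := R.exists_norm_op_le
  obtain ⟨δ, hδ, hδj⟩ : ∃ δ : ℝ, 0 < δ ∧ ∀ j, j ≠ i → δ ≤ ‖a - D.pt j‖ := by
    refine ⟨Finset.univ.inf' Finset.univ_nonempty fun j => if j = i then 1 else ‖a - D.pt j‖,
      ?_, fun j hj => ?_⟩
    · rw [Finset.lt_inf'_iff]
      intro j _
      split_ifs with hj
      · exact one_pos
      · exact norm_pos_iff.2 (hpt j hj)
    · refine (Finset.inf'_le _ (Finset.mem_univ j)).trans ?_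
      simp [hj]
  obtain ⟨n₀, hn₀⟩ := exists_nat_ge (‖D.θ i‖ + 1)
  have hbound : ∀ n, n₀ + 1 ≤ n → ‖G (n + 1)‖ ≤ ((K + 1) * ((K + 1) / δ) + 1) * ‖G n‖ := by
    intro n hn
    have hn1 : (0 : ℝ) < (n : ℝ) + 1 := by positivity
    have hj1 : ∀ j, j ≠ i → ‖G (n + 1) j‖ ≤ (K + 1) / δ * ‖G n‖ := by
      intro j hj
      have e : (n + 1) * ((a - D.pt j) * G (n + 1) j) = R.op (G n) j - n * G n j := by
        have := hrec n j
        rw [if_neg (by omega)] at this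
        linear_combination this
      have e2 := congrArg norm e
      have hnn : ‖(n : ℂ) + 1‖ = n + 1 := by
        have := Complex.norm_natCast (n + 1)
        push_cast at this
        exact this
      rw [norm_mul, norm_mul, hnn] at e2
      have e3 : ‖R.op (G n) j - n * G n j‖ ≤ (n + 1) * ((K + 1) * ‖G n‖) := by
        calc ‖R.op (G n) j - n * G n j‖ ≤ ‖R.op (G n) j‖ + ‖(n : ℂ) * G n j‖ := norm_sub_le _ _
          _ ≤ K * ‖G n‖ + n * ‖G n‖ := by
            rw [norm_mul, Complex.norm_natCast]
            gcongr
            · exact (norm_le_pi_norm _ j).trans (hK _)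
            · exact norm_le_pi_norm _ j
          _ ≤ (n + 1) * ((K + 1) * ‖G n‖) := by
            have e : 0 ≤ n * (K * ‖G n‖) + ‖G n‖ := by positivity
            linarith
      rw [← e2] at e3
      have e4 := le_of_mul_le_mul_left e3 hn1
      rw [div_mul_eq_mul_div, le_div_iff₀ hδ]
      calc ‖G (n + 1) j‖ * δ ≤ ‖G (n + 1) j‖ * ‖a - D.pt j‖ := by
            gcongr
            exact hδj j hj
        _ ≤ _ := by rw [mul_comm]; exact e4
    have hi : ‖G (n + 1) i‖ ≤ K * ((K + 1) / δ * ‖G n‖) := by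
      obtain ⟨w, hw⟩ : ∃ w : Fin 3 → ℂ, w = G (n + 1) - Pi.single i (G (n + 1) i) := ⟨_, rfl⟩
      have e : ((n + 1 : ℕ) - D.θ i) * G (n + 1) i = R.op w i := by
        have hni := hrec (n + 1) i
        rw [if_neg (by omega), ← ha, sub_self] at hni
        rw [hw, map_sub, Pi.sub_apply, op_single, ← hni]
        push_cast
        ring
      have e2 := congrArg norm e
      rw [norm_mul] at e2
      have e3 : 1 ≤ ‖((n + 1 : ℕ) : ℂ) - D.θ i‖ := by
        have h1 := norm_sub_norm_le (((n + 1 : ℕ) : ℂ)) (D.θ i)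
        rw [Complex.norm_natCast] at h1
        have h2 : (n₀ : ℝ) + 1 ≤ n := by exact_mod_cast hn
        push_cast at h1 ⊢
        linarith
      have e4 : ‖w‖ ≤ (K + 1) / δ * ‖G n‖ := by
        rw [hw, pi_norm_le_iff_of_nonneg (by positivity)]
        intro j
        rcases eq_or_ne j i with rfl | hj
        · simp
          positivity
        · simpa [hj] using hj1 j hj
      calc ‖G (n + 1) i‖ ≤ ‖((n + 1 : ℕ) : ℂ) - D.θ i‖ * ‖G (n + 1) i‖ :=
            le_mul_of_one_le_left (norm_nonneg _) e3
        _ = ‖R.op w i‖ := e2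
        _ ≤ K * ‖w‖ := (norm_le_pi_norm _ i).trans (hK _)
        _ ≤ K * ((K + 1) / δ * ‖G n‖) := mul_le_mul_of_nonneg_left e4 hK0
    have hX : 0 ≤ (K + 1) / δ * ‖G n‖ := by positivity
    rw [pi_norm_le_iff_of_nonneg (by positivity)]
    intro j
    rcases eq_or_ne j i with rfl | hj
    · calc ‖G (n + 1) j‖ ≤ K * ((K + 1) / δ * ‖G n‖) := hi
        _ ≤ K * ((K + 1) / δ * ‖G n‖) + ((K + 1) / δ * ‖G n‖ + ‖G n‖) :=
          le_add_of_nonneg_right (by positivity)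
        _ = _ := by ring
    · calc ‖G (n + 1) j‖ ≤ (K + 1) / δ * ‖G n‖ := hj1 j hj
        _ ≤ (K + 1) / δ * ‖G n‖ + (K * ((K + 1) / δ * ‖G n‖) + ‖G n‖) :=
          le_add_of_nonneg_right (by positivity)
        _ = _ := by ring
  have hC1 : 1 ≤ (K + 1) * ((K + 1) / δ) + 1 := by
    have : 0 ≤ (K + 1) * ((K + 1) / δ) := by positivity
    linarith
  obtain ⟨A, hA⟩ := exists_geometric_bound (b := fun n => ‖G n‖) (fun n => norm_nonneg _) hC1 hbound
  exact ⟨A, _, zero_lt_one.trans_le hC1, hA⟩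

variable (R) in
/-- Analytic solutions of an inhomogeneous Okubo system at a singular point. -/
theorem exists_analytic (h : D.Regular) (i : Fin 3) {V G₀ : Fin 3 → ℂ}
    (h0 : R.op G₀ i = V i) (hθ : ∀ n : ℕ, D.θ i ≠ n + 1) :
    ∃ (H : Fin 3 → ℂ → ℂ) (r : ℝ), 0 < r ∧ (∀ j, AnalyticAt ℂ (H j) (D.pt i)) ∧
      (∀ j, H j (D.pt i) = G₀ j) ∧ ∀ z ∈ Metric.ball (D.pt i) r, ∀ j, ∃ d,
        HasDerivAt (H j) d z ∧ (z - D.pt j) * d + V j = R.op (fun k => H k z) j := by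
  set a := D.pt i with ha
  obtain ⟨G, hG0, hrec⟩ := R.exists_seq h i h0 hθ
  obtain ⟨A, C, hC, hA⟩ := exists_bound h hrec
  have hA' : ∀ j n, ‖G n j‖ ≤ A * C ^ n := fun j n => (norm_le_pi_norm _ j).trans (hA n)
  refine ⟨fun j z => ∑' n, G n j * (z - a) ^ n, 1 / (2 * C), by positivity, ?_, ?_, ?_⟩
  · intro j
    have h1 : AnalyticAt ℂ (fun x => ∑' n, G n j * x ^ n) (a - a) := by
      rw [sub_self]
      exact analyticAt_powerSeries hC (hA' j)
    exact h1.fun_comp (f := fun z => z - a) (by fun_prop)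
  · intro j
    simp only [sub_self]
    rw [powerSeries_zero, hG0]
  · intro z hz j
    have hx : z - a ∈ Metric.ball (0 : ℂ) (1 / (2 * C)) := by
      simpa [dist_eq_norm] using hz
    have hsum : ∀ k, HasSum (fun n => G n k * (z - a) ^ n) (∑' n, G n k * (z - a) ^ n) :=
      fun k => (hasDerivAt_powerSeries hC (hA' k) hx).1
    obtain ⟨d, hd1, hd2⟩ := (hasDerivAt_powerSeries hC (hA' j) hx).2
    have hd3 : HasDerivAt (fun z => ∑' n, G n j * (z - a) ^ n) d z :=
      HasDerivAt.comp_sub_const z a hd1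
    refine ⟨d, hd3, ?_⟩
    have hop := hasSum_op (R := R) hsum j
    have h1 : HasSum (fun n => n * G n j * (z - a) ^ n) ((z - a) * d) := by
      rw [← hasSum_nat_add_iff' 1]
      simp only [Finset.range_one, Finset.sum_singleton, Nat.cast_zero, zero_mul, sub_zero]
      refine (hd2.mul_left (z - a)).congr_fun fun n => ?_
      push_cast
      ring
    have h2 : HasSum (fun n => (if n = 0 then V j else 0) * (z - a) ^ n) (V j) := by
      have := hasSum_single (f := fun n : ℕ => (if n = 0 then V j else 0) * (z - a) ^ n) 0
        (fun n hn => by simp [hn])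
      simpa using this
    have h3 := ((h1.add (hd2.mul_left (a - D.pt j))).add h2)
    have h4 : (fun n : ℕ => n * G n j * (z - a) ^ n + (a - D.pt j) * ((n + 1) * G (n + 1) j *
        (z - a) ^ n) + (if n = 0 then V j else 0) * (z - a) ^ n) =
        fun n => R.op (G n) j * (z - a) ^ n := by
      ext n
      rw [← hrec n j]
      ring
    rw [h4] at h3
    exact (show _ = _ by ring).trans (hop.unique h3).symm

end Realization

end LinP6

end

/-! ### Convergence and continuation of formal solutions at infinity. -/

noncomputable section

namespace LinP6

namespace Realization

variable {D : LinP6} {R : D.Realization}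

/-- Once `n ≥ 2‖K‖ + 2k`, the term `op (G (n + 1))` is absorbed on the left, since `n + ‖K‖ ≤ 3 (n +
1 - ‖K‖ - k)`. -/
theorem exists_bound_infty {K : ℂ} {G : ℕ → Fin 3 → ℂ}
    (hrec : ∀ (n : ℕ) j, R.op (G (n + 1)) j - (K - (n + 1)) * G (n + 1) j =
      -(K - n) * (D.pt j * G n j)) : ∃ A C : ℝ, 0 < C ∧ ∀ n, ‖G n‖ ≤ A * C ^ n := by
  obtain ⟨k, hk0, hk⟩ := R.exists_norm_op_le
  obtain ⟨n₀, hn₀⟩ := exists_nat_ge (2 * ‖K‖ + 2 * k)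
  have hbound : ∀ n, n₀ ≤ n → ‖G (n + 1)‖ ≤ (3 * ‖D.pt‖ + 1) * ‖G n‖ := by
    intro n hn
    have hn' : 2 * ‖K‖ + 2 * k ≤ n := hn₀.trans (by exact_mod_cast hn)
    have e : ((n + 1 : ℕ) - K : ℂ) • G (n + 1) =
        ((n : ℂ) - K) • (D.pt * G n) - R.op (G (n + 1)) := by
      ext j
      have := hrec n j
      simp only [Pi.smul_apply, Pi.sub_apply, Pi.mul_apply, smul_eq_mul]
      push_cast
      linear_combination this
    have e2 := congrArg norm e
    rw [norm_smul] at e2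
    have e3 : ((n + 1 : ℕ) : ℝ) - ‖K‖ ≤ ‖((n + 1 : ℕ) : ℂ) - K‖ := by
      have := norm_sub_norm_le ((n + 1 : ℕ) : ℂ) K
      rwa [Complex.norm_natCast] at this
    have e4 : ‖(n : ℂ) - K‖ ≤ n + ‖K‖ := by
      have := norm_sub_le (n : ℂ) K
      rwa [Complex.norm_natCast] at this
    have e5 : ‖((n : ℂ) - K) • (D.pt * G n) - R.op (G (n + 1))‖ ≤
        (n + ‖K‖) * (‖D.pt‖ * ‖G n‖) + k * ‖G (n + 1)‖ := by
      refine (norm_sub_le _ _).trans (add_le_add ?_ (hk _))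
      rw [norm_smul]
      exact mul_le_mul e4 (norm_mul_le _ _) (norm_nonneg _) (by positivity)
    have e6 := mul_le_mul_of_nonneg_right e3 (norm_nonneg (G (n + 1)))
    push_cast at e6 e2
    have hX : 0 < (n : ℝ) + 1 - ‖K‖ - k := by
      have := norm_nonneg K
      linarith
    have e7 : ((n : ℝ) + 1 - ‖K‖ - k) * ‖G (n + 1)‖ ≤
        ((n : ℝ) + 1 - ‖K‖ - k) * (3 * ‖D.pt‖ * ‖G n‖) := by
      have h1 : (n : ℝ) + ‖K‖ ≤ 3 * ((n : ℝ) + 1 - ‖K‖ - k) := by linarith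
      have h2 := mul_le_mul_of_nonneg_right h1 (by positivity : 0 ≤ ‖D.pt‖ * ‖G n‖)
      linarith
    have e8 := le_of_mul_le_mul_left e7 hX
    have := norm_nonneg (G n)
    linarith
  obtain ⟨A, hA⟩ := exists_geometric_bound (b := fun n => ‖G n‖) (fun n => norm_nonneg _)
    (by have := norm_nonneg D.pt; linarith) hbound
  exact ⟨A, _, by positivity, hA⟩

/-- A formal solution of the Okubo system at infinity gives a solution of the equation. -/
theorem exists_solution_infty (h : D.Regular) {K : ℂ} {G : ℕ → Fin 3 → ℂ}
    (h0 : R.op (G 0) = K • G 0)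
    (hrec : ∀ (n : ℕ) j, R.op (G (n + 1)) j - (K - (n + 1)) * G (n + 1) j =
      -(K - n) * (D.pt j * G n j)) :
    ∃ (g : ℂ → ℂ) (r : ℝ), AnalyticAt ℂ g 0 ∧ g 0 = ∑ j, G 0 j ∧ deriv g 0 = ∑ j, G 1 j ∧ 0 < r ∧
      ∀ (U : Set ℂ) (ℓ : ℂ → ℂ), IsOpen U → U ⊆ {z | r < ‖z‖} → IsLogBranch U 0 ℓ →
        D.IsSolutionOn U (fun z => Complex.exp (K * ℓ z) * g z⁻¹) := by
  obtain ⟨A, C, hC, hA⟩ := exists_bound_infty hrec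
  have hA' : ∀ j n, ‖G n j‖ ≤ A * C ^ n := fun j n => (norm_le_pi_norm _ j).trans (hA n)
  let H : Fin 3 → ℂ → ℂ := fun j x => ∑' n, G n j * x ^ n
  have hH : ∀ j, AnalyticAt ℂ (H j) 0 := fun j => analyticAt_powerSeries hC (hA' j)
  have h00 : (0 : ℂ) ∈ Metric.ball (0 : ℂ) (1 / (2 * C)) := Metric.mem_ball_self (by positivity)
  refine ⟨fun x => ∑ j, H j x, 2 * C + ‖D.pt‖ + ‖D.lam‖,
    Finset.analyticAt_fun_sum _ fun j _ => hH j, ?_, ?_, by positivity, ?_⟩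
  · exact Finset.sum_congr rfl fun j _ => powerSeries_zero fun n => G n j
  · rw [deriv_fun_sum fun j _ => (hH j).differentiableAt]
    refine Finset.sum_congr rfl fun j _ => ?_
    obtain ⟨d, hd1, hd2⟩ := (hasDerivAt_powerSeries hC (hA' j) h00).2
    rw [show deriv (H j) 0 = d from hd1.deriv]
    have := hasSum_single (f := fun n : ℕ => (n + 1) * G (n + 1) j * (0 : ℂ) ^ n) 0
      (fun n hn => by simp [hn])
    rw [hd2.unique this]
    simp
  · intro U ℓ hU hUr hℓ
    have hbig : ∀ z ∈ U, 2 * C < ‖z‖ ∧ ‖D.pt‖ < ‖z‖ ∧ ‖D.lam‖ < ‖z‖ := fun z hz => by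
      have h1 : 2 * C + ‖D.pt‖ + ‖D.lam‖ < ‖z‖ := hUr hz
      have h2 := norm_nonneg D.pt
      have h3 := norm_nonneg D.lam
      exact ⟨by linarith, by linarith, by linarith⟩
    have hp : ∀ z ∈ U, ∀ i, z ≠ D.pt i := fun z hz i e => by
      have := (norm_le_pi_norm D.pt i).trans_lt (hbig z hz).2.1
      rw [e] at this
      exact lt_irrefl _ this
    have hl : D.lam ∉ U := fun hz => lt_irrefl _ (hbig _ hz).2.2
    have key := isSolutionOn_sum (R := R) h hU hp hl
      (G := fun j z => Complex.exp (K * ℓ z) * H j z⁻¹) ?_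
    · simpa only [Finset.mul_sum] using key
    · intro z hz j
      have hz0 : z ≠ 0 := hℓ.ne hz
      have hx : z⁻¹ ∈ Metric.ball (0 : ℂ) (1 / (2 * C)) := by
        rw [mem_ball_zero_iff, norm_inv, one_div]
        exact inv_strictAnti₀ (by positivity) (hbig z hz).1
      have hsum : ∀ k, HasSum (fun n => G n k * z⁻¹ ^ n) (H k z⁻¹) :=
        fun k => (hasDerivAt_powerSeries hC (hA' k) hx).1
      obtain ⟨d, hd1, hd2⟩ := (hasDerivAt_powerSeries hC (hA' j) hx).2
      have hder := (hℓ.hasDerivAt_exp hU hz K).fun_mul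
        (HasDerivAt.comp (h₂ := H j) z hd1 (hasDerivAt_inv hz0))
      refine hder.congr_deriv ?_
      have hop := hasSum_op (R := R) hsum j
      have h1 : HasSum (fun n => n * G n j * z⁻¹ ^ n) (z⁻¹ * d) := by
        rw [← hasSum_nat_add_iff' 1]
        simp only [Finset.range_one, Finset.sum_singleton, Nat.cast_zero, zero_mul, sub_zero]
        refine (hd2.mul_left z⁻¹).congr_fun fun n => ?_
        push_cast
        ring
      have h2 : HasSum (fun n => (K - n) * G n j * z⁻¹ ^ n) (K * H j z⁻¹ - z⁻¹ * d) := by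
        refine (((hsum j).mul_left K).sub h1).congr_fun fun n => ?_
        ring
      have h3 : HasSum (fun n => ((K - n) * G n j - R.op (G n) j) * z⁻¹ ^ n)
          (K * H j z⁻¹ - z⁻¹ * d - R.op (fun k => H k z⁻¹) j) := by
        refine (h2.sub hop).congr_fun fun n => ?_
        ring
      -- The same series with its index shifted by one: the constant term vanishes by the
      -- eigenvector equation and the others are given by the recursion.
      have h4 : HasSum (fun n => ((K - n) * G n j - R.op (G n) j) * z⁻¹ ^ n)
          (D.pt j * z⁻¹ * (K * H j z⁻¹ - z⁻¹ * d)) := by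
        rw [← hasSum_nat_add_iff' 1]
        have e0 : (K - (0 : ℕ)) * G 0 j - R.op (G 0) j = 0 := by
          rw [h0]; simp
        simp only [Finset.range_one, Finset.sum_singleton, e0, zero_mul, sub_zero]
        refine (h2.mul_left (D.pt j * z⁻¹)).congr_fun fun n => ?_
        have := hrec n j
        push_cast
        rw [pow_succ]
        linear_combination (-(z⁻¹ ^ n * z⁻¹)) * this
      have h5 := h3.unique h4
      have hop2 : R.op (fun k => Complex.exp (K * ℓ z) * H k z⁻¹) j =
          Complex.exp (K * ℓ z) * R.op (fun k => H k z⁻¹) j := by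
        have : (fun k => Complex.exp (K * ℓ z) * H k z⁻¹) =
          Complex.exp (K * ℓ z) • fun k => H k z⁻¹ := rfl
        rw [this, map_smul]
        rfl
      have hzj := sub_ne_zero.2 (hp z hz j)
      rw [hop2]
      have h6 : R.op (fun k => H k z⁻¹) j =
        (1 - D.pt j * z⁻¹) * (K * H j z⁻¹ - z⁻¹ * d) := by linear_combination -h5
      rw [h6, Function.comp_apply]
      field_simp
      ring

/-- Continuation of a formal solution at infinity beyond the last resonance. -/
theorem exists_extension {K : ℂ} {G : ℕ → Fin 3 → ℂ} {J : ℕ}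
    (hrec : ∀ n : ℕ, n < J → ∀ j, R.op (G (n + 1)) j - (K - (n + 1)) * G (n + 1) j =
      -(K - n) * (D.pt j * G n j))
    (hinj : ∀ n : ℕ, J ≤ n → ∀ v, R.op v = (K - (n + 1)) • v → v = 0) :
    ∃ G' : ℕ → Fin 3 → ℂ, (∀ n ≤ J, G' n = G n) ∧
      ∀ (n : ℕ) j, R.op (G' (n + 1)) j - (K - (n + 1)) * G' (n + 1) j =
        -(K - n) * (D.pt j * G' n j) := by
  have hstep : ∀ (n : ℕ) (y : Fin 3 → ℂ), ∃ g : Fin 3 → ℂ, J ≤ n → ∀ j,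
      R.op g j - (K - (n + 1)) * g j = y j := by
    intro n y
    by_cases hn : J ≤ n
    · have hi : Function.Injective 
          (R.op - (K - (n + 1)) • (LinearMap.id : (Fin 3 → ℂ) →ₗ[ℂ] (Fin 3 → ℂ))) := by
        rw [← LinearMap.ker_eq_bot, LinearMap.ker_eq_bot']
        intro v hv
        refine hinj n hn v ?_
        simpa [sub_eq_zero] using hv
      obtain ⟨g, hg⟩ := LinearMap.injective_iff_surjective.1 hi y
      refine ⟨g, fun _ j => ?_⟩
      simpa using congrFun hg j
    · exact ⟨0, fun h => absurd h hn⟩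
  choose step hstep using hstep
  let G' : ℕ → Fin 3 → ℂ := fun n => Nat.rec (G 0) (fun n g =>
    if n + 1 ≤ J then G (n + 1) else step n fun j => -(K - n) * (D.pt j * g j)) n
  have hs : ∀ n, G' (n + 1) = if n + 1 ≤ J then G (n + 1) else
    step n fun j => -(K - n) * (D.pt j * G' n j) := fun n => rfl
  have hle : ∀ n ≤ J, G' n = G n := by
    intro n hn
    rcases n with _ | n
    · rfl
    · rw [hs, if_pos hn]
  refine ⟨G', hle, fun n j => ?_⟩
  by_cases hn : n < J
  · rw [hle _ hn, hle n hn.le]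
    exact hrec n hn j
  · rw [hs, if_neg (by omega), hstep n _ (by omega)]

/-- The exponent at infinity of the solution of the equation given by a formal solution of the Okubo
system. -/
theorem hasFrobeniusSolutionInfty (h : D.Regular) {K : ℂ} (hK : K ≠ 0) {G : ℕ → Fin 3 → ℂ}
    (hG : G 0 ≠ 0) (h0 : R.op (G 0) = K • G 0)
    (hrec : ∀ (n : ℕ) j, R.op (G (n + 1)) j - (K - (n + 1)) * G (n + 1) j =
      -(K - n) * (D.pt j * G n j)) :
    (∑ j, G 0 j ≠ 0 ∧ K = -D.kappa1 ∧ D.HasFrobeniusSolutionInfty (-K)) ∨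
      (∑ j, G 0 j = 0 ∧ K = -D.kappa2 ∧ D.HasFrobeniusSolutionInfty (1 - K)) := by
  obtain ⟨g, r, hg, hg0, hg1, hr, hsol⟩ := exists_solution_infty h h0 hrec
  rcases eigen_cases h h0 hG hK with ⟨h1, h2⟩ | ⟨h1, h2, s, hs, hGs⟩
  · refine Or.inl ⟨h1, h2, g, r, hg, by rwa [hg0], hr, ?_⟩
    simpa using hsol
  -- Here `g(0) = 0`, so one factor `1/z` moves into the power and raises the exponent by one.
  · refine Or.inr ⟨h1, h2, dslope g 0, r, ?_, ?_, hr, ?_⟩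
    · obtain ⟨p, hp⟩ := hg
      exact ⟨_, hp.has_fpower_series_dslope_fslope⟩
    · rw [dslope_same, hg1]
      intro h3
      -- The components of the first recursion step are summed. As `G 0 = s ρ` and `∑ p_j ρ_j = 1`,
      -- vanishing of `∑ G 1` would force `K s = 0`.
      have h4 := Finset.sum_congr (rfl : (Finset.univ : Finset (Fin 3)) = _)
        fun j _ => hrec 0 j
      rw [Finset.sum_sub_distrib, sum_op h, ← Finset.mul_sum, ← Finset.mul_sum, h3, hGs] at h4
      simp only [Pi.smul_apply, smul_eq_mul, mul_left_comm _ s, ← Finset.mul_sum,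
        h.sum_pt_rho] at h4
      simp [hK, hs] at h4
    · intro U ℓ hU hUr hℓ
      have := hsol U ℓ hU hUr hℓ
      have e : ∀ z ∈ U, Complex.exp (K * ℓ z) * g z⁻¹ =
          Complex.exp (-(1 - K) * ℓ z) * dslope g 0 z⁻¹ := by
        intro z hz
        have hz0 : z ≠ 0 := hℓ.ne hz
        have h3 := sub_smul_dslope g 0 z⁻¹
        rw [hg0, h1, sub_zero, sub_zero, smul_eq_mul] at h3
        have h4 := hℓ.2 z hz
        rw [sub_zero] at h4
        rw [← h3, show -(1 - K) * ℓ z = K * ℓ z - ℓ z by ring, Complex.exp_sub, h4]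
        field_simp
      exact this.congr hU fun z hz => (e z hz).symm

end Realization

end LinP6

end

/-! ### Finite formal solutions and solutions of polynomial type. -/

noncomputable section

/-- The polynomial with coefficients `b` in powers of `X - a`. -/
def shiftedPolynomial (a : ℂ) (n : ℕ) (b : ℕ → ℂ) : Polynomial ℂ :=
  (∑ k ∈ Finset.range (n + 1), Polynomial.monomial k (b k)).comp
    (Polynomial.X - Polynomial.C a)

theorem eval_shiftedPolynomial (a : ℂ) (n : ℕ) (b : ℕ → ℂ) (z : ℂ) :
    (shiftedPolynomial a n b).eval z = ∑ k ∈ Finset.range (n + 1), b k * (z - a) ^ k := by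
  simp [shiftedPolynomial, Polynomial.eval_finsetSum]

theorem coeff_sum_monomial {n : ℕ} {b : ℕ → ℂ} {k : ℕ} (hk : k ≤ n) :
    (∑ k ∈ Finset.range (n + 1), Polynomial.monomial k (b k)).coeff k = b k := by
  rw [Polynomial.finsetSum_coeff]
  simp only [Polynomial.coeff_monomial]
  rw [Finset.sum_ite_eq' (Finset.range (n + 1)) k b, if_pos (Finset.mem_range.2 (by omega))]

theorem natDegree_shiftedPolynomial {a : ℂ} {n : ℕ} {b : ℕ → ℂ} {d : ℕ} (hd : d ≤ n)
    (h : b d ≠ 0) (h0 : ∀ k, d < k → k ≤ n → b k = 0) :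
    shiftedPolynomial a n b ≠ 0 ∧ (shiftedPolynomial a n b).natDegree = d := by
  have hdeg : (∑ k ∈ Finset.range (n + 1), Polynomial.monomial k (b k)).natDegree = d := by
    refine le_antisymm ?_ (Polynomial.le_natDegree_of_ne_zero (by rwa [coeff_sum_monomial hd]))
    refine Polynomial.natDegree_sum_le_of_forall_le _ _ fun k hk => ?_
    by_cases hkd : k ≤ d
    · exact (Polynomial.natDegree_monomial_le _).trans hkd
    · rw [h0 k (by omega) (by have := Finset.mem_range.1 hk; omega)]
      simp
  have hne : ∑ k ∈ Finset.range (n + 1), Polynomial.monomial k (b k) ≠ 0 := by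
    intro h1
    have := coeff_sum_monomial (b := b) hd
    rw [h1, Polynomial.coeff_zero] at this
    exact h this.symm
  refine ⟨fun h1 => ?_, by rw [shiftedPolynomial, Polynomial.natDegree_comp, hdeg,
    Polynomial.natDegree_X_sub_C, mul_one]⟩
  rw [shiftedPolynomial, Polynomial.comp_eq_zero_iff] at h1
  rcases h1 with h1 | ⟨-, h1⟩
  · exact hne h1
  · have := congrArg Polynomial.natDegree h1
    rw [Polynomial.natDegree_X_sub_C, Polynomial.natDegree_C] at this
    omega

/-- The recursion in generating-function form. `W` is the defect of the truncated sum: zero for a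
finite solution, and the source of the logarithm at a resonance. -/
theorem sum_mul_pow_eq {o g : ℕ → ℂ} {K d x W : ℂ} {n : ℕ} (h0 : K * (d * g 0) = 0)
    (hrec : ∀ k < n, o k - (K + k) * g k = (K + k + 1) * (d * g (k + 1)))
    (hn : o n - (K + n) * g n = W) :
    x * ∑ k ∈ Finset.range (n + 1), o k * x ^ k =
      (x + d) * (∑ k ∈ Finset.range (n + 1), (K + k) * g k * x ^ k) + W * x ^ (n + 1) := by
  have e : ∑ k ∈ Finset.range (n + 1), d * ((K + k) * g k * x ^ k) + W * x ^ (n + 1) =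
      ∑ k ∈ Finset.range (n + 1), (o k - (K + k) * g k) * x ^ (k + 1) := by
    rw [Finset.sum_range_succ', Finset.sum_range_succ _ n, hn]
    congr 1
    have : ∑ k ∈ Finset.range n, d * ((K + ↑(k + 1)) * g (k + 1) * x ^ (k + 1)) =
        ∑ k ∈ Finset.range n, (o k - (K + k) * g k) * x ^ (k + 1) := by
      refine Finset.sum_congr rfl fun k hk => ?_
      rw [hrec k (Finset.mem_range.1 hk)]
      push_cast
      ring
    rw [this]
    simp only [Nat.cast_zero, add_zero, pow_zero, mul_one]
    linear_combination h0
  rw [add_mul, Finset.mul_sum _ _ d, add_assoc, e, Finset.mul_sum, Finset.mul_sum,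
    ← Finset.sum_add_distrib]
  exact Finset.sum_congr rfl fun k _ => by ring

theorem exists_hasDerivAt_sum_pow (g : ℕ → ℂ) (n : ℕ) (a z K : ℂ) :
    ∃ X, HasDerivAt (fun z => ∑ k ∈ Finset.range n, g k * (z - a) ^ k) X z ∧
      ∑ k ∈ Finset.range n, (K + k) * g k * (z - a) ^ k =
        K * (∑ k ∈ Finset.range n, g k * (z - a) ^ k) + (z - a) * X := by
  refine ⟨∑ k ∈ Finset.range n, g k * (k * (z - a) ^ (k - 1)),
    HasDerivAt.fun_sum fun k _ => ?_, ?_⟩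
  · simpa using (((hasDerivAt_id' z).sub_const a).fun_pow k).const_mul (g k)
  · rw [Finset.mul_sum, Finset.mul_sum, ← Finset.sum_add_distrib]
    refine Finset.sum_congr rfl fun k _ => ?_
    rcases k with _ | k
    · simp
    · simp only [Nat.add_sub_cancel, pow_succ]
      ring

namespace LinP6

namespace Realization

variable {D : LinP6} {R : D.Realization}

/-- A finite formal solution of the Okubo system gives a solution of polynomial type. -/
theorem isPolyTypeSolution (h : D.Regular) {i : Fin 3} {K : ℂ} {G : ℕ → Fin 3 → ℂ} {n : ℕ}
    (h0 : ∀ j, K * ((D.pt i - D.pt j) * G 0 j) = 0)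
    (hrec : ∀ (k : ℕ) j, R.op (G k) j - (K + k) * G k j =
      (K + k + 1) * ((D.pt i - D.pt j) * G (k + 1) j)) (hn : G (n + 1) = 0) :
    D.IsPolyTypeSolution (Pi.single i K) (shiftedPolynomial (D.pt i) n fun k => ∑ j, G k j) := by
  intro U ℓ hU hl hℓ
  have hp : ∀ z ∈ U, ∀ j, z ≠ D.pt j := fun z hz j => (hℓ j).ne hz
  set a := D.pt i with ha
  have key := isSolutionOn_sum (R := R) h hU hp hl (G := fun j z => Complex.exp (K * ℓ i z) *
    ∑ k ∈ Finset.range (n + 1), G k j * (z - a) ^ k) ?_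
  · refine key.congr hU fun z hz => ?_
    rw [eval_shiftedPolynomial, ← Finset.mul_sum, Finset.sum_comm]
    simp [Pi.single_apply, Finset.sum_mul]
  · intro z hz j
    have hza : z - a ≠ 0 := sub_ne_zero.2 (hp z hz i)
    have hzj : z - D.pt j ≠ 0 := sub_ne_zero.2 (hp z hz j)
    obtain ⟨X, hX, e4⟩ := exists_hasDerivAt_sum_pow (fun k => G k j) (n + 1) a z K
    refine (((hℓ i).hasDerivAt_exp hU hz K).fun_mul hX).congr_deriv ?_
    have hop : R.op (fun k => Complex.exp (K * ℓ i z) *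
        ∑ m ∈ Finset.range (n + 1), G m k * (z - a) ^ m) j =
        Complex.exp (K * ℓ i z) * ∑ m ∈ Finset.range (n + 1), R.op (G m) j * (z - a) ^ m := by
      have : (fun k => Complex.exp (K * ℓ i z) * ∑ m ∈ Finset.range (n + 1), G m k * (z - a) ^ m) =
          Complex.exp (K * ℓ i z) • ∑ m ∈ Finset.range (n + 1), (z - a) ^ m • G m := by
        ext k
        simp [Finset.sum_apply, mul_comm]
      rw [this, map_smul, map_sum]
      simp [Finset.sum_apply, mul_comm]
    have e2 : (z - a) * ∑ k ∈ Finset.range (n + 1), R.op (G k) j * (z - a) ^ k =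
        (z - D.pt j) * ∑ k ∈ Finset.range (n + 1), (K + k) * G k j * (z - a) ^ k := by
      have e := sum_mul_pow_eq (o := fun k => R.op (G k) j) (g := fun k => G k j) (x := z - a)
        (W := 0) (n := n) (h0 j) (fun k _ => hrec k j) (by simpa [hn] using hrec n j)
      simpa using e
    rw [e4] at e2
    rw [hop, eq_div_iff hzj, ← ha]
    clear e4 hX hop
    generalize ∑ k ∈ Finset.range (n + 1), G k j * (z - a) ^ k = Y at e2 ⊢
    generalize ∑ k ∈ Finset.range (n + 1), R.op (G k) j * (z - a) ^ k = Z at e2 ⊢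
    field_simp
    linear_combination -e2

/-- The leading coefficient of a finite formal solution. -/
theorem sum_top (h : D.Regular) {i : Fin 3} {K : ℂ} {G : ℕ → Fin 3 → ℂ} {n : ℕ}
    (hrec : ∀ (k : ℕ) j, R.op (G k) j - (K + k) * G k j =
      (K + k + 1) * ((D.pt i - D.pt j) * G (k + 1) j)) (hn : G (n + 1) = 0) (hG : G n ≠ 0)
    (hK : K + n ≠ 0) :
    (∑ j, G n j ≠ 0 ∧ K + n = -D.kappa1) ∨
      (∑ j, G n j = 0 ∧ K + n = -D.kappa2 ∧ ∀ m, n = m + 1 → ∑ j, G m j ≠ 0) := by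
  have he : R.op (G n) = (K + n) • G n := by
    ext j
    have := hrec n j
    rw [hn] at this
    simp only [Pi.zero_apply, mul_zero] at this
    simpa using sub_eq_zero.1 this
  rcases eigen_cases h he hG hK with h1 | ⟨h1, h2, s, hs, h3⟩
  · exact Or.inl h1
  · refine Or.inr ⟨h1, h2, ?_⟩
    rintro m rfl h4
    -- Summing the components of the step before the top gives `0` on the left if `∑ G m = 0`, but
    -- `-(K + m + 1) s` on the right.
    have h5 : ∑ j, (R.op (G m) j - (K + m) * G m j) =
        ∑ j, (K + m + 1) * ((D.pt i - D.pt j) * G (m + 1) j) :=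
      Finset.sum_congr rfl fun j _ => hrec m j
    rw [Finset.sum_sub_distrib, ← Finset.mul_sum, sum_op h, h4, ← Finset.mul_sum] at h5
    have h6 : ∑ j, (D.pt i - D.pt j) * G (m + 1) j = -s := by
      have e1 : ∑ j, (D.pt i - D.pt j) * G (m + 1) j =
          s * (D.pt i * ∑ j, D.rho j - ∑ j, D.pt j * D.rho j) := by
        rw [h3, Finset.mul_sum, ← Finset.sum_sub_distrib, Finset.mul_sum]
        exact Finset.sum_congr rfl fun j _ => by simp; ring
      rw [e1, h.sum_rho, h.sum_pt_rho]
      ring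
    rw [h6] at h5
    push_cast at hK
    refine hs ((mul_eq_zero.1 (?_ : (K + m + 1) * s = 0)).resolve_left ?_)
    · linear_combination h5
    · rwa [add_assoc]

end Realization

end LinP6

end

/-! ### Convolution on series at a finite point, and truncation at a negative integer exponent. -/

noncomputable section

theorem exists_last_ne_zero {α : Type*} [Zero α] {n : ℕ} {b : ℕ → α} {k : ℕ} (hk : k ≤ n)
    (h : b k ≠ 0) : ∃ d ≤ n, b d ≠ 0 ∧ ∀ m, d < m → m ≤ n → b m = 0 := by
  classical
  refine ⟨Nat.findGreatest (fun m => b m ≠ 0) n, Nat.findGreatest_le n,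
    Nat.findGreatest_spec (P := fun m => b m ≠ 0) hk h, fun m hm hn => ?_⟩
  by_contra hb
  exact Nat.findGreatest_is_greatest hm hn hb

namespace LinP6

variable {D E : LinP6} {κ : ℂ}

/-- The factors that turn a formal solution into one for the exponent shifted by `κ + 1`. -/
def shiftFactor (κ ρ : ℂ) (k : ℕ) : ℂ := ∏ j ∈ Finset.range k, ((j + ρ) / (κ + ρ + j + 1))

theorem shiftFactor_zero (κ ρ : ℂ) : shiftFactor κ ρ 0 = 1 := by simp [shiftFactor]

theorem shiftFactor_succ {κ ρ : ℂ} {k : ℕ} (h : κ + ρ + k + 1 ≠ 0) :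
    (κ + ρ + k + 1) * shiftFactor κ ρ (k + 1) = (k + ρ) * shiftFactor κ ρ k := by
  rw [shiftFactor, Finset.prod_range_succ, ← shiftFactor]
  field_simp

namespace ConvPair

variable (C : ConvPair D E κ)

theorem op_mul (v : Fin 3 → ℂ) (i : Fin 3) :
    C.R'.op (fun j => C.S j * v j) i = C.S i * (C.R.op v i + κ * v i) := by
  have e1 : C.R'.op (fun j => C.S j * v j) i =
      ∑ j, (C.R'.l i + E.rho i * C.R'.c j) * C.S j * v j := by
    rw [Realization.op_apply, Finset.mul_sum, Finset.mul_sum, ← Finset.sum_add_distrib]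
    exact Finset.sum_congr rfl fun j _ => by ring
  have e2 : C.R.op v i = ∑ j, (C.R.l i + D.rho i * C.R.c j) * v j := by
    rw [Realization.op_apply, Finset.mul_sum, Finset.mul_sum, ← Finset.sum_add_distrib]
    exact Finset.sum_congr rfl fun j _ => by ring
  have e3 : κ * v i = ∑ j, (if i = j then κ else 0) * v j := by simp
  rw [e1, e2, e3, ← Finset.sum_add_distrib, Finset.mul_sum]
  exact Finset.sum_congr rfl fun j _ => by rw [C.intertwine]; ring

theorem theta_eq (C : ConvPair D E κ) (i : Fin 3) : E.θ i = D.θ i + κ := by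
  have h := C.intertwine i i
  rw [C.R.diag, C.R'.diag, if_pos rfl, mul_comm] at h
  exact mul_left_cancel₀ (C.S_ne_zero i) h

/-- The image of a formal solution. -/
def image (ρ : ℂ) (F : ℕ → Fin 3 → ℂ) (k : ℕ) : Fin 3 → ℂ :=
  shiftFactor κ ρ k • fun j => C.S j * F k j

theorem image_apply (ρ : ℂ) (F : ℕ → Fin 3 → ℂ) (k : ℕ) (j : Fin 3) :
    C.image ρ F k j = shiftFactor κ ρ k * (C.S j * F k j) := rfl

/-- The input belongs to `M - 1` and exponent `ρ - 1`, the output to `M + κ` and exponent `κ + ρ`.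
The left-hand coefficients agree, and the ratio of the right-hand ones is absorbed by `shiftFactor`.
-/
theorem image_rec {ρ : ℂ} {F : ℕ → Fin 3 → ℂ} {i : Fin 3} {k : ℕ}
    (hF : ∀ j, C.R.op (F k) j - (k + ρ) * F k j = (k + ρ) * ((D.pt i - D.pt j) * F (k + 1) j))
    (hk : κ + ρ + k + 1 ≠ 0) (j : Fin 3) :
    C.R'.op (C.image ρ F k) j - (κ + ρ + k) * C.image ρ F k j =
      (κ + ρ + k + 1) * ((E.pt i - E.pt j) * C.image ρ F (k + 1) j) := by
  have e := shiftFactor_succ hk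
  rw [image, map_smul, image_apply, Pi.smul_apply, op_mul, C.pt_eq, Pi.smul_apply, smul_eq_mul,
    smul_eq_mul]
  linear_combination shiftFactor κ ρ k * C.S j * hF j -
    (D.pt i - D.pt j) * C.S j * F (k + 1) j * e

end ConvPair

/-- The leading coefficient is concentrated in component `i`, where the recursion gives `(θ_i - ρ) F
0 i = 0`. If `F 0 i = 0`, the sum formula gives `ρ g(p_i) = 0`. -/
theorem HasFrobeniusSolution.exponent (h : D.Regular) {i : Fin 3} {ρ : ℂ}
    (hf : D.HasFrobeniusSolution i ρ) : ρ = 0 ∨ ρ = D.θ i := by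
  obtain ⟨g, r, hg, hg0, hr, hsol⟩ := hf
  obtain ⟨F, h1, h2, h3, -⟩ := (Realization.canonical D h).exists_coeffs h i ρ hg hr
    fun U ℓ hU _ hp hb hℓ => hsol U ℓ hU (fun z hz => ⟨hb hz, hp z hz i⟩) hℓ
  have e : F 0 = Pi.single i (F 0 i) := by
    ext j
    rcases eq_or_ne j i with rfl | hj
    · simp
    · simp [hj, h1 j hj]
  have h4 := h3 0 i
  have h5 := h2 0
  rw [e, Realization.op_single] at h4
  rw [e, Finset.sum_pi_single', if_pos (Finset.mem_univ _), taylorCoeff_zero] at h5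
  simp only [Nat.cast_zero, zero_add, sub_self, zero_mul, mul_zero, Pi.single_eq_same] at h4 h5
  rcases mul_eq_zero.1 (show (D.θ i - ρ) * F 0 i = 0 by linear_combination h4) with h6 | h6
  · exact Or.inr (sub_eq_zero.1 h6).symm
  · rw [h6] at h5
    exact Or.inl ((mul_eq_zero.1 h5.symm).resolve_right hg0)

theorem NonLogarithmicAt.frobenius (h : D.Regular) {i : Fin 3} (hn : D.NonLogarithmicAt i) :
    D.θ i ≠ 0 ∧ D.HasFrobeniusSolution i 0 ∧ D.HasFrobeniusSolution i (D.θ i) := by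
  obtain ⟨ρ, σ, hne, h1, h2⟩ := hn
  rcases h1.exponent h with rfl | rfl <;> rcases h2.exponent h with rfl | rfl
  · exact absurd rfl hne
  · exact ⟨hne.symm, h1, h2⟩
  · exact ⟨hne, h2, h1⟩
  · exact absurd rfl hne

/-- A solution of the first equation with a negative integer exponent at a finite point gives a
finite formal solution of the Okubo system of the second one. -/
theorem ConvPair.exists_finite (C : ConvPair D E κ) {i : Fin 3} {n : ℕ} (hn : n ≠ 0)
    (hκ : NotInt κ) (hf : D.HasFrobeniusSolution i (-n)) :
    ∃ G : ℕ → Fin 3 → ℂ, (∀ j, (E.pt i - E.pt j) * G 0 j = 0) ∧ ∑ j, G 0 j ≠ 0 ∧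
      (∀ (k : ℕ) j, C.R'.op (G k) j - (κ - n + k) * G k j =
        (κ - n + k + 1) * ((E.pt i - E.pt j) * G (k + 1) j)) ∧
      (∀ k, n < k → G k = 0) ∧ ∑ j, G n j / C.S j = 0 := by
  obtain ⟨g, r, hg, hg0, hr, hsol⟩ := hf
  obtain ⟨F, h1, h2, h3, -⟩ := C.R.exists_coeffs C.regular i (-n) hg hr
    fun U ℓ hU _ hp hb hℓ => hsol U ℓ hU (fun z hz => ⟨hb hz, hp z hz i⟩) hℓ
  have hK : ∀ k : ℕ, κ + -n + (k : ℂ) + 1 ≠ 0 := fun k hk =>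
    hκ (n - k - 1) (by push_cast; linear_combination hk)
  refine ⟨C.image (-n) F, fun j => ?_, ?_, fun k j => ?_, fun k hk => ?_, ?_⟩
  · rw [C.image_apply, C.pt_eq]
    rcases eq_or_ne j i with rfl | hj
    · simp
    · simp [h1 j hj]
  · have e : ∑ j, C.image (-n) F 0 j = C.S i * F 0 i := by
      rw [Finset.sum_eq_single i]
      · rw [C.image_apply, shiftFactor_zero, one_mul]
      · intro j _ hj
        rw [C.image_apply, h1 j hj]
        simp
      · simp
    have e' : F 0 i = ∑ j, F 0 j := by
      rw [Finset.sum_eq_single i (fun j _ hj => h1 j hj) (by simp)]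
    rw [e, e', h2, taylorCoeff_zero]
    simp [C.S_ne_zero i, hn, hg0]
  · have := C.image_rec (fun j => h3 k j) (hK k) j
    simpa only [sub_eq_add_neg] using this
  -- The factor with index `n` of the product has numerator `n - n`.
  · have : shiftFactor κ (-n) k = 0 := by
      refine Finset.prod_eq_zero (Finset.mem_range.2 hk) ?_
      simp
    rw [ConvPair.image, this, zero_smul]
  · have e : ∀ j, C.image (-n) F n j / C.S j = shiftFactor κ (-n) n * F n j := fun j => by
      rw [C.image_apply]
      have := C.S_ne_zero j
      field_simp
    simp_rw [e]
    rw [← Finset.mul_sum, h2]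
    simp

end LinP6

end

/-! ### Absence of logarithms at a finite point. -/

noncomputable section

namespace LinP6

variable {D E : LinP6} {κ : ℂ}

theorem Regular.exists_ball (h : D.Regular) (i : Fin 3) :
    ∃ r > 0, ∀ z ∈ Metric.ball (D.pt i) r \ {D.pt i}, (∀ j, z ≠ D.pt j) ∧ z ≠ D.lam := by
  obtain ⟨r, hr, hb⟩ := Metric.mem_nhdsWithin_iff.1 (h.eventually_ne i)
  exact ⟨r, hr, fun z hz => hb hz⟩

namespace Realization

variable {R : D.Realization}

/-- An analytic solution of the Okubo system may start from any vector on which row `i` vanishes.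
Since `κ₂ ≠ 0`, such a vector can be chosen with sum `1`. -/
theorem hasFrobeniusSolution_zero (h : D.Regular) {i : Fin 3} (hk : D.kappa2 ≠ 0)
    (hθ : ∀ n : ℕ, D.θ i ≠ n + 1) (R : D.Realization) : D.HasFrobeniusSolution i 0 := by
  obtain ⟨G₀, h1, h2⟩ := R.exists_sum_eq h hk 1 (-(R.l i / D.rho i))
  have h3 : R.op G₀ i = (0 : Fin 3 → ℂ) i := by
    have := h.rho_ne_zero i
    rw [op_apply, h1, h2, Pi.zero_apply]
    field_simp
    ring
  obtain ⟨H, r, hr, hH, hH0, hd⟩ := R.exists_analytic h i h3 hθ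
  obtain ⟨r', hr', hb⟩ := h.exists_ball i
  refine ⟨fun z => ∑ j, H j z, min r r', Finset.analyticAt_fun_sum _ fun j _ => hH j, ?_,
    lt_min hr hr', fun U ℓ hU hUb hℓ => ?_⟩
  · simp [hH0, h1]
  · have hreg : ∀ z ∈ U, (∀ j, z ≠ D.pt j) ∧ z ≠ D.lam := fun z hz =>
      hb z ⟨Metric.ball_subset_ball (min_le_right _ _) (hUb hz).1, (hUb hz).2⟩
    have := isSolutionOn_sum (R := R) h hU (fun z hz => (hreg z hz).1)
      (fun hl => (hreg _ hl).2 rfl) (G := H) fun z hz j => by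
        obtain ⟨d, hd1, hd2⟩ :=
          hd z (Metric.ball_subset_ball (min_le_left _ _) (hUb hz).1) j
        refine hd1.congr_deriv ?_
        rw [eq_div_iff (sub_ne_zero.2 ((hreg z hz).1 j)), ← hd2]
        simp [mul_comm]
    simpa using this

/-- The Okubo system has the solution "principal part `+ V log (z - a) + H`", with `H` analytic and
the defect of the recursion feeding the logarithm. Since `∑ V j = 0`, no logarithm remains in the
component sum. -/
theorem hasFrobeniusSolution_neg (h : D.Regular) {i : Fin 3} {n : ℕ} {G : ℕ → Fin 3 → ℂ}
    {V : Fin 3 → ℂ} (hθ : D.θ i = -(n + 1)) (h0 : ∀ j, (D.pt i - D.pt j) * G 0 j = 0)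
    (hG : ∑ j, G 0 j ≠ 0)
    (hrec : ∀ k < n, ∀ j, R.op (G k) j - (-(n + 1) + k) * G k j =
      (-(n + 1) + k + 1) * ((D.pt i - D.pt j) * G (k + 1) j))
    (hn : ∀ j, R.op (G n) j + G n j = (D.pt i - D.pt j) * V j) (hV : R.op V = 0)
    (hV' : ∑ j, V j = 0) : D.HasFrobeniusSolution i (-(n + 1)) := by
  have hn1 : (-(n + 1) : ℂ) ≠ 0 := neg_ne_zero.2 (by exact_mod_cast n.succ_ne_zero)
  have h3 : R.op (Pi.single i (V i / -(n + 1))) i = V i := by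
    rw [op_single, hθ]
    field_simp
  obtain ⟨H, r, hr, hH, hH0, hd⟩ := R.exists_analytic h i h3 fun m hm => by
    rw [hθ] at hm
    have : ((n + 1 + (m + 1) : ℕ) : ℂ) = 0 := by push_cast; linear_combination -hm
    exact absurd this (Nat.cast_ne_zero.2 (by omega))
  obtain ⟨r', hr', hb⟩ := h.exists_ball i
  set a := D.pt i with ha
  set K : ℂ := -(n + 1) with hK
  refine ⟨fun z => ∑ j, (∑ k ∈ Finset.range (n + 1), G k j * (z - a) ^ k +
    (z - a) ^ (n + 1) * H j z), min r r', ?_, ?_, lt_min hr hr', fun U ℓ hU hUb hℓ => ?_⟩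
  · refine Finset.analyticAt_fun_sum _ fun j _ => ?_
    have := hH j
    fun_prop
  · simpa [Finset.sum_range_succ', ← ha] using hG
  · have hreg : ∀ z ∈ U, (∀ j, z ≠ D.pt j) ∧ z ≠ D.lam := fun z hz =>
      hb z ⟨Metric.ball_subset_ball (min_le_right _ _) (hUb hz).1, (hUb hz).2⟩
    have hx : ∀ z ∈ U, Complex.exp (K * ℓ z) * (z - a) ^ (n + 1) = 1 := fun z hz => by
      rw [← hℓ.2 z hz, ← Complex.exp_nat_mul, ← Complex.exp_add, hK]
      push_cast
      rw [show -((n : ℂ) + 1) * ℓ z + (n + 1) * ℓ z = 0 by ring, Complex.exp_zero]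
    have key := isSolutionOn_sum (R := R) h hU (fun z hz => (hreg z hz).1)
      (fun hl => (hreg _ hl).2 rfl) (G := fun j z => Complex.exp (K * ℓ z) *
        (∑ k ∈ Finset.range (n + 1), G k j * (z - a) ^ k) + (V j * ℓ z + H j z)) ?_
    · refine key.congr hU fun z hz => ?_
      simp only [Finset.sum_add_distrib, ← Finset.mul_sum, ← Finset.sum_mul, hV']
      linear_combination (∑ j, H j z) * hx z hz
    · intro z hz j
      have hza : z - a ≠ 0 := sub_ne_zero.2 ((hreg z hz).1 i)
      have hzj : z - D.pt j ≠ 0 := sub_ne_zero.2 ((hreg z hz).1 j)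
      obtain ⟨d, hd1, hd2⟩ := hd z (Metric.ball_subset_ball (min_le_left _ _) (hUb hz).1) j
      obtain ⟨X, hX, e4⟩ := exists_hasDerivAt_sum_pow (fun k => G k j) (n + 1) a z K
      refine (((hℓ.hasDerivAt_exp hU hz K).fun_mul hX).fun_add
        (((hℓ.hasDerivAt hU hz).const_mul (V j)).fun_add hd1)).congr_deriv ?_
      have hop : R.op (fun k => Complex.exp (K * ℓ z) *
          (∑ m ∈ Finset.range (n + 1), G m k * (z - a) ^ m) + (V k * ℓ z + H k z)) j =
          Complex.exp (K * ℓ z) * (∑ m ∈ Finset.range (n + 1), R.op (G m) j * (z - a) ^ m) +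
            R.op (fun k => H k z) j := by
        have : (fun k => Complex.exp (K * ℓ z) *
            (∑ m ∈ Finset.range (n + 1), G m k * (z - a) ^ m) + (V k * ℓ z + H k z)) =
            Complex.exp (K * ℓ z) • ∑ m ∈ Finset.range (n + 1), (z - a) ^ m • G m +
              (ℓ z • V + fun k => H k z) := by
          ext k
          simp [Finset.sum_apply, mul_comm]
        rw [this, map_add, map_add, map_smul, map_smul, hV, map_sum]
        simp [Finset.sum_apply, mul_comm]
      have e2 := sum_mul_pow_eq (o := fun k => R.op (G k) j) (g := fun k => G k j) (x := z - a)
        (K := K) (d := a - D.pt j) (W := (a - D.pt j) * V j) (n := n) (by rw [h0 j, mul_zero])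
        (fun k hk => hrec k hk j) (by rw [← hn j, hK]; ring)
      rw [e4] at e2
      rw [hop, eq_div_iff hzj, ← ha, ← hd2]
      have hx' := hx z hz
      clear e4 hX hop hd2
      generalize ∑ k ∈ Finset.range (n + 1), G k j * (z - a) ^ k = Y at e2 ⊢
      generalize ∑ k ∈ Finset.range (n + 1), R.op (G k) j * (z - a) ^ k = Z at e2 ⊢
      field_simp
      linear_combination -Complex.exp (K * ℓ z) * e2 - (a - D.pt j) * V j * hx'

end Realization


/-- The Okubo expansion of a nonzero solution `(z - pt i) ^ θ i * p z` has finitely many nonzero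
terms, and the initial one is nonzero. -/
theorem IsPolyTypeSolution.exists_coeffs (h : D.Regular) (R : D.Realization) {i : Fin 3}
    {p : Polynomial ℂ} (hp : p ≠ 0) (hsol : D.IsPolyTypeSolution (Pi.single i (D.θ i)) p)
    (hθ : NotInt (D.θ i)) :
    ∃ (F : ℕ → Fin 3 → ℂ) (J : ℕ), (∀ j, j ≠ i → F 0 j = 0) ∧ F 0 i ≠ 0 ∧
      (∀ (k : ℕ) j, R.op (F k) j - (k + D.θ i) * F k j =
        (k + D.θ i) * ((D.pt i - D.pt j) * F (k + 1) j)) ∧ F J ≠ 0 ∧ ∀ k, J < k → F k = 0 := by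
  have hv : AnalyticAt ℂ (fun z => p.eval z) (D.pt i) :=
    p.differentiable.analyticAt _
  obtain ⟨F, h1, h2, h3, -, h5⟩ := R.exists_coeffs h i (D.θ i) hv one_pos
    fun U ℓ hU hl hp' _ hℓ => hsol.isSolutionOn_single hU hl hp' hℓ
  obtain ⟨n₀, hn₀⟩ := h5 fun j => by
    obtain ⟨q, hq⟩ := R.exists_polynomial_okubo h hsol j
    exact ⟨q, (h.eventually_ne i).mono fun z hz => hq z hz.1 hz.2⟩
  have hkθ : ∀ k : ℕ, (k : ℂ) + D.θ i ≠ 0 := fun k hk =>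
    hθ (-k) (by push_cast; linear_combination hk)
  -- If the initial vector vanished, so would all coefficients: rows `j ≠ i` give the off
  -- components, and row `i` gives `(k + 1) F (k + 1) i = 0`. Then every Taylor coefficient of `p`
  -- would vanish.
  have hF0 : F 0 i ≠ 0 := by
    intro h0
    have hall : ∀ k, F k = 0 := by
      intro k
      induction k with
      | zero =>
        ext j
        rcases eq_or_ne j i with rfl | hj
        · exact h0
        · exact h1 j hj
      | succ k ih =>
        have hs : ∀ j, j ≠ i → F (k + 1) j = 0 := fun j hj => by
          have := h3 k j
          rw [ih] at this
          simp only [map_zero, Pi.zero_apply, mul_zero, sub_zero] at this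
          have hne : D.pt i - D.pt j ≠ 0 := sub_ne_zero.2 (h.pt_injective.ne hj.symm)
          simpa [hkθ k, hne] using this.symm
        have e : F (k + 1) = Pi.single i (F (k + 1) i) := by
          ext j
          rcases eq_or_ne j i with rfl | hj
          · simp
          · simp [hj, hs j hj]
        have h6 := h3 (k + 1) i
        rw [e, Realization.op_single] at h6
        simp only [Pi.single_eq_same, sub_self, zero_mul, mul_zero] at h6
        have h7 : ((k : ℂ) + 1) * F (k + 1) i = 0 := by push_cast at h6; linear_combination -h6
        have h8 : F (k + 1) i = 0 :=
          (mul_eq_zero.1 h7).resolve_left (by exact_mod_cast k.succ_ne_zero)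
        rw [e, h8, Pi.single_zero]
    have hT : ∀ n, taylorCoeff (fun z => p.eval z) (D.pt i) n = 0 := fun n => by
      have := h2 n
      rw [hall n] at this
      simpa [hkθ n] using this.symm
    refine absurd ?_ (not_exists.2 fun n => not_not.2 (hT n))
    refine exists_taylorCoeff_ne_zero hv fun hev => hp ?_
    refine Polynomial.eq_zero_of_infinite_isRoot p ?_
    exact infinite_of_mem_nhds (D.pt i) hev
  have hF0' : F 0 ≠ 0 := fun h0 => hF0 (congrFun h0 i)
  obtain ⟨J, -, hJ, hJ'⟩ := exists_last_ne_zero (n := n₀) (Nat.zero_le _) hF0'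
  refine ⟨F, J, h1, hF0, h3, hJ, fun k hk => ?_⟩
  rcases le_or_gt k n₀ with h6 | h6
  · exact hJ' k hk h6
  · exact hn₀ k h6

/-- The finite expansion stops at the index `n` where the convolved recursion is resonant. The
gauged top vector is annihilated by the new matrix, and `E.kappa1 ≠ 0` makes its sum vanish, which
is what `hasFrobeniusSolution_neg` requires. -/
theorem ConvPair.nonLogarithmicAt (C : ConvPair D E κ) {i : Fin 3} {n : ℕ} (hκ : NotInt κ)
    (hκD : κ = D.kappa1 ∨ κ = D.kappa2) (hinf : NotInt D.θinf) (h1 : E.kappa1 ≠ 0)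
    (h2 : E.kappa2 ≠ 0) (hθ : E.θ i = -n) {p : Polynomial ℂ} (hp : p ≠ 0)
    (hsol : D.IsPolyTypeSolution (Pi.single i (D.θ i)) p) : E.NonLogarithmicAt i := by
  have hθD : D.θ i = -n - κ := by rw [← hθ, C.theta_eq]; ring
  have hθn : NotInt (D.θ i) := fun m hm => hκ (-n - m) (by
    push_cast
    linear_combination -hm + hθD)
  obtain ⟨F, J, hF0, hFi, hrec, hJ, hJ'⟩ := hsol.exists_coeffs C.regular C.R hp hθn
  have hkθ : ∀ k : ℕ, (k : ℂ) + D.θ i ≠ 0 := fun k hk =>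
    hθn (-k) (by push_cast; linear_combination hk)
  have htop : C.R.op (F J) = (J + D.θ i) • F J := by
    ext j
    have := hrec J j
    rw [hJ' _ (Nat.lt_succ_self J)] at this
    simpa [sub_eq_zero] using this
  -- The top coefficient has eigenvalue `-κ₁` or `-κ₂`. One of these is `-κ` and gives `J = n`; the
  -- other would make `θ_∞` an integer.
  have hJn : J = n := by
    have hd := D.kappa1_sub_kappa2
    have hc : (J : ℂ) = n ∨ ∃ m : ℤ, D.θinf = m := by
      rcases Realization.eigen_cases C.regular htop hJ (hkθ J) with ⟨-, h3⟩ | ⟨-, h3, -⟩ <;>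
        rcases hκD with h4 | h4 <;> rw [hθD, h4] at h3
      · exact Or.inl (by linear_combination h3)
      · exact Or.inr ⟨n - J, by push_cast; linear_combination -hd + h3⟩
      · exact Or.inr ⟨J - n, by push_cast; linear_combination -hd - h3⟩
      · exact Or.inl (by linear_combination h3)
    rcases hc with hc | ⟨m, hm⟩
    · exact_mod_cast hc
    · exact absurd hm (hinf m)
  subst hJn
  have hsum0 : ∑ j, C.S j * F 0 j = C.S i * F 0 i := by
    rw [Finset.sum_eq_single i (fun j _ hj => by rw [hF0 j hj, mul_zero]) (by simp)]
  have hsum0' : ∑ j, C.S j * F 0 j ≠ 0 := by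
    rw [hsum0]
    exact mul_ne_zero (C.S_ne_zero i) hFi
  have hker : C.R'.op (fun j => C.S j * F J j) = 0 := by
    ext j
    rw [C.op_mul, htop, Pi.smul_apply, smul_eq_mul, hθD]
    simp only [Pi.zero_apply]
    ring
  have hkersum : ∑ j, C.S j * F J j = 0 := by
    have := Realization.sum_op (R := C.R') C.regular' (fun j => C.S j * F J j)
    rw [hker] at this
    simpa [h1] using this.symm
  -- For `J = 0` the top vector is also the initial one, whose sum is both zero and non-zero. This
  -- rules out equal exponents.
  rcases J with _ | N
  · exact absurd hkersum hsum0'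
  · have hn1 : (-((N : ℂ) + 1)) ≠ 0 := neg_ne_zero.2 (by exact_mod_cast N.succ_ne_zero)
    push_cast at hθ hθD
    refine ⟨-(N + 1), 0, hn1, ?_, ?_⟩
    · have hκθ : κ + D.θ i = -(N + 1) := by rw [hθD]; ring
      refine Realization.hasFrobeniusSolution_neg (R := C.R') C.regular' (n := N)
        (G := C.image (D.θ i) F)
        (V := (shiftFactor κ (D.θ i) N * (N + D.θ i)) • fun j => C.S j * F (N + 1) j)
        hθ (fun j => ?_) ?_ (fun k hk j => ?_) (fun j => ?_) ?_ ?_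
      · rw [C.image_apply]
        rcases eq_or_ne j i with rfl | hj
        · simp
        · simp [hF0 j hj]
      · simpa only [C.image_apply, shiftFactor_zero, one_mul] using hsum0'
      · have := C.image_rec (fun j => hrec k j) (by
          rw [hκθ]
          intro h3
          have : ((N : ℂ)) = k := by linear_combination -h3
          exact absurd (Nat.cast_injective this) (by omega)) j
        rwa [hκθ] at this
      · have := hrec N j
        rw [ConvPair.image, map_smul, Pi.smul_apply, Pi.smul_apply, Pi.smul_apply, C.op_mul,
          C.pt_eq, smul_eq_mul, smul_eq_mul, smul_eq_mul]
        linear_combination shiftFactor κ (D.θ i) N * C.S j * this +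
          shiftFactor κ (D.θ i) N * C.S j * F N j * hκθ
      · rw [map_smul, hker, smul_zero]
      · simp only [Pi.smul_apply, smul_eq_mul]
        rw [← Finset.mul_sum, hkersum, mul_zero]
    · refine Realization.hasFrobeniusSolution_zero C.regular' h2 (fun m hm => ?_) C.R'
      rw [hθ] at hm
      have : ((N + 1 + (m + 1) : ℕ) : ℂ) = 0 := by push_cast; linear_combination -hm
      exact absurd this (Nat.cast_ne_zero.2 (by omega))

end LinP6

end

/-! ### Exponents, convolution and truncation at infinity. -/

noncomputable section

namespace LinP6

variable {D E : LinP6} {κ : ℂ}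

/-- The leading vector `(κ₁ - ρ) g(0) • D.rho` must have eigenvalue `1 - ρ`, while `D.rho` has
eigenvalue `-κ₂`. -/
theorem HasFrobeniusSolutionInfty.exponent (h : D.Regular) {ρ : ℂ}
    (hf : D.HasFrobeniusSolutionInfty ρ) : ρ = D.kappa1 ∨ ρ = D.kappa2 + 1 := by
  obtain ⟨g, r, hg, hg0, hr, hsol⟩ := hf
  obtain ⟨F, h1, h2, -⟩ := (Realization.canonical D h).exists_coeffs_infty h ρ hg hsol
  rw [h1, map_smul, Realization.op_rho h] at h2
  have h3 := congrFun h2 0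
  simp only [Pi.smul_apply, smul_eq_mul] at h3
  have h4 : (D.kappa1 - ρ) * (g 0 * D.rho 0 * (D.kappa2 + 1 - ρ)) = 0 := by
    linear_combination -h3
  have := h.rho_ne_zero 0
  rcases mul_eq_zero.1 h4 with h5 | h5
  · exact Or.inl (sub_eq_zero.1 h5).symm
  · exact Or.inr (sub_eq_zero.1 ((mul_eq_zero.1 h5).resolve_left (mul_ne_zero hg0 this))).symm

theorem NonLogarithmicAtInfty.frobenius (h : D.Regular) (hn : D.NonLogarithmicAtInfty) :
    D.kappa1 ≠ D.kappa2 + 1 ∧ D.HasFrobeniusSolutionInfty D.kappa1 ∧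
      D.HasFrobeniusSolutionInfty (D.kappa2 + 1) := by
  obtain ⟨ρ, σ, hne, h1, h2⟩ := hn
  rcases h1.exponent h with rfl | rfl <;> rcases h2.exponent h with rfl | rfl
  · exact absurd rfl hne
  · exact ⟨hne, h1, h2⟩
  · exact ⟨hne.symm, h2, h1⟩
  · exact absurd rfl hne

/-- The factors that turn a formal solution at infinity into one for the shifted exponent. -/
def inftyFactor (K ρ : ℂ) (n : ℕ) : ℂ := ∏ j ∈ Finset.range n, (-(K - j) / (j + ρ))

theorem inftyFactor_zero (K ρ : ℂ) : inftyFactor K ρ 0 = 1 := by simp [inftyFactor]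

theorem inftyFactor_succ {K ρ : ℂ} {n : ℕ} (h : n + ρ ≠ 0) :
    (n + ρ) * inftyFactor K ρ (n + 1) = -(K - n) * inftyFactor K ρ n := by
  rw [inftyFactor, Finset.prod_range_succ, ← inftyFactor]
  field_simp

namespace ConvPair

variable (C : ConvPair D E κ)

/-- The image of a formal solution at infinity. -/
def imageInfty (ρ : ℂ) (F : ℕ → Fin 3 → ℂ) (n : ℕ) : Fin 3 → ℂ :=
  inftyFactor (κ + 1 - ρ) ρ n • fun j => C.S j * F n j

theorem imageInfty_apply (ρ : ℂ) (F : ℕ → Fin 3 → ℂ) (n : ℕ) (j : Fin 3) :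
    C.imageInfty ρ F n j = inftyFactor (κ + 1 - ρ) ρ n * (C.S j * F n j) := rfl

theorem imageInfty_zero {ρ : ℂ} {F : ℕ → Fin 3 → ℂ} (hF : C.R.op (F 0) = (1 - ρ) • F 0) :
    C.R'.op (C.imageInfty ρ F 0) = (κ + 1 - ρ) • C.imageInfty ρ F 0 := by
  ext j
  have := congrFun hF j
  rw [imageInfty, inftyFactor_zero, one_smul, op_mul, this]
  simp only [Pi.smul_apply, smul_eq_mul]
  ring

theorem imageInfty_rec {ρ : ℂ} {F : ℕ → Fin 3 → ℂ} {n : ℕ}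
    (hF : ∀ j, C.R.op (F (n + 1)) j + (n + ρ) * F (n + 1) j = (n + ρ) * (D.pt j * F n j))
    (hn : n + ρ ≠ 0) (j : Fin 3) :
    C.R'.op (C.imageInfty ρ F (n + 1)) j -
        (κ + 1 - ρ - (n + 1)) * C.imageInfty ρ F (n + 1) j =
      -(κ + 1 - ρ - n) * (E.pt j * C.imageInfty ρ F n j) := by
  have e := inftyFactor_succ (K := κ + 1 - ρ) hn
  rw [imageInfty, map_smul, imageInfty_apply, Pi.smul_apply, op_mul, C.pt_eq, Pi.smul_apply,
    smul_eq_mul, smul_eq_mul]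
  linear_combination inftyFactor (κ + 1 - ρ) ρ (n + 1) * C.S j * hF j +
    D.pt j * C.S j * F n j * e

/-- A solution of the first equation at infinity gives a polynomial formal solution of the Okubo
system of the second one. -/
theorem exists_finite_infty (C : ConvPair D E κ) {ρ : ℂ} {N : ℕ} (hρ : NotInt ρ)
    (hN : κ + 1 - ρ = N) (hf : D.HasFrobeniusSolutionInfty ρ) :
    ∃ (B : ℕ → Fin 3 → ℂ) (g : ℂ), g ≠ 0 ∧
      (∀ (k : ℕ) j, C.R'.op (B k) j - (0 + k) * B k j =
        (0 + k + 1) * ((E.pt 0 - E.pt j) * B (k + 1) j)) ∧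
      (∀ k, N < k → B k = 0) ∧ (∀ j, B N j = (D.kappa1 - ρ) * g * (C.S j * D.rho j)) ∧
      ∀ M, N = M + 1 → ∃ s ≠ 0, ∃ w : Fin 3 → ℂ, (∀ j, B M j = s * (C.S j * w j)) ∧
        ∑ j, w j = -ρ * g := by
  obtain ⟨g, r, hg, hg0, hr, hsol⟩ := hf
  obtain ⟨F, h1, h2, h3, h4⟩ := C.R.exists_coeffs_infty C.regular ρ hg hsol
  have hρn : ∀ n : ℕ, n + ρ ≠ 0 := fun n hn => hρ (-n) (by push_cast; linear_combination hn)
  have e0 := C.imageInfty_zero h2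
  have e1 := fun n => C.imageInfty_rec (fun j => h4 n j) (hρn n)
  -- The series at infinity is reversed: the coefficient of `z^(N - n)` becomes that of `z^k` at the
  -- base point `0`. The factor `-(K - N) = 0` is what ends the series.
  refine ⟨fun k => if k ≤ N then C.imageInfty ρ F (N - k) else 0, g 0, hg0, fun k j => ?_,
    fun k hk => if_neg (by omega), fun j => ?_, ?_⟩
  · rcases lt_trichotomy k N with hk | rfl | hk
    · obtain ⟨n, rfl⟩ := Nat.exists_eq_add_of_lt hk
      have := e1 n j
      simp only [if_pos hk.le, if_pos (Nat.succ_le_of_lt hk)]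
      rw [show k + n + 1 - k = n + 1 by omega, show k + n + 1 - (k + 1) = n by omega]
      rw [hN] at this
      push_cast at this
      have hp : E.pt 0 = 0 := rfl
      rw [hp]
      linear_combination this
    · have := congrFun e0 j
      rw [hN] at this
      simp [this]
    · simp [show ¬ k ≤ N by omega, show ¬ k + 1 ≤ N by omega]
  · simp only [le_refl, if_true, Nat.sub_self, imageInfty_apply, inftyFactor_zero, h1,
      Pi.smul_apply, smul_eq_mul]
    ring
  · rintro M rfl
    refine ⟨inftyFactor (κ + 1 - ρ) ρ 1, ?_, F 1, fun j => ?_, ?_⟩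
    · rw [hN]
      have h5 := hρn 0
      have h6 : ((M : ℂ) + 1) ≠ 0 := by exact_mod_cast M.succ_ne_zero
      simp only [Nat.cast_zero, zero_add] at h5
      simp only [inftyFactor, Finset.prod_range_one, Nat.cast_zero, zero_add]
      push_cast
      exact div_ne_zero (by rw [sub_zero]; exact neg_ne_zero.2 h6) h5
    · simp only [if_pos (Nat.le_succ M), show M + 1 - M = 1 by omega, imageInfty_apply]
    · have := h3 0
      rw [taylorCoeff_zero] at this
      simpa using this

end ConvPair

end LinP6

end

/-! ### Polynomial solutions and absence of logarithms at infinity. -/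

noncomputable section

theorem exists_taylorCoeff_polynomial_ne_zero {p : Polynomial ℂ} (a : ℂ) (hp : p.natDegree ≠ 0) :
    ∃ n : ℕ, taylorCoeff (fun z => p.eval z) a (n + 1) ≠ 0 := by
  set q := p + Polynomial.C (-p.eval a) with hq
  have han : ∀ r : Polynomial ℂ, AnalyticAt ℂ (fun z => r.eval z) a := fun r =>
    r.differentiable.analyticAt _
  have hq0 : q ≠ 0 := fun h => hp (by
    have : p = Polynomial.C (p.eval a) := by
      rw [hq, Polynomial.C_neg, ← sub_eq_add_neg] at h
      exact sub_eq_zero.1 h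
    rw [this, Polynomial.natDegree_C])
  obtain ⟨n, hn⟩ := exists_taylorCoeff_ne_zero (han q) fun hev => hq0
    (Polynomial.eq_zero_of_infinite_isRoot q (infinite_of_mem_nhds a hev))
  rcases n with _ | n
  · rw [taylorCoeff_zero] at hn
    simp [hq] at hn
  · refine ⟨n, fun h => hn ?_⟩
    have e : (fun z => q.eval z) = fun z => p.eval z + (Polynomial.C (-p.eval a)).eval z := by
      ext z
      rw [hq, Polynomial.eval_add]
    rw [e, taylorCoeff_add (han p) (han _), h, taylorCoeff_polynomial _ (by
      rw [Polynomial.natDegree_C]; omega), add_zero]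

namespace LinP6

variable {D E : LinP6} {κ : ℂ}

/-- A constant solution exists only in a degenerate case. -/
theorem IsPolyTypeSolution.mu_eq_zero (h : D.Regular) {p : Polynomial ℂ} (hp : p ≠ 0)
    (hdeg : p.natDegree = 0) (hsol : D.IsPolyTypeSolution 0 p) :
    D.mu = 0 ∧ D.kappa1 * (D.kappa2 + 1) = 0 := by
  obtain ⟨s, rfl⟩ := Polynomial.natDegree_eq_zero.1 hdeg
  have hs : s ≠ 0 := by simpa using hp
  rw [← Pi.single_zero (0 : Fin 3)] at hsol
  have hQ : ∀ z, (∀ j, z ≠ D.pt j) → z ≠ D.lam → D.coeffQ z = 0 := by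
    intro z hz hzl
    obtain ⟨ℓ, hℓ⟩ := exists_isLogBranch (hz 0)
    set U := {z | (∀ j, z ≠ D.pt j) ∧ z ≠ D.lam} ∩ Metric.ball z ‖z - D.pt 0‖
    have hU : IsOpen U := D.isOpen_regular.inter Metric.isOpen_ball
    have hzU : z ∈ U := ⟨⟨hz, hzl⟩, Metric.mem_ball_self (norm_pos_iff.2 (sub_ne_zero.2 (hz 0)))⟩
    have := (hsol.isSolutionOn_single hU (fun hl => hl.1.2 rfl) (fun w hw => hw.1.1)
      (hℓ.mono Set.inter_subset_right)).2 z hzU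
    simpa [hs] using this
  -- The numerator of `coeffQ` over the common denominator. It vanishes on a dense set; its values
  -- at `λ`, `t` and `λ + t` isolate `μ`, `H` and `κ₁ (κ₂ + 1)`.
  set f : ℂ → ℂ := fun z => D.kappa1 * (D.kappa2 + 1) * ((z - D.lam) * (z - D.t)) +
    D.lam * (D.lam - 1) * D.mu * (z - D.t) - D.t * (D.t - 1) * D.H * (z - D.lam) with hf
  have hfz : ∀ z, (∀ j, z ≠ D.pt j) → z ≠ D.lam → f z = 0 := by
    intro z hz hzl
    have e := hQ z hz hzl
    have z0 : z ≠ 0 := hz 0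
    have z1 : z - 1 ≠ 0 := sub_ne_zero.2 (hz 1)
    have z2 : z - D.t ≠ 0 := sub_ne_zero.2 (hz 2)
    have z3 : z - D.lam ≠ 0 := sub_ne_zero.2 hzl
    rw [coeffQ] at e
    field_simp at e
    linear_combination e
  have hfc : Continuous f := by fun_prop
  have hf0 : ∀ z, f z = 0 := by
    have hd : Dense {z | (∀ j, z ≠ D.pt j) ∧ z ≠ D.lam} := by
      have : {z | (∀ j, z ≠ D.pt j) ∧ z ≠ D.lam} = (insert D.lam (Set.range D.pt))ᶜ := by
        ext z
        simp only [Set.mem_ofPred_eq, Set.mem_compl_iff, Set.mem_insert_iff, Set.mem_range,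
          not_or, not_exists]
        exact ⟨fun hz => ⟨hz.2, fun j hj => hz.1 j hj.symm⟩,
          fun hz => ⟨fun j hj => hz.2 j hj.symm, hz.1⟩⟩
      rw [this]
      exact ((Set.finite_range D.pt).insert D.lam).countable.dense_compl ℂ
    have := hfc.ext_on hd continuous_const (g := fun _ => (0 : ℂ)) fun z hz => hfz z hz.1 hz.2
    exact fun z => congrFun this z
  have h1 := sub_ne_zero.2 h.lam_ne_one
  have h2 := sub_ne_zero.2 h.lam_ne_t
  have h0 := h.lam_ne_zero
  have hmu : D.mu = 0 := by
    have := hf0 D.lam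
    simp only [hf, sub_self, zero_mul, mul_zero, zero_add, sub_zero] at this
    simpa [h0, h1, h2] using this
  refine ⟨hmu, ?_⟩
  have e1 := hf0 D.t
  have e2 := hf0 (D.lam + D.t)
  simp only [hf, hmu] at e1 e2
  have h3 : D.t - D.lam ≠ 0 := sub_ne_zero.2 h.lam_ne_t.symm
  have h4 : D.t * (D.t - 1) * D.H = 0 := by
    simp only [sub_self, mul_zero, zero_add, zero_sub, neg_eq_zero] at e1
    exact (mul_eq_zero.1 e1).resolve_right h3
  have h5 : D.kappa1 * (D.kappa2 + 1) * (D.t * D.lam) = 0 := by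
    linear_combination e2 + D.t * h4
  exact (mul_eq_zero.1 h5).resolve_right (mul_ne_zero h.t_ne_zero h0)

/-- The Okubo expansion at the origin of a nonconstant polynomial solution. -/
theorem IsPolyTypeSolution.exists_coeffs_zero (h : D.Regular) (R : D.Realization)
    {p : Polynomial ℂ} (hp : p.natDegree ≠ 0) (hsol : D.IsPolyTypeSolution 0 p) :
    ∃ (g : ℕ → Fin 3 → ℂ) (J : ℕ), g J ≠ 0 ∧ R.op (g J) = ((J : ℂ) + 1) • g J ∧
      (∀ (k : ℕ) j, R.op (g k) j - (k + 1) * g k j = -((k + 1) * (D.pt j * g (k + 1) j))) ∧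
      (∃ α β, ∀ j, -(D.pt j * g 0 j) = R.l j * α + D.rho j * β) ∧
      (J = 0 → ∑ j, g 0 j ≠ 0) := by
  have hv : AnalyticAt ℂ (fun z => p.eval z) (D.pt 0) := p.differentiable.analyticAt _
  rw [← Pi.single_zero (0 : Fin 3)] at hsol
  obtain ⟨F, h1, h2, h3, ⟨β, h4⟩, h5⟩ := R.exists_coeffs h 0 0 hv one_pos
    fun U ℓ hU hl hp' _ hℓ => hsol.isSolutionOn_single hU hl hp' hℓ
  obtain ⟨n₀, hn₀⟩ := h5 fun j => by
    obtain ⟨q, hq⟩ := R.exists_polynomial_okubo h hsol j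
    exact ⟨q, (h.eventually_ne 0).mono fun z hz => hq z hz.1 hz.2⟩
  -- With exponent zero the Okubo vector has no pole at the origin, so the expansion really starts
  -- at index one; `g k = F (k + 1)` below.
  have hF0 : F 0 = 0 := by
    have e := h2 0
    rw [Finset.sum_eq_single 0 (fun j _ hj => h1 j hj) (by simp)] at e
    ext j
    rcases eq_or_ne j 0 with rfl | hj
    · simpa using e
    · exact h1 j hj
  obtain ⟨n, hn⟩ := exists_taylorCoeff_polynomial_ne_zero (D.pt 0) hp
  have hFn : ∑ j, F (n + 1) j ≠ 0 := by
    rw [h2]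
    refine mul_ne_zero ?_ hn
    rw [add_zero]
    exact_mod_cast n.succ_ne_zero
  have hFn' : F (n + 1) ≠ 0 := fun h0 => hFn (by simp [h0])
  have hnn : n + 1 ≤ n₀ := by
    by_contra hlt
    exact hFn' (hn₀ _ (by omega))
  obtain ⟨J, hJn, hJ, hJ'⟩ := exists_last_ne_zero (b := fun k => F (k + 1)) (n := n₀)
    (by omega : n ≤ n₀) hFn'
  have hJ2 : ∀ k, J < k → F (k + 1) = 0 := fun k hk => by
    rcases le_or_gt k n₀ with h6 | h6
    · exact hJ' k hk h6
    · exact hn₀ _ (by omega)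
  have hp0 : D.pt 0 = 0 := rfl
  have hrec : ∀ (k : ℕ) j, R.op (F (k + 1)) j - (k + 1) * F (k + 1) j =
      -((k + 1) * (D.pt j * F (k + 1 + 1) j)) := fun k j => by
    have := h3 (k + 1) j
    rw [hp0] at this
    push_cast at this
    linear_combination this
  refine ⟨fun k => F (k + 1), J, hJ, ?_, hrec, ⟨p.eval (D.pt 0), β, fun j => ?_⟩, ?_⟩
  · ext j
    have := hrec J j
    rw [hJ2 (J + 1) (by omega)] at this
    simpa [sub_eq_zero] using this
  · rw [← h4 j, hF0, hp0]
    simp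
  · rintro rfl
    rcases n with _ | n
    · exact hFn
    · exact absurd (hJ2 (n + 1) (by omega)) hFn'

namespace ConvPair

variable (C : ConvPair D E κ)

/-- Injectivity of the recursion operator: `κ - (n + 1)` is non-zero and is neither of the possible
non-zero eigenvalues, so no resonance is met below `κ`. -/
theorem eq_zero_of_op_eq (hκ : NotInt κ)
    (hE : ∀ n : ℕ, κ - (n + 1) ≠ -E.kappa1 ∧ κ - (n + 1) ≠ -E.kappa2) {n : ℕ} {v : Fin 3 → ℂ}
    (hv : C.R'.op v = (κ - (n + 1)) • v) : v = 0 := by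
  by_contra h0
  have hne : κ - (n + 1) ≠ 0 := fun h1 => hκ (n + 1) (by push_cast; linear_combination h1)
  rcases Realization.eigen_cases C.regular' hv h0 hne with ⟨-, h1⟩ | ⟨-, h1, -⟩
  · exact (hE n).1 h1
  · exact (hE n).2 h1

/-- A kernel vector of the residue matrix gives a solution of the second equation at infinity. -/
theorem hasFrobeniusSolutionInfty_of_kernel (hκ : NotInt κ)
    (hE : ∀ n : ℕ, κ - (n + 1) ≠ -E.kappa1 ∧ κ - (n + 1) ≠ -E.kappa2) {x : Fin 3 → ℂ}
    (hx : x ≠ 0) (hx' : C.R.op x = 0) :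
    (∑ j, C.S j * x j ≠ 0 ∧ κ = -E.kappa1 ∧ E.HasFrobeniusSolutionInfty (-κ)) ∨
      (∑ j, C.S j * x j = 0 ∧ κ = -E.kappa2 ∧ E.HasFrobeniusSolutionInfty (1 - κ)) := by
  obtain ⟨G, hG, hrec⟩ := Realization.exists_extension (R := C.R') (K := κ) (J := 0)
    (G := fun _ j => C.S j * x j) (fun n hn => by omega)
    fun n _ v hv => C.eq_zero_of_op_eq hκ hE hv
  have hG0 := hG 0 le_rfl
  have := Realization.hasFrobeniusSolutionInfty C.regular' (fun h0 => hκ 0 (by simpa using h0))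
    (G := G) (K := κ) (by
      rw [hG0]
      intro h0
      refine hx (funext fun j => ?_)
      simpa [C.S_ne_zero j] using congrFun h0 j) (by
      rw [hG0]
      ext j
      rw [C.op_mul, hx']
      simp only [Pi.zero_apply, Pi.smul_apply, smul_eq_mul]
      ring) hrec
  rwa [hG0] at this

/-- A nonconstant polynomial solution of the first equation makes infinity non-logarithmic for the
second one. -/
theorem nonLogarithmicAtInfty (C : ConvPair D E κ) (hκ : NotInt κ) (hk : D.kappa2 ≠ 0)
    (hE : ∀ n : ℕ, κ - (n + 1) ≠ -E.kappa1 ∧ κ - (n + 1) ≠ -E.kappa2)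
    (hdist : D.kappa1 ≠ -1 ∨ κ + 1 ≠ -E.kappa2) {p : Polynomial ℂ}
    (hp : p.natDegree ≠ 0) (hsol : D.IsPolyTypeSolution 0 p) : E.NonLogarithmicAtInfty := by
  obtain ⟨g, J, hJ, hJop, hrec, ⟨α, β, himg⟩, hJ0⟩ := hsol.exists_coeffs_zero C.regular C.R hp
  set ρ : ℂ := -J with hρ
  -- The polynomial Okubo vector read from the top is its expansion at infinity with exponent `ρ =
  -- -J`.
  set F : ℕ → Fin 3 → ℂ := fun n => g (J - n) with hF
  have hF0 : C.R.op (F 0) = (1 - ρ) • F 0 := by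
    simp only [hF, Nat.sub_zero, hJop, hρ]
    congr 1
    ring
  have hFrec : ∀ n < J, ∀ j, C.R.op (F (n + 1)) j + (n + ρ) * F (n + 1) j =
      (n + ρ) * (D.pt j * F n j) := by
    intro n hn j
    obtain ⟨m, rfl⟩ := Nat.exists_eq_add_of_lt hn
    have := hrec m j
    simp only [hF, show n + m + 1 - (n + 1) = m by omega, show n + m + 1 - n = m + 1 by omega, hρ]
    push_cast
    linear_combination this
  have hnρ : ∀ n < J, (n : ℂ) + ρ ≠ 0 := fun n hn h0 => by
    have : (n : ℂ) = J := by rw [hρ] at h0; linear_combination h0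
    exact absurd (Nat.cast_injective this) (by omega)
  have e0 := C.imageInfty_zero hF0
  have e1 := fun n hn => C.imageInfty_rec (hFrec n hn) (hnρ n hn)
  set m := inftyFactor (κ + 1 - ρ) ρ J with hm
  -- At index `J` the factor `n + ρ` vanishes and the convolved recursion needs `op x = -(κ + 1) m
  -- p_j g 0 j`. By `himg` the right side is a combination of `l` and `ρ`, and `op x` depends only
  -- on the two functionals prescribed here.
  obtain ⟨x, hx1, hx2⟩ := C.R.exists_sum_eq C.regular hk ((κ + 1) * m * α) ((κ + 1) * m * β)
  set G : ℕ → Fin 3 → ℂ := fun n => if n ≤ J then C.imageInfty ρ F n else fun j => C.S j * x j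
  have hG0 : G 0 = C.imageInfty ρ F 0 := if_pos (Nat.zero_le _)
  have hGrec : ∀ n < J + 1, ∀ j, C.R'.op (G (n + 1)) j -
      (κ + 1 - ρ - (n + 1)) * G (n + 1) j = -(κ + 1 - ρ - n) * (E.pt j * G n j) := by
    intro n hn j
    rcases Nat.lt_succ_iff_lt_or_eq.1 hn with hn | rfl
    · simp only [G, if_pos hn.le, if_pos (Nat.succ_le_of_lt hn)]
      exact e1 n hn j
    · simp only [G, le_refl, if_true, show ¬ n + 1 ≤ n by omega, if_false]
      rw [C.op_mul, C.imageInfty_apply, ← hm, C.pt_eq, Realization.op_apply, hx1, hx2, hρ]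
      simp only [hF, Nat.sub_self]
      linear_combination -(κ + 1) * m * C.S j * himg j
  obtain ⟨G', hG', hG'rec⟩ := Realization.exists_extension hGrec fun n hn v hv => by
    obtain ⟨k, rfl⟩ := Nat.exists_eq_add_of_le hn
    refine C.eq_zero_of_op_eq hκ hE (n := k) ?_
    rw [hv, hρ]
    congr 1
    push_cast
    ring
  have hG'0 : G' 0 = C.imageInfty ρ F 0 := (hG' 0 (Nat.zero_le _)).trans hG0
  have hF0ne : C.imageInfty ρ F 0 ≠ 0 := by
    intro h0
    refine hJ (funext fun j => ?_)
    have := congrFun h0 j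
    rw [C.imageInfty_apply, inftyFactor_zero] at this
    simpa [C.S_ne_zero j, hF] using this
  have hne : κ + 1 - ρ ≠ 0 := fun h0 => hκ (-1 - J) (by
    rw [hρ] at h0
    push_cast
    linear_combination h0)
  have first := Realization.hasFrobeniusSolutionInfty C.regular' hne (by rwa [hG'0])
    (by rw [hG'0, e0]) hG'rec
  -- A kernel vector of the old matrix has eigenvalue `κ` for the new one and starts a second
  -- solution.
  obtain ⟨y, hy0, -, hy⟩ := C.R.exists_op_eq_zero C.regular hk
  have second := C.hasFrobeniusSolutionInfty_of_kernel hκ hE hy0 hy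
  have hcast : ∀ k : ℕ, (J : ℂ) + (k + 1) ≠ 0 := fun k => by
    exact_mod_cast (by omega : J + (k + 1) ≠ 0)
  rcases first with ⟨-, f1, f2⟩ | ⟨-, f1, f2⟩ <;> rcases second with ⟨-, s1, s2⟩ | ⟨-, s1, s2⟩
  · refine ⟨_, _, fun he => hcast 0 ?_, f2, s2⟩
    rw [hρ] at he
    push_cast
    linear_combination -he
  · refine ⟨_, _, fun he => hcast 1 ?_, f2, s2⟩
    rw [hρ] at he
    push_cast
    linear_combination -he
  -- The only possible coincidence of exponents is at `J = 0`; `hdist` excludes it through the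
  -- eigenvalue of `g 0` or directly through `κ̃₂`.
  · refine ⟨_, _, fun he => ?_, f2, s2⟩
    rw [hρ] at he
    have hJz : J = 0 := by
      have : (J : ℂ) = 0 := by linear_combination -he
      exact_mod_cast this
    subst hJz
    rcases hdist with hd | hd
    · rcases Realization.eigen_cases C.regular hJop hJ (by simp) with ⟨-, h1⟩ | ⟨h1, -⟩
      · refine hd ?_
        push_cast at h1
        linear_combination h1
      · exact hJ0 rfl h1
    · refine hd ?_
      rw [← f1, hρ]
      simp
  · refine ⟨_, _, fun he => hcast 0 ?_, f2, s2⟩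
    rw [hρ] at he
    push_cast
    linear_combination -he

end ConvPair

end LinP6

end

/-! ### Transfer of solutions from the dual equation. -/

noncomputable section

namespace LinP6

variable {D : LinP6}

theorem hasDerivAt_exp_sum {U : Set ℂ} (hU : IsOpen U) {ℓ : Fin 3 → ℂ → ℂ} {p : Fin 3 → ℂ}
    (hℓ : ∀ i, IsLogBranch U (p i) (ℓ i)) (s : Fin 3 → ℂ) {z : ℂ} (hz : z ∈ U) :
    HasDerivAt (fun z => Complex.exp (∑ i, s i * ℓ i z))
      ((∑ i, s i / (z - p i)) * Complex.exp (∑ i, s i * ℓ i z)) z := by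
  have : HasDerivAt (fun z => ∑ i, s i * ℓ i z) (∑ i, s i / (z - p i)) z :=
    HasDerivAt.fun_sum fun i _ => (((hℓ i).hasDerivAt hU hz).const_mul (s i)).congr_deriv (by ring)
  exact this.cexp.congr_deriv (mul_comm _ _)

theorem IsPolyTypeSolution.of_dual (h : D.Regular) {ρ : Fin 3 → ℂ} {p : Polynomial ℂ}
    (hsol : D.dual.IsPolyTypeSolution ρ p) : D.IsPolyTypeSolution (ρ + D.θ) p := by
  intro U ℓ hU hl hℓ
  refine (IsSolutionOn.of_dual h hU (fun z hz j => (hℓ j).ne hz) hl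
    (fun z hz => hasDerivAt_exp_sum hU hℓ D.θ hz) (hsol U ℓ hU hl hℓ)).congr hU fun z _ => ?_
  simp only [Pi.add_apply, add_mul, Finset.sum_add_distrib, Complex.exp_add]
  ring

/-- Near `p_i` the factors `(z - p_j)^θ_j` with `j ≠ i` have non-vanishing analytic branches, which
are absorbed into `g`. -/
theorem HasFrobeniusSolution.of_dual (h : D.Regular) {i : Fin 3} {ρ : ℂ}
    (hf : D.dual.HasFrobeniusSolution i ρ) : D.HasFrobeniusSolution i (ρ + D.θ i) := by
  obtain ⟨g, r, hg, hg0, hr, hsol⟩ := hf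
  obtain ⟨r', hr', hb⟩ := h.exists_ball i
  have hL : ∀ j, ∃ L : ℂ → ℂ, j ≠ i → IsLogBranch (Metric.ball (D.pt i) ‖D.pt i - D.pt j‖)
      (D.pt j) L := fun j => by
    by_cases hj : j = i
    · exact ⟨0, fun h => absurd hj h⟩
    · obtain ⟨L, hL⟩ := exists_isLogBranch (h.pt_injective.ne (Ne.symm hj))
      exact ⟨L, fun _ => hL⟩
  choose L hL using hL
  have hpos : ∀ j, j ≠ i → 0 < ‖D.pt i - D.pt j‖ := fun j hj =>
    norm_pos_iff.2 (sub_ne_zero.2 (h.pt_injective.ne hj.symm))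
  have hball : ∀ j, j ≠ i → Metric.ball (D.pt i) r' ⊆ Metric.ball (D.pt i) ‖D.pt i - D.pt j‖ := by
    intro j hj
    refine Metric.ball_subset_ball (not_lt.1 fun hlt => ?_)
    refine (hb (D.pt j) ⟨?_, fun hji => hj (h.pt_injective hji)⟩).1 j rfl
    rwa [Metric.mem_ball, dist_comm, dist_eq_norm]
  refine ⟨fun z => Complex.exp (∑ j ∈ Finset.univ.erase i, D.θ j * L j z) * g z, min r r', ?_, ?_,
    lt_min hr hr', fun U ℓ hU hUb hℓ => ?_⟩
  · have han : ∀ j ∈ Finset.univ.erase i, AnalyticAt ℂ (fun z => D.θ j * L j z) (D.pt i) :=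
      fun j hj => analyticAt_const.mul ((hL j (Finset.ne_of_mem_erase hj)).1.analyticAt
        (Metric.ball_mem_nhds _ (hpos j (Finset.ne_of_mem_erase hj))))
    exact (Finset.analyticAt_fun_sum _ han).cexp.mul hg
  · exact mul_ne_zero (Complex.exp_ne_zero _) hg0
  · have hU1 : U ⊆ Metric.ball (D.pt i) r \ {D.pt i} := fun z hz =>
      ⟨Metric.ball_subset_ball (min_le_left _ _) (hUb hz).1, (hUb hz).2⟩
    have hU2 : U ⊆ Metric.ball (D.pt i) r' \ {D.pt i} := fun z hz =>
      ⟨Metric.ball_subset_ball (min_le_right _ _) (hUb hz).1, (hUb hz).2⟩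
    have hM : ∀ j, IsLogBranch U (D.pt j) (if j = i then ℓ else L j) := fun j => by
      split_ifs with hj
      · rwa [hj]
      · exact (hL j hj).mono fun z hz => hball j hj (hU2 hz).1
    refine (IsSolutionOn.of_dual h hU (fun z hz => (hb z (hU2 hz)).1)
      (fun hl => (hb _ (hU2 hl)).2 rfl) (fun z hz => hasDerivAt_exp_sum hU hM D.θ hz)
      (hsol U ℓ hU hU1 hℓ)).congr hU fun z _ => ?_
    have e : ∑ j, D.θ j * (if j = i then ℓ else L j) z =
        D.θ i * ℓ z + ∑ j ∈ Finset.univ.erase i, D.θ j * L j z := by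
      rw [← Finset.add_sum_erase _ _ (Finset.mem_univ i), if_pos rfl]
      congr 1
      exact Finset.sum_congr rfl fun j hj => by rw [if_neg (Finset.ne_of_mem_erase hj)]
    rw [e, Complex.exp_add, add_mul, Complex.exp_add]
    ring

/-- Writing `z - p_j = z (1 - p_j / z)`, the second factor has an analytic power at infinity, while
the powers of `z` lower the exponent by `∑ θ_j`. -/
theorem HasFrobeniusSolutionInfty.of_dual (h : D.Regular) {ρ : ℂ}
    (hf : D.dual.HasFrobeniusSolutionInfty ρ) :
    D.HasFrobeniusSolutionInfty (ρ - ∑ j, D.θ j) := by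
  obtain ⟨g, r, hg, hg0, hr, hsol⟩ := hf
  refine ⟨fun u => Complex.exp (∑ j, D.θ j * Complex.log (1 - D.pt j * u)) * g u,
    r + (∑ j, ‖D.pt j‖ + ‖D.lam‖), ?_, ?_, by positivity, fun U ℓ hU hUr hℓ => ?_⟩
  · refine AnalyticAt.mul (AnalyticAt.cexp (Finset.analyticAt_fun_sum _ fun j _ => ?_)) hg
    refine analyticAt_const.mul (AnalyticAt.clog (by fun_prop) (by simp))
  · exact mul_ne_zero (Complex.exp_ne_zero _) hg0
  · have hpt : ∀ z ∈ U, ∀ j, ‖D.pt j‖ < ‖z‖ := fun z hz j => by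
      have h1 : r + (∑ j, ‖D.pt j‖ + ‖D.lam‖) < ‖z‖ := hUr hz
      have h2 := Finset.single_le_sum (f := fun j => ‖D.pt j‖) (fun j _ => norm_nonneg _)
        (Finset.mem_univ j)
      have h3 := norm_nonneg D.lam
      linarith
    have hlam : ∀ z ∈ U, ‖D.lam‖ < ‖z‖ := fun z hz => by
      have h1 : r + (∑ j, ‖D.pt j‖ + ‖D.lam‖) < ‖z‖ := hUr hz
      have h2 := Finset.sum_nonneg (f := fun j => ‖D.pt j‖) fun j (_ : j ∈ Finset.univ) =>
        norm_nonneg _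
      linarith
    have hz0 : ∀ z ∈ U, z ≠ 0 := fun z hz => by simpa using hℓ.ne hz
    have hU1 : U ⊆ {z | r < ‖z‖} := fun z hz => by
      have h1 : r + (∑ j, ‖D.pt j‖ + ‖D.lam‖) < ‖z‖ := hUr hz
      have h2 : 0 ≤ ∑ j, ‖D.pt j‖ + ‖D.lam‖ := by positivity
      show r < ‖z‖
      linarith
    have hslit : ∀ z ∈ U, ∀ j, 1 - D.pt j * z⁻¹ ∈ Complex.slitPlane := fun z hz j => by
      refine Or.inl ?_
      have h1 : ‖D.pt j * z⁻¹‖ < 1 := by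
        rw [norm_mul, norm_inv, ← div_eq_mul_inv, div_lt_one (norm_pos_iff.2 (hz0 z hz))]
        exact hpt z hz j
      have h2 := (Complex.re_le_norm (D.pt j * z⁻¹)).trans_lt h1
      rw [Complex.sub_re, Complex.one_re]
      linarith
    have hM : ∀ j, IsLogBranch U (D.pt j) (fun z => ℓ z + Complex.log (1 - D.pt j * z⁻¹)) := by
      intro j
      refine ⟨hℓ.1.add (DifferentiableOn.clog ?_ fun z hz => hslit z hz j), fun z hz => ?_⟩
      · exact (differentiableOn_const 1).sub ((differentiableOn_const _).mul
          (differentiableOn_id.inv hz0))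
      · rw [Complex.exp_add, hℓ.2 z hz, Complex.exp_log (Complex.slitPlane_ne_zero (hslit z hz j))]
        have := hz0 z hz
        field_simp
        ring
    refine (IsSolutionOn.of_dual h hU (fun z hz j he => ?_) (fun hl => (hlam _ hl).false)
      (fun z hz => hasDerivAt_exp_sum hU hM D.θ hz) (hsol U ℓ hU hU1 hℓ)).congr hU fun z _ => ?_
    · exact (hpt z hz j).ne (by rw [he])
    · have e : -(ρ - ∑ j, D.θ j) * ℓ z = -ρ * ℓ z + ∑ j, D.θ j * ℓ z := by
        rw [← Finset.sum_mul]
        ring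
      simp only [mul_add, Finset.sum_add_distrib]
      rw [e, Complex.exp_add, Complex.exp_add]
      ring

end LinP6

end

/-! ### The eight implications. -/

noncomputable section

namespace LinP6

variable {D : LinP6}

theorem IsPolyTypeSolution.dual (h : D.Regular) {ρ : Fin 3 → ℂ} {p : Polynomial ℂ}
    (hsol : D.IsPolyTypeSolution ρ p) : D.dual.IsPolyTypeSolution (ρ - D.θ) p := by
  have : D.dual.dual.IsPolyTypeSolution ρ p := by rwa [dual_dual]
  have h2 := this.of_dual h.dual
  rwa [show ρ + D.dual.θ = ρ - D.θ from (sub_eq_add_neg _ _).symm] at h2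

theorem HasFrobeniusSolution.dual (h : D.Regular) {i : Fin 3} {ρ : ℂ}
    (hf : D.HasFrobeniusSolution i ρ) : D.dual.HasFrobeniusSolution i (ρ - D.θ i) := by
  have : D.dual.dual.HasFrobeniusSolution i ρ := by rwa [dual_dual]
  have h2 := this.of_dual h.dual
  rwa [show ρ + D.dual.θ i = ρ - D.θ i from (sub_eq_add_neg _ _).symm] at h2

theorem HasFrobeniusSolutionInfty.dual (h : D.Regular) {ρ : ℂ}
    (hf : D.HasFrobeniusSolutionInfty ρ) :
    D.dual.HasFrobeniusSolutionInfty (ρ + ∑ j, D.θ j) := by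
  have : D.dual.dual.HasFrobeniusSolutionInfty ρ := by rwa [dual_dual]
  have h2 := this.of_dual h.dual
  have e : ∑ j, D.dual.θ j = -∑ j, D.θ j := Finset.sum_neg_distrib _
  rwa [e, sub_neg_eq_add] at h2

theorem NonLogarithmicAt.of_dual (h : D.Regular) {i : Fin 3} (hn : D.dual.NonLogarithmicAt i) :
    D.NonLogarithmicAt i := by
  obtain ⟨ρ, σ, hne, h1, h2⟩ := hn
  exact ⟨_, _, fun he => hne (add_right_cancel he), h1.of_dual h, h2.of_dual h⟩

theorem NonLogarithmicAtInfty.of_dual (h : D.Regular) (hn : D.dual.NonLogarithmicAtInfty) :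
    D.NonLogarithmicAtInfty := by
  obtain ⟨ρ, σ, hne, h1, h2⟩ := hn
  exact ⟨_, _, fun he => hne (sub_left_injective he), h1.of_dual h, h2.of_dual h⟩

theorem single_sub_theta {a b c : Fin 3} (hab : a ≠ b) (hbc : b ≠ c) (hca : c ≠ a)
    (θ : Fin 3 → ℂ) : Pi.single b (θ b) + Pi.single c (θ c) - θ = Pi.single a (-θ a) := by
  ext j
  have : j = a ∨ j = b ∨ j = c := by omega
  rcases this with rfl | rfl | rfl
  · simp [hab, hca.symm]
  · simp [hbc, hab.symm]
  · simp [hca, hbc.symm]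

/-- The Frobenius solution with exponent `θ_a = -n` truncates under convolution. -/
theorem exists_polyType_of_neg (h : D.Regular) (h' : D.tilde.Regular)
    (hden : D.tildeDenom ≠ 0) (hκ : NotInt D.kappa2) {a : Fin 3} {n : ℕ} (hn : n ≠ 0) (hθ : D.θ a = -n)
    (hlog : D.NonLogarithmicAt a) :
    ∃ p : Polynomial ℂ, p ≠ 0 ∧ D.tilde.IsPolyTypeSolution (Pi.single a (D.tilde.θ a)) p ∧
      p.natDegree + 1 ≤ n ∧ (NotInt D.kappa1 → p.natDegree + 1 = n) := by
  have hk : D.kappa2 ≠ 0 := fun h0 => hκ 0 (by simpa using h0)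
  have hf := (hlog.frobenius h).2.2
  rw [hθ] at hf
  obtain ⟨G, h0, hG0, hrec, hG, hGn⟩ := (tildePair h h' hden hk).exists_finite hn hκ hf
  have hb : ∑ j, G n j = 0 := by simpa [tildePair] using hGn
  have hsol := Realization.isPolyTypeSolution h' (fun j => by rw [h0 j, mul_zero]) hrec
    (hG (n + 1) (by omega))
  have hK : D.kappa2 - n = D.tilde.θ a := by
    change _ = D.kappa2 + D.θ a
    rw [hθ]
    ring
  obtain ⟨d, hdn, hd, hd'⟩ := exists_last_ne_zero (b := fun k => ∑ j, G k j) (Nat.zero_le n) hG0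
  obtain ⟨hp, hdeg⟩ := natDegree_shiftedPolynomial (a := D.tilde.pt a) hdn hd hd'
  -- The coefficient at `n` has sum zero because the Euler factor `n + ρ` vanishes there; hence the
  -- degree is at most `n - 1`.
  have hdlt : d ≠ n := fun hdn => hd (hdn ▸ hb)
  refine ⟨_, hp, hK ▸ hsol, by omega, fun hκ1 => ?_⟩
  rw [hdeg]
  have hG0' : G 0 ≠ 0 := fun h1 => hG0 (by simp [h1])
  obtain ⟨J, hJn, hJ, hJ'⟩ := exists_last_ne_zero (Nat.zero_le n) hG0'
  have hJ1 : G (J + 1) = 0 := by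
    rcases Nat.lt_or_ge n (J + 1) with hlt | hge
    · exact hG _ hlt
    · exact hJ' _ (Nat.lt_succ_self J) hge
  have hKJ : D.kappa2 - n + J ≠ 0 := fun h1 => hκ (n - J) (by push_cast; linear_combination h1)
  rcases Realization.sum_top h' hrec hJ1 hJ hKJ with ⟨-, h1⟩ | ⟨-, h1, h2⟩
  · rw [tilde_kappa1] at h1
    exact absurd (by push_cast; linear_combination h1) (hκ1 (n - J))
  -- The eigenvalue forces the top index to be `n`, and then `sum_top` makes the preceding
  -- coefficient sum non-zero.
  · rw [tilde_kappa2] at h1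
    have hJn : (J : ℂ) = n := by linear_combination h1
    obtain rfl : J = n := by exact_mod_cast hJn
    obtain ⟨k, rfl⟩ := Nat.exists_eq_succ_of_ne_zero hn
    by_contra hne
    exact h2 k rfl (hd' k (by omega) (by omega))

/-- The exponent `0` at `a` becomes `-n` for the dual equation. There the top eigenvector has
non-zero sum, so no degree is lost. -/
theorem exists_polyType_of_nonneg (h : D.Regular) (h' : D.tilde.Regular)
    (hden : D.tildeDenom ≠ 0) (hκ : NotInt D.kappa2) {a b c : Fin 3} (hab : a ≠ b) (hbc : b ≠ c) (hca : c ≠ a)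
    (hκ1 : NotInt D.kappa1) {n : ℕ} (hθ : D.θ a = n) (hlog : D.NonLogarithmicAt a) :
    ∃ p : Polynomial ℂ, p ≠ 0 ∧ D.tilde.IsPolyTypeSolution
      (Pi.single b (D.tilde.θ b) + Pi.single c (D.tilde.θ c)) p ∧ p.natDegree = n := by
  have hk : D.kappa2 ≠ 0 := fun h0 => hκ 0 (by simpa using h0)
  have hκ' : NotInt (-D.kappa2) := fun m hm => hκ (-m) (by push_cast; linear_combination -hm)
  obtain ⟨hθ0, hf0, -⟩ := hlog.frobenius h
  have hn : n ≠ 0 := by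
    rintro rfl
    exact hθ0 (by simpa using hθ)
  have hf := hf0.dual h
  rw [hθ, zero_sub] at hf
  obtain ⟨G, h0, hG0, hrec, hG, -⟩ := (tildePair h h' hden hk).dual.exists_finite hn hκ' hf
  have hsol := Realization.isPolyTypeSolution h'.dual (fun j => by rw [h0 j, mul_zero]) hrec
    (hG (n + 1) (by omega))
  have hG0' : G 0 ≠ 0 := fun h1 => hG0 (by simp [h1])
  obtain ⟨J, hJn, hJ, hJ'⟩ := exists_last_ne_zero (Nat.zero_le n) hG0'
  have hJ1 : G (J + 1) = 0 := by
    rcases Nat.lt_or_ge n (J + 1) with hlt | hge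
    · exact hG _ hlt
    · exact hJ' _ (Nat.lt_succ_self J) hge
  have hKJ : -D.kappa2 - n + J ≠ 0 := fun h1 => hκ (J - n) (by push_cast; linear_combination -h1)
  have hGn : ∑ j, G n j ≠ 0 := by
    rcases Realization.sum_top h'.dual hrec hJ1 hJ hKJ with ⟨h1, h2⟩ | ⟨-, h2, -⟩
    · rw [dual_kappa1, tilde_kappa2] at h2
      have hJn : (J : ℂ) = n := by linear_combination h2
      obtain rfl : J = n := by exact_mod_cast hJn
      exact h1
    · rw [dual_kappa2, tilde_kappa1] at h2
      exact absurd (by push_cast; linear_combination -h2) (hκ1 (J - n))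
  obtain ⟨hp, hdeg⟩ := natDegree_shiftedPolynomial (a := D.tilde.dual.pt a)
    (b := fun k => ∑ j, G k j) le_rfl hGn fun k hk hk' => by omega
  refine ⟨_, hp, ?_, hdeg⟩
  have hK : -D.kappa2 - n = -D.tilde.θ a := by
    change _ = -(D.kappa2 + D.θ a)
    rw [hθ]
    ring
  rw [hK] at hsol
  have := hsol.of_dual h'
  rwa [← single_sub_theta hab hbc hca, sub_add_cancel] at this

theorem nonLogarithmicAt_of_nonpos (h : D.Regular) (h' : D.tilde.Regular)
    (hden : D.tildeDenom ≠ 0) (hκ : NotInt D.kappa2) {a : Fin 3} {n : ℕ} (hinf : NotInt D.θinf)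
    (hθ : D.tilde.θ a = -n) {p : Polynomial ℂ} (hp : p ≠ 0)
    (hsol : D.IsPolyTypeSolution (Pi.single a (D.θ a)) p) : D.tilde.NonLogarithmicAt a := by
  have hk : D.kappa2 ≠ 0 := fun h0 => hκ 0 (by simpa using h0)
  refine (tildePair h h' hden hk).nonLogarithmicAt hκ (Or.inr rfl) hinf ?_ ?_ hθ hp hsol
  · rw [tilde_kappa1, kappa1_sub_kappa2]
    exact fun h0 => hinf 0 (by simpa using h0)
  · rw [tilde_kappa2]
    exact neg_ne_zero.2 hk

theorem nonLogarithmicAt_of_pos (h : D.Regular) (h' : D.tilde.Regular)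
    (hden : D.tildeDenom ≠ 0) (hκ : NotInt D.kappa2) {a b c : Fin 3} (hab : a ≠ b) (hbc : b ≠ c) (hca : c ≠ a) {n : ℕ}
    (hinf : NotInt D.θinf) (hθ : D.tilde.θ a = n) {p : Polynomial ℂ} (hp : p ≠ 0)
    (hsol : D.IsPolyTypeSolution (Pi.single b (D.θ b) + Pi.single c (D.θ c)) p) :
    D.tilde.NonLogarithmicAt a := by
  have hk : D.kappa2 ≠ 0 := fun h0 => hκ 0 (by simpa using h0)
  have hκ' : NotInt (-D.kappa2) := fun m hm => hκ (-m) (by push_cast; linear_combination -hm)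
  have hs := hsol.dual h
  rw [single_sub_theta hab hbc hca] at hs
  refine NonLogarithmicAt.of_dual h' ?_
  refine (tildePair h h' hden hk).dual.nonLogarithmicAt (n := n) hκ' (Or.inl dual_kappa1.symm)
    hinf ?_ ?_ ?_ hp hs
  · rw [dual_kappa1, tilde_kappa2, neg_neg]
    exact hk
  · rw [dual_kappa2, tilde_kappa1, kappa1_sub_kappa2]
    exact neg_ne_zero.2 fun h0 => hinf 0 (by simpa using h0)
  · change -D.tilde.θ a = _
    rw [hθ]

/-- The solution with exponent `κ₁` truncates at `N = n + 1`. Its leading vector carries the factor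
`κ₁ - ρ = 0`, so the degree is one less. -/
theorem exists_polynomial_of_nonpos (h : D.Regular) (h' : D.tilde.Regular)
    (hden : D.tildeDenom ≠ 0) (hκ : NotInt D.kappa2) {n : ℕ} (hθ : D.θinf = -n) (hlog : D.NonLogarithmicAtInfty) :
    ∃ p : Polynomial ℂ, p ≠ 0 ∧ D.tilde.IsPolyTypeSolution 0 p ∧ p.natDegree = n := by
  have hk : D.kappa2 ≠ 0 := fun h0 => hκ 0 (by simpa using h0)
  have hd := D.kappa1_sub_kappa2
  have hκ1 : NotInt D.kappa1 := fun m hm => hκ (m + n) (by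
    push_cast
    linear_combination hm - hd - hθ)
  have hk1 : D.kappa1 ≠ 0 := fun h0 => hκ1 0 (by simpa using h0)
  obtain ⟨B, g, hg, hrec, hB, hBN, hBM⟩ := (tildePair h h' hden hk).exists_finite_infty
    (N := n + 1) hκ1 (by push_cast; linear_combination -hd - hθ) (hlog.frobenius h).2.1
  obtain ⟨s, hs, w, hw, hws⟩ := hBM n rfl
  have hsol := Realization.isPolyTypeSolution h' (fun j => by rw [zero_mul]) hrec
    (hB (n + 1 + 1) (by omega))
  rw [Pi.single_zero] at hsol
  obtain ⟨hp, hdeg⟩ := natDegree_shiftedPolynomial (a := D.tilde.pt 0)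
    (b := fun k => ∑ j, B k j) (d := n) (n := n + 1) (by omega) (by
      have e : ∑ j, B n j = s * ∑ j, w j := by
        rw [Finset.mul_sum]
        exact Finset.sum_congr rfl fun j _ => by rw [hw j]; simp [tildePair]
      rw [e, hws]
      simp [hs, hg, hk1]) fun k hk hk' => by
      obtain rfl : k = n + 1 := by omega
      simp [hBN]
  exact ⟨_, hp, hsol, hdeg⟩

/-- The exponent `κ₂ + 1` becomes `1 - κ₁` for the dual equation, and the series truncates at `N =
n`. Its top vector is a non-zero multiple of `ρ` up to gauge, since `κ₁ ≠ κ₂ + 1`; its sum vanishes,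
whence degree `n - 1`. -/
theorem exists_polyType_of_pos (h : D.Regular) (h' : D.tilde.Regular)
    (hden : D.tildeDenom ≠ 0) (hκ : NotInt D.kappa2) {n : ℕ} (hn : n ≠ 0) (hθ : D.θinf = n) (hlog : D.NonLogarithmicAtInfty) :
    ∃ p : Polynomial ℂ, p ≠ 0 ∧ D.tilde.IsPolyTypeSolution D.tilde.θ p ∧ p.natDegree + 1 = n := by
  have hk : D.kappa2 ≠ 0 := fun h0 => hκ 0 (by simpa using h0)
  have hd := D.kappa1_sub_kappa2
  have hsum : D.kappa1 + D.kappa2 = -∑ j, D.θ j := by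
    simp only [kappa1, kappa2, Fin.sum_univ_three]
    ring
  obtain ⟨hne, -, hf⟩ := hlog.frobenius h
  have hf' := hf.dual h
  rw [show D.kappa2 + 1 + ∑ j, D.θ j = 1 - D.kappa1 by linear_combination hsum] at hf'
  have hρ : NotInt (1 - D.kappa1) := fun m hm => hκ (1 - m - n) (by
    push_cast
    linear_combination -hm - hd - hθ)
  obtain ⟨B, g, hg, hrec, hB, hBN, -⟩ := (tildePair h h' hden hk).dual.exists_finite_infty
    (N := n) hρ (by linear_combination hd + hθ) hf'
  have hn1 : ((n : ℂ) - 1) ≠ 0 := fun h1 => hne (by linear_combination hd + hθ + h1)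
  have hBn : B n ≠ 0 := fun h0 => by
    have := congrFun h0 0
    rw [hBN 0, dual_kappa1, show -D.kappa2 - (1 - D.kappa1) = n - 1 by
      linear_combination hd + hθ] at this
    simp only [Pi.zero_apply, mul_eq_zero, hn1, hg, ConvPair.S_ne_zero, h.dual.rho_ne_zero 0,
      or_self] at this
  have hsol := Realization.isPolyTypeSolution h'.dual (fun j => by rw [zero_mul]) hrec
    (hB (n + 1) (by omega))
  rw [Pi.single_zero] at hsol
  have hsol' := hsol.of_dual h'
  rw [zero_add] at hsol'
  obtain ⟨M, rfl⟩ := Nat.exists_eq_succ_of_ne_zero hn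
  rcases Realization.sum_top h'.dual hrec (hB _ (Nat.lt_succ_self _)) hBn
    (by rw [zero_add]; exact Nat.cast_ne_zero.2 hn) with ⟨-, h1⟩ | ⟨h1, -, h2⟩
  · rw [dual_kappa1, tilde_kappa2] at h1
    exact absurd (by push_cast at h1 ⊢; linear_combination h1) (hκ (-(M + 1)))
  · obtain ⟨hp, hdeg⟩ := natDegree_shiftedPolynomial (a := D.tilde.dual.pt 0)
      (b := fun k => ∑ j, B k j) (d := M) (n := M + 1) (by omega) (h2 M rfl) fun k hk hk' => by
        obtain rfl : k = M + 1 := by omega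
        exact h1
    exact ⟨_, hp, hsol', by omega⟩

theorem nonLogarithmicAtInfty_of_nonpos (h : D.Regular) (h' : D.tilde.Regular)
    (hden : D.tildeDenom ≠ 0) (hκ : NotInt D.kappa2) {n : ℕ} (hκ1 : D.kappa1 = -n) {p : Polynomial ℂ}
    (hp : p ≠ 0) (hsol : D.IsPolyTypeSolution 0 p) : D.tilde.NonLogarithmicAtInfty := by
  have hk : D.kappa2 ≠ 0 := fun h0 => hκ 0 (by simpa using h0)
  have hE : ∀ k : ℕ, D.kappa2 - (k + 1) ≠ -D.tilde.kappa1 ∧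
      D.kappa2 - (k + 1) ≠ -D.tilde.kappa2 := fun k => by
    rw [tilde_kappa1, tilde_kappa2, hκ1]
    refine ⟨fun h1 => ?_, fun h1 => ?_⟩
    · have : ((n + (k + 1) : ℕ) : ℂ) = 0 := by push_cast; linear_combination -h1
      exact absurd this (Nat.cast_ne_zero.2 (by omega))
    · have : ((k + 1 : ℕ) : ℂ) = 0 := by push_cast; linear_combination -h1
      exact absurd this (Nat.cast_ne_zero.2 (by omega))
  by_cases hdeg : p.natDegree = 0
  -- A constant solution forces `μ = κ₁ = 0`, so `l = 0` in the canonical realization and the kernel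
  -- of `op` contains vectors of sum `1` and of sum `0`. They give the two exponents.
  · obtain ⟨hmu, hq⟩ := hsol.mu_eq_zero h hp hdeg
    have hκ10 : D.kappa1 = 0 := (mul_eq_zero.1 hq).resolve_right fun h1 =>
      hκ (-1) (by push_cast; linear_combination h1)
    set C := tildePair h h' hden hk with hC
    obtain ⟨x, hx1, hx2⟩ := C.R.exists_sum_eq h hk 1 0
    obtain ⟨y, hy0, hy1, hy2⟩ := C.R.exists_op_eq_zero h hk
    have hS : ∀ v : Fin 3 → ℂ, ∑ j, C.S j * v j = ∑ j, v j := fun v => by simp [hC, tildePair]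
    have hxop : C.R.op x = 0 := by
      ext i
      rw [Realization.op_apply, hx2, mul_zero, add_zero]
      simp [hC, tildePair, Realization.canonical, hmu, hκ10]
    have hx0 : x ≠ 0 := by
      rintro rfl
      simp at hx1
    rcases C.hasFrobeniusSolutionInfty_of_kernel hκ hE hx0 hxop with ⟨-, -, f⟩ | ⟨h1, -⟩
    · rcases C.hasFrobeniusSolutionInfty_of_kernel hκ hE hy0 hy2 with ⟨h1, -⟩ | ⟨-, -, f'⟩
      · exact absurd ((hS y).trans hy1) h1
      · exact ⟨_, _, fun he => one_ne_zero (α := ℂ) (by linear_combination -he), f, f'⟩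
    · rw [hS, hx1] at h1
      exact absurd h1 one_ne_zero
  · refine (tildePair h h' hden hk).nonLogarithmicAtInfty hκ hk hE (Or.inr ?_) hdeg hsol
    rw [tilde_kappa2, neg_neg]
    simp

theorem nonLogarithmicAtInfty_of_pos (h : D.Regular) (h' : D.tilde.Regular)
    (hden : D.tildeDenom ≠ 0) (hκ : NotInt D.kappa2) {n : ℕ} (hn : n ≠ 0) (hκ1 : D.kappa1 = n)
    {p : Polynomial ℂ} (hp : p ≠ 0) (hsol : D.IsPolyTypeSolution D.θ p) :
    D.tilde.NonLogarithmicAtInfty := by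
  have hk : D.kappa2 ≠ 0 := fun h0 => hκ 0 (by simpa using h0)
  have hκ' : NotInt (-D.kappa2) := fun m hm => hκ (-m) (by push_cast; linear_combination -hm)
  have hs := hsol.dual h
  rw [sub_self] at hs
  -- A constant solution of the dual equation would make its `μ`, the denominator of `λ̃`, vanish.
  have hdeg : p.natDegree ≠ 0 := fun hdeg => hden (by
    rw [← dual_mu]
    exact (hs.mu_eq_zero h.dual hp hdeg).1)
  refine NonLogarithmicAtInfty.of_dual h' ?_
  refine (tildePair h h' hden hk).dual.nonLogarithmicAtInfty hκ' ?_ (fun k => ?_) (Or.inl ?_)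
    hdeg hs
  · rw [dual_kappa2, hκ1]
    exact neg_ne_zero.2 (Nat.cast_ne_zero.2 hn)
  · rw [dual_kappa1, dual_kappa2, tilde_kappa1, tilde_kappa2, hκ1]
    refine ⟨fun h1 => ?_, fun h1 => ?_⟩
    · have : ((k + 1 : ℕ) : ℂ) = 0 := by push_cast; linear_combination -h1
      exact absurd this (Nat.cast_ne_zero.2 (by omega))
    · have : ((n + (k + 1) : ℕ) : ℂ) = 0 := by push_cast; linear_combination -h1
      exact absurd this (Nat.cast_ne_zero.2 (by omega))
  · rw [dual_kappa1]
    exact fun h1 => hκ' (-1) (by push_cast; exact h1)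

end LinP6

end

theorem mainTheorem2 (D : LinP6) (ht0 : D.t ≠ 0) (ht1 : D.t ≠ 1)
    (hlam : ∀ i, D.lam ≠ D.pt i)
    (hden : D.tildeDenom ≠ 0) (hlamTilde : ∀ i, D.lamTilde ≠ D.pt i)
    (a b c : Fin 3) (hab : a ≠ b) (hbc : b ≠ c) (hca : c ≠ a) :
    -- (i)
    (∀ m : ℤ, m ≤ -1 → D.θ a = m → NotInt D.kappa2 → D.NonLogarithmicAt a →
      ∃ h : Polynomial ℂ, h ≠ 0 ∧ D.tilde.IsPolyTypeSolution (Pi.single a (D.tilde.θ a)) h ∧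
        (h.natDegree : ℤ) ≤ -m - 1 ∧ (NotInt D.kappa1 → (h.natDegree : ℤ) = -m - 1)) ∧
    -- (ii)
    (∀ m : ℤ, 0 ≤ m → D.θ a = m → NotInt D.kappa1 → NotInt D.kappa2 →
      NotInt (D.tilde.θ b) → NotInt (D.tilde.θ c) → D.NonLogarithmicAt a →
      ∃ h : Polynomial ℂ, h ≠ 0 ∧
        D.tilde.IsPolyTypeSolution
          (Pi.single b (D.tilde.θ b) + Pi.single c (D.tilde.θ c)) h ∧
        (h.natDegree : ℤ) = m) ∧
    -- (iii)
    (∀ m : ℤ, m ≤ 0 → D.tilde.θ a = m → NotInt D.kappa2 → NotInt D.θinf →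
      (∃ h : Polynomial ℂ, h ≠ 0 ∧ D.IsPolyTypeSolution (Pi.single a (D.θ a)) h) →
      D.tilde.NonLogarithmicAt a) ∧
    -- (iv)
    (∀ m : ℤ, 1 ≤ m → D.tilde.θ a = m → NotInt D.kappa2 → NotInt D.θinf →
      NotInt (D.θ b) → NotInt (D.θ c) →
      (∃ h : Polynomial ℂ, h ≠ 0 ∧
        D.IsPolyTypeSolution (Pi.single b (D.θ b) + Pi.single c (D.θ c)) h) →
      D.tilde.NonLogarithmicAt a) ∧
    -- (v)
    (∀ m : ℤ, m ≤ 0 → D.θinf = m → NotInt D.kappa2 → D.NonLogarithmicAtInfty →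
      ∃ h : Polynomial ℂ, h ≠ 0 ∧ D.tilde.IsPolyTypeSolution 0 h ∧
        (h.natDegree : ℤ) = -m) ∧
    -- (vi)
    (∀ m : ℤ, 1 ≤ m → D.θinf = m → NotInt D.kappa2 → (∀ i, NotInt (D.tilde.θ i)) →
      D.NonLogarithmicAtInfty →
      ∃ h : Polynomial ℂ, h ≠ 0 ∧ D.tilde.IsPolyTypeSolution D.tilde.θ h ∧
        (h.natDegree : ℤ) = m - 1) ∧
    -- (vii)
    (∀ m : ℤ, m ≤ 0 → D.kappa1 = m → NotInt D.kappa2 → NotInt (D.θ 0) →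
      (∃ h : Polynomial ℂ, h ≠ 0 ∧ D.IsPolyTypeSolution 0 h) →
      D.tilde.NonLogarithmicAtInfty) ∧
    -- (viii)
    (∀ m : ℤ, 1 ≤ m → D.kappa1 = m → NotInt D.kappa2 → (∀ i, NotInt (D.θ i)) →
      (∃ h : Polynomial ℂ, h ≠ 0 ∧ D.IsPolyTypeSolution D.θ h) →
      D.tilde.NonLogarithmicAtInfty) := by
  have h : D.Regular := ⟨ht0, ht1, hlam⟩
  have h' : D.tilde.Regular := ⟨ht0, ht1, hlamTilde⟩
  refine ⟨fun m hm hθ hκ hlog => ?_, fun m hm hθ hκ1 hκ _ _ hlog => ?_,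
    fun m hm hθ hκ hinf ⟨p, hp, hsol⟩ => ?_, fun m hm hθ hκ hinf _ _ ⟨p, hp, hsol⟩ => ?_,
    fun m hm hθ hκ hlog => ?_, fun m hm hθ hκ _ hlog => ?_,
    fun m hm hκ1 hκ _ ⟨p, hp, hsol⟩ => ?_, fun m hm hκ1 hκ _ ⟨p, hp, hsol⟩ => ?_⟩
  · obtain ⟨n, rfl⟩ : ∃ n : ℕ, m = -n := ⟨m.natAbs, by omega⟩
    push_cast at hθ
    obtain ⟨p, hp, hsol, h1, h2⟩ :=
      LinP6.exists_polyType_of_neg h h' hden hκ (by omega) hθ hlog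
    exact ⟨p, hp, hsol, by omega, fun hκ1 => by have := h2 hκ1; omega⟩
  · lift m to ℕ using hm
    obtain ⟨p, hp, hsol, h1⟩ := LinP6.exists_polyType_of_nonneg h h' hden hκ hab hbc hca hκ1
      (by exact_mod_cast hθ) hlog
    exact ⟨p, hp, hsol, by exact_mod_cast h1⟩
  · obtain ⟨n, rfl⟩ : ∃ n : ℕ, m = -n := ⟨m.natAbs, by omega⟩
    push_cast at hθ
    exact LinP6.nonLogarithmicAt_of_nonpos h h' hden hκ hinf hθ hp hsol
  · lift m to ℕ using by omega
    exact LinP6.nonLogarithmicAt_of_pos h h' hden hκ hab hbc hca hinf (by exact_mod_cast hθ) hp hsol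
  · obtain ⟨n, rfl⟩ : ∃ n : ℕ, m = -n := ⟨m.natAbs, by omega⟩
    push_cast at hθ
    obtain ⟨p, hp, hsol, h1⟩ := LinP6.exists_polynomial_of_nonpos h h' hden hκ hθ hlog
    exact ⟨p, hp, hsol, by omega⟩
  · lift m to ℕ using by omega
    obtain ⟨p, hp, hsol, h1⟩ := LinP6.exists_polyType_of_pos h h' hden hκ (n := m) (by omega)
      (by exact_mod_cast hθ) hlog
    exact ⟨p, hp, hsol, by omega⟩
  · obtain ⟨n, rfl⟩ : ∃ n : ℕ, m = -n := ⟨m.natAbs, by omega⟩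
    push_cast at hκ1
    exact LinP6.nonLogarithmicAtInfty_of_nonpos h h' hden hκ hκ1 hp hsol
  · lift m to ℕ using by omega
    exact LinP6.nonLogarithmicAtInfty_of_pos h h' hden hκ (n := m) (by omega)
      (by exact_mod_cast hκ1) hp hsol
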